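/- Let $A$ be an (infinite-dimensional, unital) UHF algebra, $\tau$ its unique tracial state, and identify $K_0(A)$ with $\tau(K_0(A))\subset\mathbb{R}$, so that $[1]=1$. For a prime $p$ let $\zeta(p)\in\{0,1,\dots,\infty\}$ be the supremum of the $k\ge 0$ such that $[1]$ is divisible by $p^k$ in $K_0(A)$; let $\mathcal{P}(A)$ be the set of primes $p$ with $1\le\zeta(p)<\infty$, and put $\theta(p)=p^{\zeta(p)}$ for $p\in\mathcal{P}(A)$. Write $U(B)$ for the unitaries of $B$, $\xi_1=(1,0)$, $\xi_2=(0,1)$, $\alpha_i=\alpha_{\xi_i}$ for an action $\alpha$ of $\mathbb{Z}^2$ on $A$, and $\operatorname{Ad}u(a)=uau^*$. *The invariant.* Let $\alpha,\beta$ be actions of $\mathbb{Z}^2$ on $A$ and $p\in\mathcal{P}(A)$. Choose $0<\delta_0<1/8$ such that for every unital finite-dimensional $C^*$-subalgebra $B\subset A$ and every $w\in U(A)$ with $\|wa-aw\|<\delta_0$ for all $a\in U(B)$ there is a piecewise smooth path $h:[0,1]\to U(A)$ with $h(0)=1$, $h(1)=w$ and $\|h(t)a-ah(t)\|<1/8$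 for all $t\in[0,1]$, $a\in U(B)$. Choose a unital subalgebra $A_0\subset A$ isomorphic to $M_{\theta(p)}(\mathbb{C})$; a unital finite-dimensional $C^*$-subalgebra $A_1\subset A$ such that for every $w\in U(A_0)$ each of $w,\beta_1^{-1}(w),\beta_2^{-1}(w)$ is at distance less than $\delta_0/7$ from some element of $U(A_1)$; and unitaries $u_1,u_2\in A$ with $\|\beta_i(a)-\operatorname{Ad}u_i\circ\alpha_i(a)\|<\delta_0/7$ for $i=1,2$ and all $a\in\beta_1^{-1}(U(A_1))\cup\beta_2^{-1}(U(A_1))\cup\beta_1^{-1}\beta_2^{-1}(U(A_1))$. Put $x=u_1\alpha_1(u_2)(u_2\alpha_2(u_1))^*$ and choose a piecewise smooth path $h:[0,1]\to U(A)$ with $h(0)=1$, $h(1)=x$ and $\|h(t)a-ah(t)\|<1/2$ for all $t\in[0,1]$, $a\in U(A_0)$. Then $$[\beta,\alpha](p)=\frac{1}{2\pi\sqrt{-1}}\int_0^1\tau(\dot h(t)h(t)^*)\,dt+K_0(A\cap A_0')\in K_0(A)/K_0(A\cap A_0')\cong\mathbb{Z}/\theta(p)\mathbb{Z},$$ where the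 isomorphism sends the class $1/\theta(p)$ of a minimal projection of $A_0$ to $1$. Such choices exist and the value does not depend on them. Put $[\alpha]=[\mathrm{id},\alpha]\in\prod_{p\in\mathcal{P}(A)}\mathbb{Z}/\theta(p)\mathbb{Z}$. An automorphism $\sigma$ of $A$ is *uniformly outer* if for all $a\in A$, all non-zero projections $e\in A$ and all $\varepsilon>0$ there are projections $e_1,\dots,e_n\in A$ with $e=\sum_i e_i$ and $\|e_i a\sigma(e_i)\|<\varepsilon$ for all $i$. An action $\alpha$ of $\mathbb{Z}^2$ on $A$ is uniformly outer if $\alpha_n$ is uniformly outer for every $n\neq 0$. It is of *product type* if $A$ is generated by a sequence $B_1,B_2,\dots$ of mutually commuting unital full matrix subalgebras such that for all $n\in\mathbb{Z}^2$ and $k$ the restriction of $\alpha_n$ to $B_k$ is $\operatorname{Ad}w$ for a unitary $w\in B_k$. Actions $\alpha,\beta$ of $\mathbb{Z}^2$ on $A$ are *outer conjugate* if there are $\sigma\in\operatorname{Aut}(A)$ and unitaries $v_n\in A$ $(n\in\mathbb{Z}^2)$ with $\operatorname{Ad}v_n\circ\alpha_n=\sigma\circ\beta_n\circ\sigma^{-1}$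 for all $n$. **Statement.** There is a family $(\gamma^f)$ of $\mathbb{Z}^2$-actions on $A$, indexed by $f\in\prod_{p\in\mathcal{P}(A)}\mathbb{Z}/\theta(p)\mathbb{Z}$, such that every $\gamma^f$ is uniformly outer, of product type, and satisfies $[\gamma^f]=f$; and whenever $f(p)=g(p)$ for all but finitely many $p\in\mathcal{P}(A)$, the actions $\gamma^f$ and $\gamma^g$ are outer conjugate. -/

import Mathlib

open scoped ContDiff

noncomputable section

namespace UHFAction

universe u

/-- `B` is (a copy of) the full matrix algebra `M_n(ℂ)`, as a unital `*`-subalgebra of `A`. -/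
def IsFullMatrix {A : Type u} [CStarAlgebra A] (B : StarSubalgebra ℂ A) (n : ℕ) : Prop :=
  Nonempty (Matrix (Fin n) (Fin n) ℂ ≃⋆ₐ[ℂ] B)

/-- UHF algebras: infinite-dimensional unital C*-algebras with an increasing sequence of unital
full matrix subalgebras whose union is dense. -/
def IsUHF (A : Type u) [CStarAlgebra A] : Prop :=
  ¬ FiniteDimensional ℂ A ∧
  ∃ (n : ℕ → ℕ) (S : ℕ → StarSubalgebra ℂ A),
    (∀ k, 0 < n k) ∧ (∀ k, IsFullMatrix (S k) (n k)) ∧ Monotone S ∧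
    Dense (⋃ k, (S k : Set A))

/-- Tracial states. -/
structure IsTracialState {A : Type u} [CStarAlgebra A] (τ : A →L[ℂ] ℂ) : Prop where
  map_one : τ 1 = 1
  nonneg : ∀ a, 0 ≤ (τ (star a * a)).re ∧ (τ (star a * a)).im = 0
  trace : ∀ a b, τ (a * b) = τ (b * a)

/-- The tracial state `τ` of `A` (a UHF algebra has exactly one). -/
def tracialState (A : Type u) [CStarAlgebra A] : A →L[ℂ] ℂ :=
  Classical.epsilon IsTracialState

/-- For a unital `*`-subalgebra `B` of `A`, the subgroup of `ℝ` generated by the values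
`τ(e) = ∑ i, τ(e i i)`, where `e` runs over the projections in matrix algebras over `B`.
For a UHF algebra `A` this is `τ(K₀(A))` when `B = A`, and, when `B = A ∩ A₀'` with `A₀` a unital
full matrix subalgebra, it is the image of `K₀(A ∩ A₀')` in `K₀(A) = τ(K₀(A)) ⊆ ℝ`. -/
def traceK0 {A : Type u} [CStarAlgebra A] (B : StarSubalgebra ℂ A) : AddSubgroup ℝ :=
  AddSubgroup.closure {x : ℝ | ∃ (n : ℕ) (e : Matrix (Fin n) (Fin n) A),
    IsStarProjection e ∧ (∀ i j, e i j ∈ B) ∧ x = (∑ i, tracialState A (e i i)).re}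

/-- `K₀(A)`, identified with `τ(K₀(A)) ⊆ ℝ`; the class `[1]` is the real number `1`. -/
def K0 (A : Type u) [CStarAlgebra A] : AddSubgroup ℝ := traceK0 (⊤ : StarSubalgebra ℂ A)

/-- `ζ(p)`: the supremum of the `k` such that `[1]` is divisible by `p ^ k` in `K₀(A)`. -/
def zeta (A : Type u) [CStarAlgebra A] (p : ℕ) : ℕ∞ :=
  sSup {k : ℕ∞ | ∃ m : ℕ, k = (m : ℕ∞) ∧ ∃ x ∈ K0 A, p ^ m • x = 1}

/-- The set `P(A)` of the primes `p` with `1 ≤ ζ(p) < ∞`. -/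
def primeSet (A : Type u) [CStarAlgebra A] : Set ℕ :=
  {p | p.Prime ∧ 1 ≤ zeta A p ∧ zeta A p < ⊤}

/-- `θ(p) = p ^ ζ(p)`, for `p ∈ P(A)`. -/
def theta (A : Type u) [CStarAlgebra A] (p : primeSet A) : ℕ := (p : ℕ) ^ (zeta A p).toNat

/-- The group `∏_{p ∈ P(A)} ℤ/θ(p)ℤ`. -/
abbrev InvariantGroup (A : Type u) [CStarAlgebra A] : Type :=
  ∀ p : primeSet A, ZMod (theta A p)

/-- Actions of `ℤ²` on `A` by `*`-automorphisms. -/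
abbrev Action (A : Type u) [CStarAlgebra A] : Type u := Multiplicative (ℤ × ℤ) →* (A ≃⋆ₐ[ℂ] A)

/-- The automorphism `α_n`, for `n ∈ ℤ²`. -/
def Action.at {A : Type u} [CStarAlgebra A] (α : Action A) (n : ℤ × ℤ) : A ≃⋆ₐ[ℂ] A :=
  α (Multiplicative.ofAdd n)

/-- Uniformly outer automorphisms. -/
def IsUniformlyOuterAut {A : Type u} [CStarAlgebra A] (σ : A ≃⋆ₐ[ℂ] A) : Prop :=
  ∀ a p : A, IsStarProjection p → p ≠ 0 → ∀ ε : ℝ, 0 < ε →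
    ∃ (n : ℕ) (q : Fin n → A), (∀ i, IsStarProjection (q i)) ∧ p = ∑ i, q i ∧
      ∀ i, ‖q i * a * σ (q i)‖ < ε

/-- Uniformly outer actions of `ℤ²`. -/
def IsUniformlyOuter {A : Type u} [CStarAlgebra A] (α : Action A) : Prop :=
  ∀ n : ℤ × ℤ, n ≠ 0 → IsUniformlyOuterAut (α.at n)

/-- Product type actions: `A` is the infinite tensor product of (mutually commuting, jointly
generating) full matrix subalgebras `B k`, and every `α_n` is `⨂ₖ Ad wₖ` with unitaries
`wₖ ∈ B k` that may depend on `n`. -/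
def IsProductType {A : Type u} [CStarAlgebra A] (α : Action A) : Prop :=
  ∃ (d : ℕ → ℕ) (B : ℕ → StarSubalgebra ℂ A),
    (∀ k, IsFullMatrix (B k) (d k)) ∧
    (∀ k l, k ≠ l → ∀ b ∈ B k, ∀ c ∈ B l, b * c = c * b) ∧
    Dense (((⨆ k, B k : StarSubalgebra ℂ A)) : Set A) ∧
    ∀ (n : ℤ × ℤ) (k : ℕ), ∃ w ∈ B k, w ∈ unitary A ∧ ∀ b ∈ B k, α.at n b = w * b * star w

/-- Outer conjugacy of actions of `ℤ²`. The unitaries need not form a cocycle. -/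
def OuterConjugate {A : Type u} [CStarAlgebra A] (α β : Action A) : Prop :=
  ∃ (σ : A ≃⋆ₐ[ℂ] A) (v : ℤ × ℤ → A), (∀ n, v n ∈ unitary A) ∧
    ∀ n a, v n * α.at n a * star (v n) = σ (β.at n (σ.symm a))

/-- `h` restricted to `[0,1]` is a piecewise smooth path of unitaries from `1` to `w`. -/
structure IsUnitaryPath {A : Type u} [CStarAlgebra A] (h : ℝ → A) (w : A) : Prop where
  mem_unitary : ∀ t ∈ Set.Icc (0 : ℝ) 1, h t ∈ unitary A
  source : h 0 = 1
  target : h 1 = w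
  continuousOn : ContinuousOn h (Set.Icc 0 1)
  piecewise : ∃ (N : ℕ) (t : ℕ → ℝ), Monotone t ∧ t 0 = 0 ∧ t N = 1 ∧
    ∀ i < N, ContDiffOn ℝ ∞ h (Set.Icc (t i) (t (i + 1)))

/-- The number `(2πi)⁻¹ ∫₀¹ τ(h'(t) h(t)*) dt`, which is real for a piecewise smooth path `h`
of unitaries. -/
def pathValue {A : Type u} [CStarAlgebra A] (h : ℝ → A) : ℝ :=
  ((2 * Real.pi * Complex.I)⁻¹ *
    ∫ t in (0 : ℝ)..1, tracialState A (deriv h t * star (h t))).re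

/-- The unitaries of the unital `*`-subalgebra `B`. -/
def unitaries {A : Type u} [CStarAlgebra A] (B : StarSubalgebra ℂ A) : Set A :=
  {a | a ∈ B ∧ a ∈ unitary A}

/-- The constants `δ₀` admitted in the definition of the invariant: a unitary which commutes up to
`δ₀` with the unitaries of a unital finite-dimensional subalgebra `A₀` is connected to `1` by a
path which commutes up to `1/8` with them. -/
def IsAdmissibleConst (A : Type u) [CStarAlgebra A] (δ : ℝ) : Prop :=
  0 < δ ∧ δ < 1 / 8 ∧
  ∀ A₀ : StarSubalgebra ℂ A, FiniteDimensional ℂ A₀ →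
    ∀ w ∈ unitary A, (∀ a ∈ unitaries A₀, ‖w * a - a * w‖ < δ) →
      ∃ h : ℝ → A, IsUnitaryPath h w ∧
        ∀ t ∈ Set.Icc (0 : ℝ) 1, ∀ a ∈ unitaries A₀, ‖h t * a - a * h t‖ < 1 / 8

/-- The choices `(δ₀, A₀, A₁, u₁, u₂, h)` that enter the definition of `[β, α](p)`. Here
`α_i = α_{ξ_i}` and `β_i = β_{ξ_i}` with `ξ₁ = (1,0)`, `ξ₂ = (0,1)`. -/
structure IsChoice {A : Type u} [CStarAlgebra A] (β α : Action A) (p : primeSet A)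
    (δ : ℝ) (A₀ A₁ : StarSubalgebra ℂ A) (u₁ u₂ : A) (h : ℝ → A) : Prop where
  const : IsAdmissibleConst A δ
  full : IsFullMatrix A₀ (theta A p)
  finite : FiniteDimensional ℂ A₁
  approx : ∀ w ∈ unitaries A₀,
    (∃ a ∈ unitaries A₁, ‖w - a‖ < δ / 7) ∧
    (∃ b ∈ unitaries A₁, ‖(β.at (1, 0)).symm w - b‖ < δ / 7) ∧
    (∃ c ∈ unitaries A₁, ‖(β.at (0, 1)).symm w - c‖ < δ / 7)
  mem_unitary₁ : u₁ ∈ unitary A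
  mem_unitary₂ : u₂ ∈ unitary A
  /-- The condition on `a` says that it belongs to
  `β₁⁻¹(U(A₁)) ∪ β₂⁻¹(U(A₁)) ∪ β₁⁻¹β₂⁻¹(U(A₁))`. -/
  perturb : ∀ a : A,
    (β.at (1, 0) a ∈ unitaries A₁ ∨ β.at (0, 1) a ∈ unitaries A₁ ∨
      β.at (0, 1) (β.at (1, 0) a) ∈ unitaries A₁) →
    ‖β.at (1, 0) a - u₁ * α.at (1, 0) a * star u₁‖ < δ / 7 ∧
    ‖β.at (0, 1) a - u₂ * α.at (0, 1) a * star u₂‖ < δ / 7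
  path : IsUnitaryPath h (u₁ * α.at (1, 0) u₂ * star (u₂ * α.at (0, 1) u₁))
  almost_commute : ∀ t ∈ Set.Icc (0 : ℝ) 1, ∀ a ∈ unitaries A₀, ‖h t * a - a * h t‖ < 1 / 2

/-- The class of the real number `x` in `K₀(A) / K₀(A ∩ A₀') ≅ ℤ/θ(p)ℤ` is `c`. The isomorphism
sends the class `[e] = 1 / θ(p)` of a minimal projection `e` of `A₀` to `1`. (In particular
`x ∈ K₀(A)`, since `c / θ(p)` and `K₀(A ∩ A₀')` lie in `K₀(A)`.) -/
def HasClass {A : Type u} [CStarAlgebra A] (p : primeSet A) (A₀ : StarSubalgebra ℂ A)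
    (x : ℝ) (c : ZMod (theta A p)) : Prop :=
  x - (c.val : ℝ) / (theta A p : ℝ) ∈ traceK0 (StarSubalgebra.centralizer ℂ (A₀ : Set A))

/-- `[β, α] = f`: for every `p ∈ P(A)` there are admitted choices, and, whatever the choices,
the class of `(2πi)⁻¹ ∫₀¹ τ(h'(t) h(t)*) dt` in `K₀(A) / K₀(A ∩ A₀') ≅ ℤ/θ(p)ℤ` is `f p`. -/
def HasRelInvariant {A : Type u} [CStarAlgebra A] (β α : Action A) (f : InvariantGroup A) : Prop :=
  ∀ p : primeSet A,
    (∃ (δ : ℝ) (A₀ A₁ : StarSubalgebra ℂ A) (u₁ u₂ : A) (h : ℝ → A),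
      IsChoice β α p δ A₀ A₁ u₁ u₂ h) ∧
    ∀ (δ : ℝ) (A₀ A₁ : StarSubalgebra ℂ A) (u₁ u₂ : A) (h : ℝ → A),
      IsChoice β α p δ A₀ A₁ u₁ u₂ h → HasClass p A₀ (pathValue h) (f p)

/-- `[α] = f`, where `[α] = [id, α]`, with `id` the trivial action. -/
def HasInvariant {A : Type u} [CStarAlgebra A] (α : Action A) (f : InvariantGroup A) : Prop :=
  HasRelInvariant (1 : Action A) α f

end UHFAction

end

/-! Choose an increasing sequence of full matrix subalgebras `T.alg j` of sizes `T.size j`, starting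
with the scalars, with quotients `d j` of consecutive sizes at least `(j + 1) ^ 2`, such that a
prime `p` of `P(A)` enters a size only together with its full power `θ(p)`
(`MatrixTower.exists_refinement`). Then `A` is the infinite tensor product of the matrix algebras of
size `d j` (`MatrixTower.exists_factorSystem`).

In the factor `j` take the cyclic shift and the product of a clock matrix, with eigenvalues the
powers of `exp (2πi t j)`, with the `j`-th power of the shift. They commute up to the scalar `exp
(-2πi t j)`, hence induce commuting automorphisms (`FactorSystem.action`). The phase `t j` is the
sum of `f p / θ(p)` over the primes `p` that first divide `T.size (j + 1)`; for these `θ(p)` divides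
`d j`, so the clock matrix is compatible with the cyclic indices. The action is of product type by
construction. The automorphism with index `n` permutes the diagonal projections of the factor `j` by
a shift by `n.1 + n.2 * j`, which is nonzero modulo `d j` for large `j`; this gives uniform
outerness. Two invariants that differ at finitely many primes give the same phases from some `J` on,
and correcting the implementing unitaries at the level `J` gives outer conjugacy with `σ = id`
(`FactorSystem.outerConjugate_phases`).

The invariant is computed with the de la Harpe-Skandalis determinant, whose local form is
`logTrace`, the trace of `(2πi)⁻¹ log`. It is additive near `1` (`MatrixTower.logTrace_mul`),
extends to finite chains of unitaries (`HasDet`), and equals the path integral along nearby paths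
(`IsUnitaryPath.hasDet`). On closed chains in `A` it takes values in the union of the groups `ℤ /
T.size k` (`MatrixTower.exists_int_of_hasDet_one`), and on closed chains in `A ∩ A₀'` values in the
image of `K₀(A ∩ A₀')`, by compression to a minimal projection of `A₀`
(`MatrixTower.mem_traceK0_of_hasDet_one`).

If the two generators of an action are `Ad X`, `Ad Y` on `T.alg j`, and `X Y = exp (2πi s) Y X`,
then for any admitted choice and large `j` the unitaries `u₁ X`, `u₂ Y` nearly commute with `A₀`.
They are replaced by unitaries `P`, `Q` of `A ∩ A₀'`, whose commutator has determinant `0` there. Up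
to the scalar `exp (-2πi s)` this commutator is close to `x`, so the value of the path is `-s`
modulo `K₀(A ∩ A₀')` (`MatrixTower.eventually_pathValue_add_mem`). Here `-s` is the sum of `f q /
θ(q)` over the primes `q` dividing `T.size j`, and only the term of `p` survives in the quotient.
That choices exist at all rests on the connectedness of the unitary group of the commutant of a
finite-dimensional subalgebra (`MatrixTower.isAdmissibleConst`). -/

open scoped ContDiff

noncomputable section

namespace UHFAction

universe u

/-! ### Polar decomposition of invertible elements close to unitaries. -/

section Polar

variable {A : Type u} [CStarAlgebra A]

/-- The inverse `|g|⁻¹` of the absolute value of an invertible element. -/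
def absInv (g : A) : A := cfc (fun x : ℝ => (√x)⁻¹) (star g * g)

/-- The unitary part `g |g|⁻¹` of an invertible element. -/
def polarPart (g : A) : A := g * absInv g

lemma isSelfAdjoint_absInv (g : A) : IsSelfAdjoint (absInv g) := cfc_predicate _ _

lemma absInv_mem {S : StarSubalgebra ℂ A} (hS : IsClosed (S : Set A)) {g : A}
    (hg : star g * g ∈ S) : absInv g ∈ S :=
  cfc_mem (hs := hS) _ hg

lemma polarPart_mem {S : StarSubalgebra ℂ A} (hS : IsClosed (S : Set A)) {g : A}
    (hg : g ∈ S) : polarPart g ∈ S :=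
  mul_mem hg (absInv_mem hS (mul_mem (star_mem hg) hg))

lemma spectrum_star_mul_self_pos {g : A} (hg : IsUnit g) {x : ℝ}
    (hx : x ∈ spectrum ℝ (star g * g)) : 0 < x := by
  have h0 : 0 ≤ x := spectrum_star_mul_self_nonneg x hx
  refine lt_of_le_of_ne h0 ?_
  rintro rfl
  exact spectrum.zero_notMem ℝ (hg.star.mul hg) hx

lemma continuousOn_inv_sqrt {g : A} (hg : IsUnit g) :
    ContinuousOn (fun x : ℝ => (√x)⁻¹) (spectrum ℝ (star g * g)) :=
  ContinuousOn.inv₀ (Real.continuous_sqrt.continuousOn) fun _ hx =>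
    (Real.sqrt_pos.mpr (spectrum_star_mul_self_pos hg hx)).ne'

lemma absInv_mul_abs {g : A} (hg : IsUnit g) :
    absInv g * cfc Real.sqrt (star g * g) = 1 := by
  rw [absInv, ← cfc_mul _ _ _ (continuousOn_inv_sqrt hg) (Real.continuous_sqrt.continuousOn)]
  rw [← cfc_one ℝ (star g * g)]
  refine cfc_congr fun _ hx => ?_
  exact inv_mul_cancel₀ (Real.sqrt_pos.mpr (spectrum_star_mul_self_pos hg hx)).ne'

lemma abs_mul_absInv {g : A} (hg : IsUnit g) :
    cfc Real.sqrt (star g * g) * absInv g = 1 := by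
  rw [absInv, (cfc_commute_cfc _ _ _).eq]
  exact absInv_mul_abs hg

lemma abs_mul_abs (g : A) :
    cfc Real.sqrt (star g * g) * cfc Real.sqrt (star g * g) = star g * g := by
  have hsa : IsSelfAdjoint (star g * g) := .star_mul_self g
  rw [← cfc_mul _ _ _ (Real.continuous_sqrt.continuousOn) (Real.continuous_sqrt.continuousOn)]
  conv_rhs => rw [← cfc_id ℝ (star g * g)]
  exact cfc_congr fun _ hx => Real.mul_self_sqrt (spectrum_star_mul_self_nonneg _ hx)

lemma isUnit_absInv {g : A} (hg : IsUnit g) : IsUnit (absInv g) :=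
  ⟨⟨_, _, absInv_mul_abs hg, abs_mul_absInv hg⟩, rfl⟩

lemma polarPart_mul_abs {g : A} (hg : IsUnit g) :
    polarPart g * cfc Real.sqrt (star g * g) = g := by
  rw [polarPart, mul_assoc, absInv_mul_abs hg, mul_one]

lemma polarPart_mem_unitary {g : A} (hg : IsUnit g) : polarPart g ∈ unitary A := by
  have h1 : star (polarPart g) * polarPart g = 1 := by
    rw [polarPart, star_mul, (isSelfAdjoint_absInv g).star_eq]
    calc absInv g * star g * (g * absInv g) = absInv g * (star g * g) * absInv g := by
          simp only [mul_assoc]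
      _ = absInv g * (cfc Real.sqrt (star g * g) * cfc Real.sqrt (star g * g)) * absInv g := by
          rw [abs_mul_abs]
      _ = (absInv g * cfc Real.sqrt (star g * g)) * (cfc Real.sqrt (star g * g) * absInv g) := by
          simp only [mul_assoc]
      _ = 1 := by rw [absInv_mul_abs hg, abs_mul_absInv hg, one_mul]
  have hu : IsUnit (polarPart g) := hg.mul (isUnit_absInv hg)
  refine Unitary.mem_iff.mpr ⟨h1, ?_⟩
  obtain ⟨v, hv⟩ := hu
  rw [← hv] at h1 ⊢
  rw [left_inv_eq_right_inv h1 v.mul_inv, Units.mul_inv]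

lemma isUnit_of_norm_sub_lt_one {g h : A} (hh : h ∈ unitary A) (hgh : ‖g - h‖ < 1) :
    IsUnit g := by
  have h1 : ‖1 - star h * g‖ < 1 := by
    calc ‖1 - star h * g‖ = ‖star h * (h - g)‖ := by
          rw [mul_sub, (Unitary.mem_iff.mp hh).1]
      _ = ‖h - g‖ := CStarRing.norm_mem_unitary_mul _ (Unitary.star_mem hh)
      _ < 1 := by rwa [norm_sub_rev]
  have h2 : IsUnit (star h * g) := by
    have := isUnit_one_sub_of_norm_lt_one h1
    rwa [sub_sub_cancel] at this
  have h3 : g = h * (star h * g) := by rw [← mul_assoc, (Unitary.mem_iff.mp hh).2, one_mul]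
  rw [h3]
  exact (Unitary.isUnit_coe (U := ⟨h, hh⟩)).mul h2

/-- The identity `v⁻¹ = h* - h* (g - h) v⁻¹` bounds the norm of the inverse by `1 + η` times itself.
This supplies the lower bound on the spectrum of `g* g` needed below. -/
lemma norm_inverse_le {g h : A} (hh : h ∈ unitary A) {η : ℝ} (hη : η < 1) (hgh : ‖g - h‖ ≤ η)
    {v : Aˣ} (hv : (v : A) = g) : ‖(↑v⁻¹ : A)‖ ≤ (1 - η)⁻¹ := by
  have h1 : (↑v⁻¹ : A) = star h - star h * (g - h) * ↑v⁻¹ := by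
    rw [mul_sub, (Unitary.mem_iff.mp hh).1, sub_mul, mul_assoc, ← hv]
    simp
  have h2 : ‖(↑v⁻¹ : A)‖ ≤ 1 + η * ‖(↑v⁻¹ : A)‖ := by
    calc ‖(↑v⁻¹ : A)‖ = ‖star h - star h * (g - h) * ↑v⁻¹‖ := by rw [← h1]
      _ ≤ ‖star h‖ + ‖star h * (g - h) * ↑v⁻¹‖ := norm_sub_le _ _
      _ ≤ 1 + η * ‖(↑v⁻¹ : A)‖ := by
          gcongr
          · nontriviality A
            exact (CStarRing.norm_of_mem_unitary (Unitary.star_mem hh)).le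
          · refine (norm_mul_le _ _).trans ?_
            rw [CStarRing.norm_mem_unitary_mul _ (Unitary.star_mem hh)]
            gcongr
  rw [← one_div (1 - η), le_div_iff₀ (by linarith)]
  linarith

/-- The difference is the unitary part times `|g| - 1`, up to sign, and the spectrum of `|g|` lies
in `[1 - η, 1 + η]`: the upper end comes from the norm of `g`, the lower end from the norm of `g⁻¹`.
-/
lemma norm_polarPart_sub_self_le {g h : A} (hh : h ∈ unitary A) {η : ℝ} (hη : η < 1)
    (hgh : ‖g - h‖ ≤ η) : ‖polarPart g - g‖ ≤ η := by
  have hη0 : 0 ≤ η := (norm_nonneg _).trans hgh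
  rcases subsingleton_or_nontrivial A with _ | _
  · rwa [Subsingleton.elim (polarPart g - g) 0, norm_zero]
  have hg : IsUnit g := isUnit_of_norm_sub_lt_one hh (hgh.trans_lt hη)
  have hsa : IsSelfAdjoint (star g * g) := .star_mul_self g
  have h1 : polarPart g - g = polarPart g * (1 - cfc Real.sqrt (star g * g)) := by
    rw [mul_sub, mul_one, polarPart_mul_abs hg]
  rw [h1, CStarRing.norm_mem_unitary_mul _ (polarPart_mem_unitary hg), ← cfc_one ℝ (star g * g),
    ← cfc_sub (1 : ℝ → ℝ) Real.sqrt _ (continuousOn_const) (Real.continuous_sqrt.continuousOn)]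
  refine norm_cfc_le hη0 fun x hx => ?_
  have hx0 := spectrum_star_mul_self_pos hg hx
  have hg1 : ‖g‖ ≤ 1 + η := by
    calc ‖g‖ = ‖h + (g - h)‖ := by simp
      _ ≤ ‖h‖ + ‖g - h‖ := norm_add_le _ _
      _ ≤ 1 + η := by rw [CStarRing.norm_of_mem_unitary hh]; gcongr
  have hup : x ≤ (1 + η) ^ 2 := by
    have := spectrum.norm_le_norm_of_mem hx
    rw [CStarRing.norm_star_mul_self, Real.norm_of_nonneg hx0.le] at this
    nlinarith [norm_nonneg g]
  obtain ⟨v, hv⟩ := hg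
  have hlow : (1 - η) ^ 2 ≤ x := by
    have hmem : x⁻¹ ∈ spectrum ℝ (↑(star v * v)⁻¹ : A) := by
      have := (spectrum.inv_mem_iff (R := ℝ) (r := Units.mk0 x hx0.ne') (a := star v * v)).mp (by
        simpa [hv] using hx)
      simpa using this
    have h2 := spectrum.norm_le_norm_of_mem hmem
    rw [Real.norm_of_nonneg (by positivity), mul_inv_rev, Units.val_mul] at h2
    have h3 := norm_inverse_le hh hη hgh hv
    have h4 : ‖(↑(star v)⁻¹ : A)‖ = ‖(↑v⁻¹ : A)‖ := by
      rw [← star_inv, Units.coe_star, norm_star]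
    have h5 : x⁻¹ ≤ (1 - η)⁻¹ * (1 - η)⁻¹ := by
      refine h2.trans ((norm_mul_le _ _).trans ?_)
      rw [h4]
      gcongr
    have h6 : 0 < 1 - η := by linarith
    rw [← mul_inv] at h5
    have := (inv_le_inv₀ hx0 (by positivity)).mp h5
    nlinarith
  have h7 : √x ≤ 1 + η := Real.sqrt_le_iff.mpr ⟨by linarith, hup⟩
  have h8 : 1 - η ≤ √x := Real.le_sqrt_of_sq_le hlow
  simp only [Real.norm_eq_abs, abs_le, Pi.one_apply]
  constructor <;> linarith

lemma norm_polarPart_sub_le {g h : A} (hh : h ∈ unitary A) {η : ℝ} (hη : η < 1)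
    (hgh : ‖g - h‖ ≤ η) : ‖polarPart g - h‖ ≤ 2 * η := by
  calc ‖polarPart g - h‖ = ‖(polarPart g - g) + (g - h)‖ := by simp
    _ ≤ ‖polarPart g - g‖ + ‖g - h‖ := norm_add_le _ _
    _ ≤ 2 * η := by linarith [norm_polarPart_sub_self_le hh hη hgh]

lemma continuousOn_polarPart : ContinuousOn (polarPart : A → A) {g | IsUnit g} := by
  have hc : ContinuousOn (absInv : A → A) {g | IsUnit g} := by
    refine ContinuousOn.cfc_of_mem_nhdsSet (𝕜 := ℝ) (s := Set.Ioi 0) (fun x : ℝ => (√x)⁻¹)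
      (a := fun g : A => star g * g) ?_ (by fun_prop) ?_ ?_
    · exact (isOpen_Ioi.mem_nhdsSet).mpr (Set.iUnion₂_subset fun g hg x hx =>
        spectrum_star_mul_self_pos hg hx)
    · intro g _; exact .star_mul_self g
    · exact ContinuousOn.inv₀ (Real.continuous_sqrt.continuousOn) fun x hx =>
        (Real.sqrt_pos.mpr hx).ne'
  exact continuousOn_id.mul hc

end Polar

/-! ### Stability of idempotents and similarity of close idempotents. -/

section Idempotent

variable {R : Type u} [NormedRing R]

/-- One step of the iteration `b ↦ 3 b² - 2 b³` that converges to an idempotent. -/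
def idemStep (b : R) : R := b - (2 * b - 1) * (b * b - b)

/-- In terms of the defect `x = b² - b`, one step replaces `x` by `4 x³ - 3 x²`. The convergence is
therefore quadratic; the geometric rate `1 / 2` is all that is used. -/
lemma idemStep_defect (b : R) :
    idemStep b * idemStep b - idemStep b =
      4 • ((b * b - b) * (b * b - b) * (b * b - b)) - 3 • ((b * b - b) * (b * b - b)) := by
  unfold idemStep
  noncomm_ring

lemma two_mul_idemStep_sub_one (b : R) :
    2 * idemStep b - 1 = (2 * b - 1) - 2 • ((2 * b - 1) * (b * b - b)) := by
  unfold idemStep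
  noncomm_ring

/-- Both bounds have to be carried along together: the length of a step is controlled by `2 b - 1`
times the defect. The factor `2 - (1 / 2) ^ k` leaves room for growth at each step and stays below
`2`. -/
lemma norm_iterate_idemStep {b : R} {M c : ℝ} (hM : ‖2 * b - 1‖ ≤ M) (hc : c ≤ 1 / 8)
    (hb : ‖b * b - b‖ ≤ c) (k : ℕ) :
    ‖2 * idemStep^[k] b - 1‖ ≤ (2 - (1 / 2) ^ k) * M ∧
      ‖idemStep^[k] b * idemStep^[k] b - idemStep^[k] b‖ ≤ c * (1 / 2) ^ k := by
  have hM0 : 0 ≤ M := (norm_nonneg _).trans hM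
  have hc0 : 0 ≤ c := (norm_nonneg _).trans hb
  induction k with
  | zero => norm_num; exact ⟨hM, hb⟩
  | succ k ih =>
    obtain ⟨ih1, ih2⟩ := ih
    rw [Function.iterate_succ_apply']
    set y := idemStep^[k] b
    set x := y * y - y
    set t : ℝ := (1 / 2) ^ k
    have ht0 : 0 < t := by positivity
    have ht1 : t ≤ 1 := pow_le_one₀ (by norm_num) (by norm_num)
    have hx : ‖x‖ ≤ c * t := ih2
    have hx8 : ‖x‖ ≤ 1 / 8 * t := hx.trans (by gcongr)
    constructor
    · rw [two_mul_idemStep_sub_one]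
      calc ‖(2 * y - 1) - 2 • ((2 * y - 1) * x)‖ ≤ ‖2 * y - 1‖ + 2 * (‖2 * y - 1‖ * ‖x‖) := by
            refine (norm_sub_le _ _).trans ?_
            gcongr
            refine (norm_nsmul_le).trans ?_
            push_cast
            gcongr
            exact norm_mul_le _ _
        _ = ‖2 * y - 1‖ * (1 + 2 * ‖x‖) := by ring
        _ ≤ ((2 - t) * M) * (1 + 2 * (1 / 8 * t)) := by
            have : 0 ≤ (2 - t) * M := mul_nonneg (by linarith) hM0
            gcongr
        _ = ((2 - t) * (1 + 2 * (1 / 8 * t))) * M := by ring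
        _ ≤ (2 - (1 / 2) ^ (k + 1)) * M := by
            gcongr
            rw [pow_succ]
            change (2 - t) * (1 + 2 * (1 / 8 * t)) ≤ 2 - t * (1 / 2)
            nlinarith
    · rw [idemStep_defect]
      calc ‖4 • (x * x * x) - 3 • (x * x)‖ ≤ 4 * (‖x‖ * ‖x‖ * ‖x‖) + 3 * (‖x‖ * ‖x‖) := by
            refine (norm_sub_le _ _).trans ?_
            gcongr
            · refine (norm_nsmul_le).trans ?_
              push_cast
              gcongr
              exact (norm_mul_le _ _).trans (by gcongr; exact norm_mul_le _ _)
            · refine (norm_nsmul_le).trans ?_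
              push_cast
              gcongr
              exact norm_mul_le _ _
        _ = ‖x‖ * (4 * ‖x‖ * ‖x‖ + 3 * ‖x‖) := by ring
        -- The bracket equals `7 / 16`, which is less than `1 / 2`; this is why the defect has to
        -- start below `1 / 8`.
        _ ≤ (c * t) * (4 * (1 / 8) * (1 / 8) + 3 * (1 / 8)) := by
            have : ‖x‖ ≤ 1 / 8 := hx8.trans (by linarith)
            gcongr
        _ ≤ c * (1 / 2) ^ (k + 1) := by
            rw [pow_succ]
            change c * t * _ ≤ c * (t * (1 / 2))
            have : 0 ≤ c * t := by positivity
            nlinarith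

/-- Idempotents are stable: close to an element near an idempotent `p` there is an idempotent,
which lies in all closed sets that contain this element and are invariant under `idemStep`. -/
theorem exists_idempotent_near [CompleteSpace R] {p : R} (hp : p * p = p) {ε : ℝ} (hε : 0 < ε) :
    ∃ η > 0, ∀ b : R, ‖b - p‖ < η → ∃ q : R, q * q = q ∧ ‖q - p‖ < ε ∧
      ∀ S : Set R, IsClosed S → (∀ x ∈ S, idemStep x ∈ S) → b ∈ S → q ∈ S := by
  set M : ℝ := ‖2 * p - 1‖ + 1 with hM
  have hM0 : 0 < M := by positivity
  -- The steps of the iteration have total length at most `4 M c ≤ ε / 4`, and `b` itself is within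
  -- `ε / 2` of `p`.
  set c : ℝ := min (1 / 8) (ε / (16 * M)) with hc
  have hc0 : 0 < c := by positivity
  have e1 : ∀ᶠ b in nhds p, ‖2 * b - 1‖ < M := by
    have : ContinuousAt (fun b : R => ‖2 * b - 1‖) p := by fun_prop
    exact this.eventually_lt continuousAt_const (by rw [hM]; linarith)
  have e2 : ∀ᶠ b in nhds p, ‖b * b - b‖ < c := by
    have : ContinuousAt (fun b : R => ‖b * b - b‖) p := by fun_prop
    exact this.eventually_lt continuousAt_const (by simpa [hp] using hc0)
  have e3 : ∀ᶠ b in nhds p, ‖b - p‖ < ε / 2 := by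
    have : ContinuousAt (fun b : R => ‖b - p‖) p := by fun_prop
    exact this.eventually_lt continuousAt_const (by simpa using hε)
  obtain ⟨η, hη, hball⟩ := Metric.eventually_nhds_iff.mp (e1.and (e2.and e3))
  refine ⟨η, hη, fun b hb => ?_⟩
  obtain ⟨h1, h2, h3⟩ := hball (by rwa [dist_eq_norm])
  have key := norm_iterate_idemStep h1.le (min_le_left _ _) h2.le
  have hstep : ∀ k, dist (idemStep^[k] b) (idemStep^[k + 1] b) ≤ (4 * M * c) / 2 / 2 ^ k := by
    intro k
    obtain ⟨k1, k2⟩ := key k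
    rw [Function.iterate_succ_apply', dist_eq_norm]
    set y := idemStep^[k] b
    have : y - idemStep y = (2 * y - 1) * (y * y - y) := by simp [idemStep]
    rw [this]
    refine (norm_mul_le _ _).trans ?_
    calc _ ≤ (2 * M) * (c * (1 / 2) ^ k) := by
          refine mul_le_mul (k1.trans ?_) k2 (norm_nonneg _) (by positivity)
          gcongr
          have : (0 : ℝ) ≤ (1 / 2) ^ k := by positivity
          linarith
      _ = _ := by rw [one_div, inv_pow]; ring
  obtain ⟨q, hq⟩ := cauchySeq_tendsto_of_complete (cauchySeq_of_le_geometric_two hstep)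
  refine ⟨q, ?_, ?_, ?_⟩
  · have l1 : Filter.Tendsto (fun k => idemStep^[k] b * idemStep^[k] b - idemStep^[k] b)
        Filter.atTop (nhds (q * q - q)) := (hq.mul hq).sub hq
    have l2 : Filter.Tendsto (fun k => idemStep^[k] b * idemStep^[k] b - idemStep^[k] b)
        Filter.atTop (nhds 0) := by
      refine squeeze_zero_norm (fun k => (key k).2) ?_
      have := (tendsto_pow_atTop_nhds_zero_of_lt_one (r := (1 / 2 : ℝ)) (by norm_num)
        (by norm_num)).const_mul c
      rwa [mul_zero] at this
    exact sub_eq_zero.mp (tendsto_nhds_unique l1 l2)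
  · have := dist_le_of_le_geometric_two_of_tendsto₀ hstep hq
    rw [Function.iterate_zero_apply, dist_eq_norm] at this
    have h4 : 4 * M * c ≤ ε / 4 := by
      have : c ≤ ε / (16 * M) := min_le_right _ _
      rw [le_div_iff₀ (by positivity)] at this
      linarith
    calc ‖q - p‖ = ‖(b - p) - (b - q)‖ := by congr 1; abel
      _ ≤ ‖b - p‖ + ‖b - q‖ := norm_sub_le _ _
      _ < ε := by linarith
  · intro S hS hstepS hbS
    refine hS.mem_of_tendsto hq (Filter.Eventually.of_forall fun k => ?_)
    induction k with
    | zero => exact hbS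
    | succ k ih => rw [Function.iterate_succ_apply']; exact hstepS _ ih

lemma idemStep_mem {S : Type*} [SetLike S R] [SubringClass S R] {s : S} {b : R} (hb : b ∈ s) :
    idemStep b ∈ s := by
  have h2 : (2 : R) ∈ s := ofNat_mem s 2
  exact sub_mem hb (mul_mem (sub_mem (mul_mem h2 hb) (one_mem s)) (sub_mem (mul_mem hb hb) hb))

lemma IsSelfAdjoint.idemStep [StarRing R] {b : R} (hb : IsSelfAdjoint b) :
    IsSelfAdjoint (idemStep b) := by
  have : UHFAction.idemStep b = 3 • (b * b) - 2 • (b * b * b) := by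
    unfold UHFAction.idemStep
    noncomm_ring
  rw [this, isSelfAdjoint_iff, star_sub, star_nsmul, star_nsmul, star_mul, star_mul, star_mul,
    hb.star_eq, mul_assoc]

/-- The standard element `z = q p + (1 - q) (1 - p)` that intertwines two idempotents. -/
def intertwiner (p q : R) : R := q * p + (1 - q) * (1 - p)

lemma intertwiner_mul {p q : R} (hp : p * p = p) (hq : q * q = q) :
    intertwiner p q * p = q * intertwiner p q := by
  have h1 : (1 - p) * p = 0 := by rw [sub_mul, one_mul, hp, sub_self]
  have h2 : q * (1 - q) = 0 := by rw [mul_sub, mul_one, hq, sub_self]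
  rw [intertwiner, add_mul, mul_add, mul_assoc, hp, mul_assoc, h1, ← mul_assoc q q, hq,
    ← mul_assoc q (1 - q), h2]
  simp

/-- This factorization makes the intertwiner invertible when `q` is close to `p`, so that close
idempotents are similar. -/
lemma intertwiner_sub_one {p q : R} (hp : p * p = p) :
    intertwiner p q - 1 = (q - p) * (2 * p - 1) := by
  rw [intertwiner]
  have : (q - p) * (2 * p - 1) = 2 • (q * p) - 2 • (p * p) - q + p := by noncomm_ring
  rw [this, hp]
  noncomm_ring

end Idempotent

/-! ### Traces on full matrix algebras. -/

section MatrixTrace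

variable {ι : Type*} [Fintype ι] [DecidableEq ι]

/-- The normalized trace of `M_ι(ℂ)` is its only normalized trace functional. -/
lemma linearMap_eq_trace_div_card (f : Matrix ι ι ℂ →ₗ[ℂ] ℂ) (h1 : f 1 = 1)
    (hf : ∀ a b, f (a * b) = f (b * a)) (x : Matrix ι ι ℂ) :
    f x = x.trace / Fintype.card ι := by
  have hoff : ∀ i j, i ≠ j → f (Matrix.single i j 1) = 0 := by
    intro i j hij
    have := hf (Matrix.single i i 1) (Matrix.single i j 1)
    rw [Matrix.single_mul_single_same, Matrix.single_mul_single_of_ne _ _ _ _ hij.symm] at this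
    simpa using this
  have hdiag : ∀ i j, f (Matrix.single i i 1) = f (Matrix.single j j 1) := by
    intro i j
    have := hf (Matrix.single i j 1) (Matrix.single j i 1)
    simpa using this
  have hsum : ∀ i, (Fintype.card ι : ℂ) * f (Matrix.single i i 1) = 1 := by
    intro i
    have h2 : (1 : Matrix ι ι ℂ) = ∑ j, Matrix.single j j 1 := by
      rw [Matrix.sum_single_eq_diagonal]; rfl
    rw [h2, map_sum, Finset.sum_congr rfl fun j _ => hdiag j i] at h1
    simpa using h1
  have hx := Matrix.matrix_eq_sum_single x
  have hfx : f x = ∑ i, x i i * f (Matrix.single i i 1) := by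
    conv_lhs => rw [hx]
    rw [map_sum]
    refine Finset.sum_congr rfl fun i _ => ?_
    rw [map_sum, Finset.sum_eq_single i]
    · rw [← mul_one (x i i), ← smul_eq_mul (x i i) 1, ← Matrix.smul_single, map_smul]; simp
    · intro j _ hj
      rw [← mul_one (x i j), ← smul_eq_mul (x i j) 1, ← Matrix.smul_single, map_smul,
        hoff i j hj.symm, smul_zero]
    · simp
  rcases isEmpty_or_nonempty ι with h | ⟨⟨i0⟩⟩
  · rw [hfx]; simp
  have hc : (Fintype.card ι : ℂ) ≠ 0 := by
    intro h; have := hsum i0; rw [h] at this; simp at this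
  rw [hfx, eq_div_iff hc, Finset.sum_mul, Matrix.trace]
  refine Finset.sum_congr rfl fun i _ => ?_
  rw [Matrix.diag_apply, mul_assoc, mul_comm (f _), hsum, mul_one]

lemma exists_nat_trace_of_isIdempotentElem {q : Matrix ι ι ℂ} (hq : q * q = q) :
    ∃ n : ℕ, q.trace = n := by
  have h : IsIdempotentElem (Matrix.toLin' q) := by
    rw [IsIdempotentElem, Module.End.mul_eq_comp, ← Matrix.toLin'_mul, hq]
  exact ⟨_, (Matrix.trace_toLin'_eq q).symm.trans
    (LinearMap.IsProj.trace (LinearMap.IsIdempotentElem.isProj_range _ h))⟩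

open scoped ComplexOrder in
lemma trace_star_mul_self_nonneg {κ : Type*} [Fintype κ] (x : Matrix κ κ ℂ) :
    0 ≤ (star x * x).trace.re ∧ (star x * x).trace.im = 0 := by
  have hps : 0 ≤ (star x * x).trace := (Matrix.posSemidef_conjTranspose_mul_self x).trace_nonneg
  obtain ⟨h1, h2⟩ := Complex.le_def.mp hps
  exact ⟨h1, h2.symm⟩

end MatrixTrace

/-! ### Matrix towers, and the existence, uniqueness and invariance of the tracial state. -/

section Trace

variable {A : Type u} [CStarAlgebra A]

lemma IsTracialState.map_starAlgHom {τ : A →L[ℂ] ℂ} (hτ : IsTracialState τ) {ι : Type*}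
    [Fintype ι] [DecidableEq ι] (φ : Matrix ι ι ℂ →⋆ₐ[ℂ] A) (x : Matrix ι ι ℂ) :
    τ (φ x) = x.trace / Fintype.card ι :=
  linearMap_eq_trace_div_card (τ.toLinearMap ∘ₗ φ.toAlgHom.toLinearMap)
    (by simp [hτ.map_one]) (fun a b => by simp [hτ.trace (φ a)]) x

/-- Compressing by a diagonal matrix unit `e` gives `e φ(x) e = x i i • e`, so each diagonal entry,
and hence their mean, is bounded by the norm in `A`. -/
lemma norm_trace_div_card_le {ι : Type*} [Fintype ι] [DecidableEq ι] {φ : Matrix ι ι ℂ →⋆ₐ[ℂ] A}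
    (hφ : Function.Injective φ) (x : Matrix ι ι ℂ) :
    ‖x.trace / Fintype.card ι‖ ≤ ‖φ x‖ := by
  have hentry : ∀ i, ‖x i i‖ ≤ ‖φ x‖ := by
    intro i
    set e : A := φ (Matrix.single i i 1) with he
    have hproj : IsStarProjection e := by
      constructor
      · rw [IsIdempotentElem, he, ← map_mul]; simp
      · rw [isSelfAdjoint_iff, he, ← map_star, Matrix.star_eq_conjTranspose]; simp
    have hne : e ≠ 0 := by
      rw [he, Ne, map_eq_zero_iff φ hφ]
      intro h
      have := congrFun (congrFun h i) i
      simp at this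
    have h1 : e * φ x * e = x i i • e := by
      rw [he, ← map_mul, ← map_mul, ← map_smul]
      congr 1
      simp
    have h2 : ‖x i i‖ * ‖e‖ ≤ ‖φ x‖ * ‖e‖ := by
      rw [← norm_smul, ← h1]
      refine (norm_mul_le _ _).trans ?_
      gcongr
      refine (norm_mul_le _ _).trans ?_
      calc ‖e‖ * ‖φ x‖ ≤ 1 * ‖φ x‖ := by gcongr; exact hproj.norm_le
        _ = _ := one_mul _
    exact le_of_mul_le_mul_right h2 (norm_pos_iff.mpr hne)
  rcases isEmpty_or_nonempty ι with h | h
  · simp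
  rw [norm_div, Complex.norm_natCast, div_le_iff₀ (by exact_mod_cast Fintype.card_pos)]
  calc ‖x.trace‖ ≤ ∑ i, ‖x i i‖ := norm_sum_le _ _
    _ ≤ ∑ _i : ι, ‖φ x‖ := Finset.sum_le_sum fun i _ => hentry i
    _ = _ := by simp [mul_comm]

/-- An exhausting increasing sequence of full matrix subalgebras. -/
structure MatrixTower (A : Type u) [CStarAlgebra A] where
  size : ℕ → ℕ
  size_pos : ∀ k, 0 < size k
  emb : ∀ k, Matrix (Fin (size k)) (Fin (size k)) ℂ →⋆ₐ[ℂ] A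
  injective : ∀ k, Function.Injective (emb k)
  mono : Monotone fun k => (emb k).range
  dense : Dense (⋃ k, ((emb k).range : Set A))

/-- The subalgebras of a matrix tower. -/
def MatrixTower.alg (T : MatrixTower A) (k : ℕ) : StarSubalgebra ℂ A := (T.emb k).range

lemma MatrixTower.emb_mem (T : MatrixTower A) (k : ℕ) (x) : T.emb k x ∈ T.alg k := ⟨x, rfl⟩

lemma MatrixTower.alg_mono (T : MatrixTower A) {j k : ℕ} (h : j ≤ k) : T.alg j ≤ T.alg k :=
  T.mono h

lemma finiteDimensional_range {ι : Type*} [Fintype ι] [DecidableEq ι]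
    (φ : Matrix ι ι ℂ →⋆ₐ[ℂ] A) : FiniteDimensional ℂ φ.range :=
  Module.Finite.of_surjective
    ({ toFun := fun x => ⟨φ x, x, rfl⟩
       map_add' := fun x y => Subtype.ext (map_add φ x y)
       map_smul' := fun c x => Subtype.ext (map_smul φ c x) } : Matrix ι ι ℂ →ₗ[ℂ] φ.range)
    (by rintro ⟨_, x, rfl⟩; exact ⟨x, rfl⟩)

instance (T : MatrixTower A) (k : ℕ) : FiniteDimensional ℂ (T.alg k) :=
  finiteDimensional_range _

lemma isClosed_of_finiteDimensional (S : StarSubalgebra ℂ A) [h : FiniteDimensional ℂ S] :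
    IsClosed (S : Set A) :=
  have : FiniteDimensional ℂ (Subalgebra.toSubmodule S.toSubalgebra) := h
  (Subalgebra.toSubmodule S.toSubalgebra).closed_of_finiteDimensional

lemma MatrixTower.exists_mem_alg_near (T : MatrixTower A) (a : A) {ε : ℝ} (hε : 0 < ε) :
    ∃ k, ∃ b ∈ T.alg k, ‖b - a‖ < ε := by
  obtain ⟨b, hb, hab⟩ := Metric.dense_iff.mp T.dense a ε hε
  obtain ⟨k, hk⟩ := Set.mem_iUnion.mp hab
  exact ⟨k, b, hk, by rwa [mem_ball_iff_norm] at hb⟩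

lemma MatrixTower.eventually_exists_mem_alg_near (T : MatrixTower A) (a : A) {ε : ℝ}
    (hε : 0 < ε) : ∀ᶠ k in Filter.atTop, ∃ b ∈ T.alg k, ‖b - a‖ < ε := by
  obtain ⟨k, b, hb, h⟩ := T.exists_mem_alg_near a hε
  filter_upwards [Filter.eventually_ge_atTop k] with j hj
  exact ⟨b, T.alg_mono hj hb, h⟩

/-- Contractions that are eventually constant on a dense set converge pointwise. -/
lemma exists_tendsto_of_eventually_const {E : Type*} [NormedAddCommGroup E] [NormedSpace ℂ E]
    [CompleteSpace E] (F : ℕ → A →L[ℂ] E) (hF : ∀ k a, ‖F k a‖ ≤ ‖a‖) {D : Set A} (hD : Dense D)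
    (h : ∀ a ∈ D, ∃ e, ∀ᶠ k in Filter.atTop, F k a = e) :
    ∃ G : A →L[ℂ] E, ∀ a, Filter.Tendsto (fun k => F k a) Filter.atTop (nhds (G a)) := by
  have hc : ∀ a, CauchySeq fun k => F k a := by
    intro a
    rw [Metric.cauchySeq_iff']
    intro ε hε
    obtain ⟨d, hd, hdD⟩ := Metric.dense_iff.mp hD a (ε / 2) (by positivity)
    rw [mem_ball_iff_norm] at hd
    obtain ⟨e, he⟩ := h d hdD
    obtain ⟨N, hN⟩ := Filter.eventually_atTop.mp he
    refine ⟨N, fun n hn => ?_⟩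
    rw [dist_eq_norm]
    have : F n a - F N a = F N (d - a) - F n (d - a) := by
      rw [map_sub, map_sub, hN n hn, hN N le_rfl]; abel
    rw [this]
    calc _ ≤ ‖F N (d - a)‖ + ‖F n (d - a)‖ := norm_sub_le _ _
      _ ≤ ‖d - a‖ + ‖d - a‖ := add_le_add (hF _ _) (hF _ _)
      _ < ε := by linarith
  choose G hG using fun a => cauchySeq_tendsto_of_complete (hc a)
  exact ⟨continuousLinearMapOfTendsto F (tendsto_pi_nhds.mpr hG), hG⟩

/-- Equality of two continuous functions may be checked on the algebras of a matrix tower. -/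
lemma MatrixTower.eq_of_eqOn_alg (T : MatrixTower A) {E : Type*} [TopologicalSpace E] [T2Space E]
    {f g : A → E} (hf : Continuous f) (hg : Continuous g)
    (h : ∀ k, ∀ a ∈ T.alg k, f a = g a) (a : A) : f a = g a := by
  refine congrFun (hf.ext_on T.dense hg fun a ha => ?_) a
  obtain ⟨k, hk⟩ := Set.mem_iUnion.mp ha
  exact h k a hk

lemma MatrixTower.eq_of_eqOn_alg₂ (T : MatrixTower A) {E : Type*} [TopologicalSpace E]
    [T2Space E] {f g : A → A → E} (hf : Continuous fun p : A × A => f p.1 p.2)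
    (hg : Continuous fun p : A × A => g p.1 p.2)
    (h : ∀ k, ∀ a ∈ T.alg k, ∀ b ∈ T.alg k, f a b = g a b) (a b : A) : f a b = g a b := by
  have h2 : Dense ((⋃ k, (T.alg k : Set A)) ×ˢ (⋃ k, (T.alg k : Set A))) := T.dense.prod T.dense
  refine congrFun (hf.ext_on h2 hg ?_) (a, b)
  rintro ⟨x, y⟩ ⟨hx, hy⟩
  obtain ⟨i, hi⟩ := Set.mem_iUnion.mp hx
  obtain ⟨j, hj⟩ := Set.mem_iUnion.mp hy
  exact h (max i j) x (T.alg_mono (le_max_left _ _) hi) y (T.alg_mono (le_max_right _ _) hj)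

/-- The normalized trace of each `T.alg k` extends to `A` by Hahn-Banach with norm at most one. By
uniqueness of the matrix trace, the extensions with `k ≥ i` agree on `T.alg i`. Hence they converge
pointwise, and positivity and the trace property pass to the limit by density. -/
lemma MatrixTower.exists_isTracialState (T : MatrixTower A) : ∃ τ : A →L[ℂ] ℂ,
    IsTracialState τ := by
  have hext : ∀ k, ∃ g : A →L[ℂ] ℂ, (∀ x, g (T.emb k x) = x.trace / T.size k) ∧
      ∀ a, ‖g a‖ ≤ ‖a‖ := by
    intro k
    let e := (StarAlgEquiv.ofInjective (T.emb k) (T.injective k)).symm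
    let p : Subspace ℂ A := Subalgebra.toSubmodule (T.alg k).toSubalgebra
    have hfd : FiniteDimensional ℂ p := inferInstanceAs (FiniteDimensional ℂ (T.alg k))
    let f0 : p →ₗ[ℂ] ℂ :=
      { toFun := fun a => (e ⟨a.1, a.2⟩).trace / T.size k
        map_add' := fun a b => by
          change (e (⟨a.1, a.2⟩ + ⟨b.1, b.2⟩)).trace / _ = _
          rw [map_add, Matrix.trace_add, add_div]
        map_smul' := fun c a => by
          change (e (c • ⟨a.1, a.2⟩)).trace / _ = _
          rw [map_smul, Matrix.trace_smul, smul_div_assoc]; rfl }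
    have hbound : ∀ a, ‖f0 a‖ ≤ 1 * ‖a‖ := by
      rintro ⟨_, x, rfl⟩
      have h1 : e ⟨T.emb k x, x, rfl⟩ = x := by
        rw [StarAlgEquiv.symm_apply_eq]; rfl
      have h2 := norm_trace_div_card_le (T.injective k) x
      rw [Fintype.card_fin] at h2
      change ‖(e ⟨T.emb k x, x, rfl⟩).trace / _‖ ≤ 1 * ‖T.emb k x‖
      rw [h1, one_mul]
      exact h2
    obtain ⟨g, hg, hgn⟩ := exists_extension_norm_eq p (f0.mkContinuous 1 hbound)
    refine ⟨g, fun x => ?_, fun a => ?_⟩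
    · have := hg ⟨T.emb k x, x, rfl⟩
      rw [this]
      change (e ⟨T.emb k x, x, rfl⟩).trace / _ = _
      congr 2
      rw [StarAlgEquiv.symm_apply_eq]; rfl
    · have h3 : ‖g‖ ≤ 1 := hgn.le.trans (LinearMap.mkContinuous_norm_le _ zero_le_one _)
      calc ‖g a‖ ≤ ‖g‖ * ‖a‖ := g.le_opNorm a
        _ ≤ 1 * ‖a‖ := by gcongr
        _ = _ := one_mul _
  choose F hF hFn using hext
  have hcons : ∀ i k, i ≤ k → ∀ x, F k (T.emb i x) = x.trace / T.size i := by
    intro i k hik x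
    have hmul : ∀ a b, F k (T.emb k a * T.emb k b) = F k (T.emb k b * T.emb k a) := by
      intro a b
      rw [← map_mul, ← map_mul, hF, hF, Matrix.trace_mul_comm]
    have := linearMap_eq_trace_div_card ((F k).toLinearMap ∘ₗ (T.emb i).toAlgHom.toLinearMap)
      (by
        have : F k (T.emb k 1) = 1 := by
          rw [hF, Matrix.trace_one, Fintype.card_fin, div_self]
          exact_mod_cast (T.size_pos k).ne'
        simpa using this)
      (fun a b => by
        obtain ⟨a', ha⟩ := T.alg_mono hik (T.emb_mem i a)
        obtain ⟨b', hb⟩ := T.alg_mono hik (T.emb_mem i b)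
        have := hmul a' b'
        simpa [← ha, ← hb] using this) x
    rw [Fintype.card_fin] at this
    exact this
  obtain ⟨τ, hτ⟩ := exists_tendsto_of_eventually_const F hFn T.dense (by
    intro a ha
    obtain ⟨i, x, rfl⟩ := Set.mem_iUnion.mp ha
    exact ⟨_, Filter.eventually_atTop.mpr ⟨i, fun k hk => hcons i k hk x⟩⟩)
  have hval : ∀ i x, τ (T.emb i x) = x.trace / T.size i := fun i x =>
    tendsto_nhds_unique (hτ _) (tendsto_const_nhds.congr'
      (Filter.eventually_atTop.mpr ⟨i, fun k hk => (hcons i k hk x).symm⟩))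
  refine ⟨τ, ?_, ?_, ?_⟩
  · rw [← map_one (T.emb 0), hval, Matrix.trace_one, Fintype.card_fin, div_self]
    exact_mod_cast (T.size_pos 0).ne'
  · have hcl : IsClosed {a : A | 0 ≤ (τ (star a * a)).re ∧ (τ (star a * a)).im = 0} := by
      exact IsClosed.inter
        (isClosed_le continuous_const (Complex.continuous_re.comp (by fun_prop)))
        (isClosed_eq (Complex.continuous_im.comp (by fun_prop)) continuous_const)
    intro a
    refine hcl.closure_subset_iff.mpr ?_ (T.dense a)
    intro b hb
    obtain ⟨i, x, rfl⟩ := Set.mem_iUnion.mp hb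
    change 0 ≤ (τ (star (T.emb i x) * T.emb i x)).re ∧ (τ (star (T.emb i x) * T.emb i x)).im = 0
    rw [← map_star, ← map_mul, hval]
    obtain ⟨h1, h2⟩ := trace_star_mul_self_nonneg x
    rw [Complex.div_natCast_re, Complex.div_natCast_im, h2]
    exact ⟨by positivity, by simp⟩
  · refine T.eq_of_eqOn_alg₂ (by fun_prop) (by fun_prop) ?_
    rintro k _ ⟨x, rfl⟩ _ ⟨y, rfl⟩
    change τ (T.emb k x * T.emb k y) = τ (T.emb k y * T.emb k x)
    rw [← map_mul, ← map_mul, hval, hval, Matrix.trace_mul_comm]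

lemma MatrixTower.isTracialState (T : MatrixTower A) : IsTracialState (tracialState A) :=
  Classical.epsilon_spec T.exists_isTracialState

lemma MatrixTower.tracialState_emb (T : MatrixTower A) (k : ℕ) (x) :
    tracialState A (T.emb k x) = x.trace / T.size k := by
  rw [T.isTracialState.map_starAlgHom, Fintype.card_fin]

lemma MatrixTower.tracialState_unique (T : MatrixTower A) {τ : A →L[ℂ] ℂ}
    (hτ : IsTracialState τ) (a : A) : τ a = tracialState A a := by
  refine T.eq_of_eqOn_alg (by fun_prop) (by fun_prop) ?_ a
  rintro k _ ⟨x, rfl⟩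
  exact (hτ.map_starAlgHom _ _).trans (T.isTracialState.map_starAlgHom _ _).symm

/-- The composition of the trace with an automorphism is again a tracial state, so uniqueness
applies. -/
lemma MatrixTower.tracialState_map (T : MatrixTower A) (α : A ≃⋆ₐ[ℂ] A) (a : A) :
    tracialState A (α a) = tracialState A a := by
  have hc : Continuous α := (StarAlgEquiv.isometry α).continuous
  let τ : A →L[ℂ] ℂ := (tracialState A).comp ⟨α.toAlgEquiv.toLinearMap, hc⟩
  have hv : ∀ a, τ a = tracialState A (α a) := fun _ => rfl
  have hτ : IsTracialState τ := by
    constructor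
    · rw [hv, map_one, T.isTracialState.map_one]
    · intro a
      rw [hv, map_mul, map_star]
      exact T.isTracialState.nonneg _
    · intro a b
      rw [hv, hv, map_mul α, map_mul α, T.isTracialState.trace]
  exact (hv a).symm.trans (T.tracialState_unique hτ a)

end Trace

/-! ### The range of the trace on projections, and the integers `θ(p)`. -/

section K0

variable {A : Type u} [CStarAlgebra A]

lemma MatrixTower.isClosed_alg (T : MatrixTower A) (k : ℕ) : IsClosed (T.alg k : Set A) :=
  isClosed_of_finiteDimensional _

/-- The trace of a matrix over `A`, extending `tracialState A`. -/
def matrixTracialState {n : ℕ} (e : Matrix (Fin n) (Fin n) A) : ℂ :=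
  ∑ i, tracialState A (e i i)

lemma MatrixTower.matrixTracialState_mul_comm (T : MatrixTower A) {n : ℕ}
    (a b : Matrix (Fin n) (Fin n) A) :
    matrixTracialState (a * b) = matrixTracialState (b * a) := by
  simp only [matrixTracialState, Matrix.mul_apply, map_sum]
  rw [Finset.sum_comm]
  exact Finset.sum_congr rfl fun i _ => Finset.sum_congr rfl fun j _ => T.isTracialState.trace _ _

section

attribute [local instance] Matrix.linftyOpNormedRing

lemma norm_matrix_lt {n : ℕ} {M : Matrix (Fin n) (Fin n) A} {η δ : ℝ} (hη : 0 < η)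
    (hδ : n * δ < η) (hM : ∀ i j, ‖M i j‖ ≤ δ) : ‖M‖ < η := by
  rw [Matrix.linfty_opNorm_def]
  lift η to NNReal using hη.le
  rw [NNReal.coe_lt_coe, Finset.sup_lt_iff (by exact_mod_cast hη)]
  intro i _
  rw [← NNReal.coe_lt_coe, NNReal.coe_sum]
  calc ∑ j, ‖M i j‖ ≤ ∑ _j : Fin n, δ := Finset.sum_le_sum fun j _ => hM i j
    _ = n * δ := by simp
    _ < η := hδ

/-- Approximating the entries in a single algebra of the tower and applying stability of idempotents
there gives an idempotent so close to `e` that the two are similar; the trace is invariant under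
similarity. -/
lemma MatrixTower.exists_idempotent_matrixTracialState_eq (T : MatrixTower A) {n : ℕ}
    {e : Matrix (Fin n) (Fin n) A} (he : e * e = e) :
    ∃ k, ∃ q : Matrix (Fin n) (Fin n) A, q * q = q ∧ (∀ i j, q i j ∈ T.alg k) ∧
      matrixTracialState q = matrixTracialState e := by
  have hM : 0 < ‖2 * e - 1‖ + 1 := by positivity
  have hcs' : CompleteSpace (Matrix (Fin n) (Fin n) A) := inferInstance
  have hcs : @CompleteSpace (Matrix (Fin n) (Fin n) A) PseudoMetricSpace.toUniformSpace := hcs'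
  obtain ⟨η, hη, H⟩ := exists_idempotent_near he (ε := (‖2 * e - 1‖ + 1)⁻¹) (by positivity)
  set δ : ℝ := η / (n + 1) with hδ
  have hδ0 : 0 < δ := by positivity
  have h1 : ∀ᶠ k in Filter.atTop, ∀ i j, ∃ b ∈ T.alg k, ‖b - e i j‖ < δ :=
    Filter.eventually_all.mpr fun i => Filter.eventually_all.mpr fun j =>
      T.eventually_exists_mem_alg_near _ hδ0
  obtain ⟨k, hk⟩ := h1.exists
  choose b hb hbe using hk
  obtain ⟨q, hq, hqe, hqS⟩ := H (Matrix.of b) (norm_matrix_lt hη (δ := δ) (by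
    rw [hδ, mul_div_assoc', div_lt_iff₀ (by positivity)]; nlinarith)
    (fun i j => (hbe i j).le))
  refine ⟨k, q, hq, ?_, ?_⟩
  · refine hqS {M | ∀ i j, M i j ∈ T.alg k} ?_ ?_ hb
    · simp only [Set.ofPred_forall]
      refine isClosed_iInter fun i => isClosed_iInter fun j => ?_
      exact (T.isClosed_alg k).preimage (f := fun M : Matrix (Fin n) (Fin n) A => M i j)
        (continuous_apply_apply i j)
    · intro M hM
      exact idemStep_mem (s := (T.alg k).toSubalgebra.toSubring.matrix) (b := M) hM
  · have hz : ‖intertwiner e q - 1‖ < 1 := by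
      rw [intertwiner_sub_one he]
      calc ‖(q - e) * (2 * e - 1)‖ ≤ ‖q - e‖ * ‖2 * e - 1‖ := norm_mul_le _ _
        _ ≤ (‖2 * e - 1‖ + 1)⁻¹ * ‖2 * e - 1‖ := by gcongr
        _ < (‖2 * e - 1‖ + 1)⁻¹ * (‖2 * e - 1‖ + 1) := by gcongr; linarith
        _ = 1 := inv_mul_cancel₀ hM.ne'
    have hu : IsUnit (intertwiner e q) := by
      rw [norm_sub_rev] at hz
      have := isUnit_one_sub_of_norm_lt_one hz
      rwa [sub_sub_cancel] at this
    obtain ⟨v, hv⟩ := hu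
    have h2 := intertwiner_mul he hq
    rw [← hv] at h2
    have h3 : q = v * (e * (↑v⁻¹ : Matrix (Fin n) (Fin n) A)) := by rw [← mul_assoc, h2]; simp
    rw [h3, T.matrixTracialState_mul_comm, mul_assoc]
    simp

end

/-- A matrix over `T.alg k` flattens to a complex matrix, and the trace of a complex idempotent is
its rank. -/
lemma MatrixTower.matrixTracialState_mem (T : MatrixTower A) {n : ℕ}
    {e : Matrix (Fin n) (Fin n) A} (he : e * e = e) :
    ∃ k, ∃ z : ℕ, matrixTracialState e * T.size k = z := by
  obtain ⟨k, q, hq, hqk, htr⟩ := T.exists_idempotent_matrixTracialState_eq he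
  choose Q hQ using hqk
  have hQQ : (Matrix.of Q : Matrix (Fin n) (Fin n) _) * Matrix.of Q = Matrix.of Q := by
    ext1 i j
    apply T.injective k
    rw [Matrix.mul_apply, map_sum]
    have := congrFun (congrFun hq i) j
    rw [Matrix.mul_apply] at this
    refine Eq.trans ?_ (this.trans (hQ i j).symm)
    refine Finset.sum_congr rfl fun l _ => ?_
    rw [map_mul]
    exact congrArg₂ _ (hQ i l) (hQ l j)
  have hc := congrArg (Matrix.compRingEquiv _ _ _) hQQ
  rw [map_mul] at hc
  obtain ⟨z, hz⟩ := exists_nat_trace_of_isIdempotentElem hc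
  refine ⟨k, z, ?_⟩
  have hk : (T.size k : ℂ) ≠ 0 := by exact_mod_cast (T.size_pos k).ne'
  rw [← htr, ← hz, matrixTracialState, Finset.sum_mul, Matrix.trace, Fintype.sum_prod_type]
  refine Finset.sum_congr rfl fun i _ => ?_
  have : q i i = T.emb k (Q i i) := (hQ i i).symm
  rw [this, T.tracialState_emb, div_mul_cancel₀ _ hk]
  rfl

/-- A minimal projection of the smaller algebra has trace `1 / T.size j` and integral rank in the
larger one. -/
lemma MatrixTower.size_dvd (T : MatrixTower A) {j k : ℕ} (h : j ≤ k) : T.size j ∣ T.size k := by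
  set e : Matrix (Fin (T.size j)) (Fin (T.size j)) ℂ :=
    Matrix.single ⟨0, T.size_pos j⟩ ⟨0, T.size_pos j⟩ 1 with he
  have hee : e * e = e := by simp [he]
  obtain ⟨x, hx⟩ := T.alg_mono h (T.emb_mem j e)
  have hx : T.emb k x = T.emb j e := hx
  have hxx : x * x = x := by
    apply T.injective k
    rw [map_mul, hx, ← map_mul, hee]
  obtain ⟨z, hz⟩ := exists_nat_trace_of_isIdempotentElem hxx
  have h1 := T.tracialState_emb k x
  rw [hx, T.tracialState_emb, hz, he, Matrix.trace_single_eq_same] at h1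
  have hj : (T.size j : ℂ) ≠ 0 := by exact_mod_cast (T.size_pos j).ne'
  have hk : (T.size k : ℂ) ≠ 0 := by exact_mod_cast (T.size_pos k).ne'
  rw [div_eq_div_iff hj hk, one_mul] at h1
  exact ⟨z, by rw [mul_comm]; exact_mod_cast h1⟩

lemma MatrixTower.exists_int_of_mem_K0 (T : MatrixTower A) {x : ℝ} (hx : x ∈ K0 A) :
    ∃ k, ∃ z : ℤ, x * T.size k = z := by
  induction hx using AddSubgroup.closure_induction with
  | mem x hx =>
    obtain ⟨n, e, he, -, rfl⟩ := hx
    obtain ⟨k, z, hz⟩ := T.matrixTracialState_mem he.isIdempotentElem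
    refine ⟨k, z, ?_⟩
    have := congrArg Complex.re hz
    rw [← Complex.ofReal_natCast, Complex.re_mul_ofReal] at this
    simpa [matrixTracialState] using this
  | zero => exact ⟨0, 0, by simp⟩
  | add x y _ _ hx hy =>
    obtain ⟨j, z, hz⟩ := hx
    obtain ⟨k, w, hw⟩ := hy
    obtain ⟨a, ha⟩ := T.size_dvd (le_max_left j k)
    obtain ⟨b, hb⟩ := T.size_dvd (le_max_right j k)
    refine ⟨max j k, z * a + w * b, ?_⟩
    push_cast
    rw [add_mul, ← hz, ← hw]
    conv_lhs => rw [ha]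
    have : (T.size j : ℝ) * a = T.size k * b := by
      rw [ha] at hb; exact_mod_cast hb
    push_cast
    rw [mul_assoc x, mul_assoc y, this]
  | neg x _ hx =>
    obtain ⟨k, z, hz⟩ := hx
    exact ⟨k, -z, by push_cast; rw [← hz]; ring⟩

/-- A finite supremum in `ℕ∞` is attained, so `1 / θ(p)` belongs to `K₀(A)`, which is contained in
the union of the groups `ℤ / T.size k`. -/
lemma MatrixTower.theta_dvd_size (T : MatrixTower A) (p : primeSet A) :
    ∃ k, theta A p ∣ T.size k := by
  obtain ⟨p, hp, -, hlt⟩ := p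
  have h1 : ∃ x ∈ K0 A, p ^ 0 • x = 1 := by
    refine ⟨1, AddSubgroup.subset_closure ⟨1, 1, ?_, fun _ _ => trivial, ?_⟩, by simp⟩
    · exact IsStarProjection.one _
    · simp [T.isTracialState.map_one]
  have hne : Nonempty {k : ℕ∞ | ∃ m : ℕ, k = (m : ℕ∞) ∧ ∃ x ∈ K0 A, p ^ m • x = 1} :=
    ⟨⟨0, 0, rfl, h1⟩⟩
  obtain ⟨m, hm, x, hx, hpx⟩ := ENat.sSup_mem_of_nonempty_of_lt_top hlt
  obtain ⟨k, z, hz⟩ := T.exists_int_of_mem_K0 hx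
  refine ⟨k, ?_⟩
  have hth : theta A ⟨p, hp, ‹_›, hlt⟩ = p ^ m := by
    rw [theta]
    congr 1
    change (sSup _ : ℕ∞).toNat = m
    rw [hm]; rfl
  rw [hth]
  have h2 : (T.size k : ℤ) = p ^ m * z := by
    have : (T.size k : ℝ) = p ^ m * z := by
      rw [← hz, ← mul_assoc]
      rw [nsmul_eq_mul] at hpx
      push_cast at hpx
      rw [hpx, one_mul]
    exact_mod_cast this
  have h3 : ((p ^ m : ℕ) : ℤ) ∣ (T.size k : ℤ) := ⟨z, by rw [h2]; push_cast; rfl⟩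
  exact_mod_cast h3

lemma theta_dvd_of_dvd {m : ℕ} {p : primeSet A} : theta A p ∣ m → (p : ℕ) ∣ m := by
  intro h
  refine (dvd_pow_self _ ?_).trans h
  obtain ⟨p, hp, h1, hlt⟩ := p
  intro h0
  rw [ENat.toNat_eq_zero] at h0
  rcases h0 with h0 | h0
  · change zeta A p = 0 at h0
    rw [h0] at h1; simp at h1
  · exact hlt.ne h0

lemma theta_pos (p : primeSet A) : 0 < theta A p := pow_pos p.2.1.pos _

/-- The `K₀`-classes of the relative commutant of a copy of `M_θ(ℂ)`. -/
lemma MatrixTower.theta_div_mem_traceK0 (T : MatrixTower A) {θ : ℕ}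
    (φ : Matrix (Fin θ) (Fin θ) ℂ →⋆ₐ[ℂ] A) (k : ℕ) (z : ℤ) :
    (θ * (z / T.size k) : ℝ) ∈
      traceK0 (StarSubalgebra.centralizer ℂ (φ.range : Set A)) := by
  have key : (θ * (1 / T.size k) : ℝ) ∈
      traceK0 (StarSubalgebra.centralizer ℂ (φ.range : Set A)) := by
    set i0 : Fin (T.size k) := ⟨0, T.size_pos k⟩
    set e : A := T.emb k (Matrix.single i0 i0 1) with he
    have hee : e * e = e := by rw [he, ← map_mul]; simp
    have hes : star e = e := by rw [he, ← map_star, Matrix.star_eq_conjTranspose]; simp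
    let E : Fin θ → Fin θ → A := fun i j => φ (Matrix.single i j 1)
    have hE : ∀ i j j' l, E i j * E j' l = if j = j' then E i l else 0 := by
      intro i j j' l
      simp only [E]
      rw [← map_mul]
      split_ifs with h
      · subst h; simp
      · rw [Matrix.single_mul_single_of_ne _ _ _ _ h, map_zero]
    have hEs : ∀ i j, star (E i j) = E j i := by
      intro i j
      simp only [E]
      rw [← map_star, Matrix.star_eq_conjTranspose]; simp
    have hE1 : ∑ i, E i i = 1 := by
      simp only [E]
      rw [← map_sum, Matrix.sum_single_eq_diagonal]
      exact map_one φ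
    -- This is the image of the minimal projection `e` of `T.alg k` under the isomorphism of `A`
    -- with the `θ × θ` matrices over the commutant. Summing the unnormalized diagonal gives `θ`
    -- times the trace of `e`.
    let M : Matrix (Fin θ) (Fin θ) A := fun i j => ∑ l, E l i * e * E j l
    refine AddSubgroup.subset_closure ⟨θ, M, ⟨?_, ?_⟩, ?_, ?_⟩
    · ext i j
      rw [Matrix.mul_apply]
      simp only [M]
      have : ∀ m, (∑ l, E l i * e * E m l) * (∑ l, E l m * e * E j l)
          = ∑ l, E l i * e * E m m * e * E j l := by
        intro m
        rw [Finset.sum_mul_sum]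
        refine Finset.sum_congr rfl fun l _ => ?_
        rw [Finset.sum_eq_single l]
        · calc E l i * e * E m l * (E l m * e * E j l)
              = E l i * e * (E m l * E l m) * e * E j l := by simp only [mul_assoc]
            _ = _ := by rw [hE, if_pos rfl]
        · intro l' _ hl'
          calc E l i * e * E m l * (E l' m * e * E j l')
              = E l i * e * (E m l * E l' m) * e * E j l' := by simp only [mul_assoc]
            _ = 0 := by rw [hE, if_neg hl'.symm]; simp
        · simp
      rw [Finset.sum_congr rfl fun m _ => this m, Finset.sum_comm]
      refine Finset.sum_congr rfl fun l _ => ?_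
      rw [← Finset.sum_mul, ← Finset.sum_mul, ← Finset.mul_sum, hE1, mul_one, mul_assoc (E l i), hee]
    · rw [isSelfAdjoint_iff]
      ext i j
      rw [Matrix.star_apply]
      simp only [M, star_sum, star_mul, hEs, hes, mul_assoc]
    · intro i j
      rw [StarSubalgebra.mem_centralizer_iff]
      suffices h : ∀ g ∈ φ.range, g * M i j = M i j * g from
        fun g hg => ⟨h g hg, h _ (star_mem hg)⟩
      rintro _ ⟨x, rfl⟩
      change φ x * _ = _ * φ x
      have hx : φ x = ∑ a, ∑ b, x a b • E a b := by
        conv_lhs => rw [Matrix.matrix_eq_sum_single x]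
        simp only [map_sum, E]
        refine Finset.sum_congr rfl fun a _ => Finset.sum_congr rfl fun b _ => ?_
        rw [← map_smul, Matrix.smul_single, smul_eq_mul, mul_one]
      have hcomm : ∀ a b, E a b * M i j = M i j * E a b := by
        intro a b
        simp only [M, Finset.mul_sum, Finset.sum_mul]
        rw [Finset.sum_eq_single b, Finset.sum_eq_single a]
        · rw [mul_assoc _ (E j a), hE, if_pos rfl, ← mul_assoc, ← mul_assoc, hE, if_pos rfl]
        · intro l _ hl
          rw [mul_assoc, hE, if_neg hl, mul_zero]
        · simp
        · intro l _ hl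
          rw [← mul_assoc, ← mul_assoc, hE, if_neg hl.symm]; simp
        · simp
      rw [hx]
      simp only [Finset.mul_sum, Finset.sum_mul, smul_mul_assoc, mul_smul_comm, hcomm]
    · have h1 : ∀ i, tracialState A (M i i) = ∑ _l : Fin θ, tracialState A (e * E i i) := by
        intro i
        simp only [M]
        rw [map_sum]
        refine Finset.sum_congr rfl fun l _ => ?_
        rw [mul_assoc, T.isTracialState.trace, mul_assoc, hE, if_pos rfl]
      have h2 : ∑ i, tracialState A (e * E i i) = 1 / T.size k := by
        rw [← map_sum, ← Finset.mul_sum, hE1, mul_one, he, T.tracialState_emb,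
          Matrix.trace_single_eq_same]
      rw [Finset.sum_congr rfl fun i _ => h1 i, Finset.sum_comm, Finset.sum_congr rfl fun _ _ => h2]
      simp
  have := AddSubgroup.zsmul_mem _ key z
  rw [zsmul_eq_mul] at this
  convert this using 1
  ring

end K0

/-! ### Determinants of exponentials of Hermitian matrices. -/

section Determinant

variable {ι : Type*} [Fintype ι] [DecidableEq ι]

lemma det_exp_I_smul_of_isHermitian {y : Matrix ι ι ℂ} (hy : y.IsHermitian) :
    (NormedSpace.exp (Complex.I • y)).det = Complex.exp (Complex.I * y.trace) := by
  set U := hy.eigenvectorUnitary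
  have hU : (U : Matrix ι ι ℂ) * star (U : Matrix ι ι ℂ) = 1 := (Unitary.mem_iff.mp U.2).2
  have hU' : star (U : Matrix ι ι ℂ) * (U : Matrix ι ι ℂ) = 1 := (Unitary.mem_iff.mp U.2).1
  have hspec : y = U * Matrix.diagonal (fun i => (hy.eigenvalues i : ℂ)) *
      star (U : Matrix ι ι ℂ) := by
    have := hy.spectral_theorem
    rwa [Unitary.conjStarAlgAut_apply] at this
  let V : (Matrix ι ι ℂ)ˣ := ⟨U, star (U : Matrix ι ι ℂ), hU, hU'⟩
  have h1 : Complex.I • y = V * Matrix.diagonal (fun i => Complex.I * hy.eigenvalues i) *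
      (↑V⁻¹ : Matrix ι ι ℂ) := by
    conv_lhs => rw [hspec]
    have : Matrix.diagonal (fun i => Complex.I * (hy.eigenvalues i : ℂ)) =
        Complex.I • Matrix.diagonal (fun i => (hy.eigenvalues i : ℂ)) := by
      rw [← Matrix.diagonal_smul]; rfl
    rw [this]
    simp only [Matrix.mul_smul, Matrix.smul_mul]
    rfl
  have h2 : y.trace = ∑ i, (hy.eigenvalues i : ℂ) := by
    conv_lhs => rw [hspec]
    rw [Matrix.trace_mul_comm, ← mul_assoc, hU', one_mul, Matrix.trace_diagonal]
  rw [h1, Matrix.exp_units_conj, Matrix.exp_diagonal, Matrix.det_units_conj, Matrix.det_diagonal, h2,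
    Finset.mul_sum, Complex.exp_sum]
  refine Finset.prod_congr rfl fun i _ => ?_
  rw [Complex.exp_eq_exp_ℂ]
  exact Pi.coe_exp (𝔸 := fun _ => ℂ) _ i

end Determinant

/-! ### The trace of the logarithm of a unitary and its additivity. -/

section LogTrace

variable {A : Type u} [CStarAlgebra A]

open Unitary selfAdjoint

/-- The trace of `(2πi)⁻¹ log u`, with the principal branch of the logarithm. -/
def logTrace (u : unitary A) : ℝ :=
  (2 * Real.pi)⁻¹ * (tracialState A (argSelfAdjoint u : A)).re

lemma exp_I_smul_argSelfAdjoint {u : unitary A} (hu : ‖(u - 1 : A)‖ < 2) :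
    NormedSpace.exp (Complex.I • (argSelfAdjoint u : A)) = u := by
  rw [← expUnitary_coe, expUnitary_argSelfAdjoint hu]

lemma argSelfAdjoint_mem {S : StarSubalgebra ℂ A} (hS : IsClosed (S : Set A)) {u : unitary A}
    (hu : (u : A) ∈ S) : (argSelfAdjoint u : A) ∈ S := by
  rw [argSelfAdjoint_coe]
  exact cfc_mem (hs := hS) _ hu

lemma expUnitary_mem {S : StarSubalgebra ℂ A} (hS : IsClosed (S : Set A)) {a : selfAdjoint A}
    (ha : (a : A) ∈ S) : (expUnitary a : A) ∈ S := by
  have : IsStarNormal (Complex.I • (a : A)) := a.2.isStarNormal.smul _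
  rw [expUnitary_coe, ← CFC.exp_eq_normedSpace_exp (𝕜 := ℂ)]
  exact cfc_mem (hs := hS) _ (S.smul_mem ha _)

lemma continuousOn_logTrace : ContinuousOn (logTrace : unitary A → ℝ) {u | ‖(u - 1 : A)‖ < 2} := by
  have h1 : {u : unitary A | ‖(u - 1 : A)‖ < 2} = Metric.ball 1 2 := by
    ext u; simp [Subtype.dist_eq, dist_eq_norm]
  rw [h1]
  have h2 : ContinuousOn (fun u : unitary A => (argSelfAdjoint u : A)) (Metric.ball 1 2) :=
    continuous_subtype_val.comp_continuousOn continuousOn_argSelfAdjoint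
  exact continuousOn_const.mul (Complex.continuous_re.comp_continuousOn
    ((tracialState A).continuous.comp_continuousOn h2))

lemma emb_exp {ι : Type*} [Fintype ι] [DecidableEq ι] (φ : Matrix ι ι ℂ →⋆ₐ[ℂ] A)
    (y : Matrix ι ι ℂ) : φ (NormedSpace.exp y) = NormedSpace.exp (φ y) := by
  let _ : NormedRing (Matrix ι ι ℂ) := Matrix.linftyOpNormedRing
  let _ : NormedAlgebra ℂ (Matrix ι ι ℂ) := Matrix.linftyOpNormedAlgebra
  let _ : NormedAlgebra ℚ (Matrix ι ι ℂ) := NormedAlgebra.restrictScalars ℚ ℂ _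
  let _ : NormedAlgebra ℚ A := NormedAlgebra.restrictScalars ℚ ℂ _
  refine NormedSpace.map_exp φ ?_ y
  exact φ.toAlgHom.toLinearMap.continuous_of_finiteDimensional

/-- The logarithm of a unitary of `T.alg k` is a Hermitian matrix of `T.alg k`, whose unnormalized
trace is `T.size k` times the normalized one. So the matrix determinant determines `T.size k *
logTrace u` modulo `ℤ`. -/
lemma MatrixTower.exp_logTrace (T : MatrixTower A) {k : ℕ}
    {x : Matrix (Fin (T.size k)) (Fin (T.size k)) ℂ} {u : unitary A} (hx : T.emb k x = u)
    (hu : ‖(u - 1 : A)‖ < 2) :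
    Complex.exp (2 * Real.pi * Complex.I * (T.size k * logTrace u : ℝ)) = x.det := by
  obtain ⟨y, hy⟩ : (argSelfAdjoint u : A) ∈ T.alg k :=
    argSelfAdjoint_mem (T.isClosed_alg k) ⟨x, hx⟩
  have hy : T.emb k y = (argSelfAdjoint u : A) := hy
  have hyh : y.IsHermitian := by
    apply T.injective k
    have : T.emb k (star y) = star (T.emb k y) := map_star _ _
    rw [Matrix.star_eq_conjTranspose] at this
    rw [this, hy]
    exact (argSelfAdjoint u).2.star_eq
  have h1 : x = NormedSpace.exp (Complex.I • y) := by
    apply T.injective k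
    rw [hx, emb_exp, map_smul, hy, exp_I_smul_argSelfAdjoint hu]
  have hreal : ((y.trace.re : ℝ) : ℂ) = y.trace := by
    rw [hyh.trace_eq_sum_eigenvalues]
    simp
  have hm : (T.size k : ℂ) ≠ 0 := by exact_mod_cast (T.size_pos k).ne'
  rw [h1, det_exp_I_smul_of_isHermitian hyh]
  congr 1
  rw [logTrace, ← hy, T.tracialState_emb, ← hreal, ← Complex.ofReal_natCast, ← Complex.ofReal_div,
    Complex.ofReal_re]
  have hpi : (Real.pi : ℂ) ≠ 0 := by exact_mod_cast Real.pi_ne_zero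
  push_cast
  field_simp

lemma MatrixTower.exists_unitary_near (T : MatrixTower A) (u : unitary A) {ε : ℝ} (hε : 0 < ε) :
    ∀ᶠ k in Filter.atTop, ∃ v : unitary A, (v : A) ∈ T.alg k ∧ ‖(v - u : A)‖ < ε := by
  set η : ℝ := min (1 / 2) (ε / 4)
  have hη : 0 < η := by positivity
  filter_upwards [T.eventually_exists_mem_alg_near (u : A) hη] with k hk
  obtain ⟨b, hb, hbu⟩ := hk
  have hη1 : η < 1 := (min_le_left _ _).trans_lt (by norm_num)
  refine ⟨⟨polarPart b, polarPart_mem_unitary (isUnit_of_norm_sub_lt_one u.2 (hbu.trans hη1))⟩,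
    polarPart_mem (T.isClosed_alg k) hb, ?_⟩
  have := norm_polarPart_sub_le u.2 hη1 hbu.le
  have h4 : η ≤ ε / 4 := min_le_right _ _
  change ‖polarPart b - u‖ < ε
  linarith

lemma norm_unitary_mul_sub_one_le (u v : unitary A) :
    ‖((u * v : unitary A) - 1 : A)‖ ≤ ‖(u - 1 : A)‖ + ‖(v - 1 : A)‖ := by
  have : ((u * v : unitary A) - 1 : A) = u * (v - 1) + (u - 1) := by
    rw [Submonoid.coe_mul]; noncomm_ring
  rw [this]
  refine (norm_add_le _ _).trans ?_
  rw [CStarRing.norm_coe_unitary_mul, add_comm]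

lemma logTrace_one : logTrace (1 : unitary A) = 0 := by
  have : argSelfAdjoint (1 : unitary A) = 0 := by
    have := argSelfAdjoint_expUnitary (A := A) (x := 0) (by simpa using Real.pi_pos)
    rwa [expUnitary_zero] at this
  simp [logTrace, this]

lemma isDiscrete_range_intCast : IsDiscrete (Set.range ((↑) : ℤ → ℝ)) :=
  Int.isClosedEmbedding_coe_real.isInducing.isDiscrete_range

/-- Multiplicativity of the determinant makes `T.size k` times the defect of additivity an integer.
Along the paths `exp (t log u)`, `exp (t log v)` the distances to `1` do not exceed those at `t =
1`, so the principal logarithm of the product stays continuous; the integer is constant, and it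
vanishes at `t = 0`. -/
lemma MatrixTower.logTrace_mul_of_mem (T : MatrixTower A) {k : ℕ} {u v : unitary A}
    (hu : (u : A) ∈ T.alg k) (hv : (v : A) ∈ T.alg k)
    (huv : ‖(u - 1 : A)‖ + ‖(v - 1 : A)‖ < 2) :
    logTrace (u * v) = logTrace u + logTrace v := by
  have hu2 : ‖(u - 1 : A)‖ < 2 := by linarith [norm_nonneg (v - 1 : A)]
  have hv2 : ‖(v - 1 : A)‖ < 2 := by linarith [norm_nonneg (u - 1 : A)]
  let a : ℝ → unitary A := fun t => expUnitary (t • argSelfAdjoint u)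
  let b : ℝ → unitary A := fun t => expUnitary (t • argSelfAdjoint v)
  have ha : Continuous a := by fun_prop
  have hb : Continuous b := by fun_prop
  have ha1 : ∀ t ∈ Set.Icc (0 : ℝ) 1, ‖(a t - 1 : A)‖ ≤ ‖(u - 1 : A)‖ := fun t ht =>
    norm_expUnitary_smul_argSelfAdjoint_sub_one_le u ht hu2
  have hb1 : ∀ t ∈ Set.Icc (0 : ℝ) 1, ‖(b t - 1 : A)‖ ≤ ‖(v - 1 : A)‖ := fun t ht =>
    norm_expUnitary_smul_argSelfAdjoint_sub_one_le v ht hv2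
  have hab : ∀ t ∈ Set.Icc (0 : ℝ) 1, ‖((a t * b t : unitary A) - 1 : A)‖ < 2 := fun t ht =>
    (norm_unitary_mul_sub_one_le _ _).trans_lt
      ((add_le_add (ha1 t ht) (hb1 t ht)).trans_lt huv)
  have hcl := T.isClosed_alg k
  have hmem : ∀ (w : unitary A), (w : A) ∈ T.alg k → ∀ t : ℝ,
      ((expUnitary (t • argSelfAdjoint w) : unitary A) : A) ∈ T.alg k := by
    intro w hw t
    refine expUnitary_mem hcl ?_
    have : ((t • argSelfAdjoint w : selfAdjoint A) : A) = (t : ℂ) • (argSelfAdjoint w : A) := by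
      rw [selfAdjoint.val_smul, Complex.coe_smul]
    rw [this]
    exact (T.alg k).smul_mem (argSelfAdjoint_mem hcl hw) _
  have hm : (T.size k : ℝ) ≠ 0 := by exact_mod_cast (T.size_pos k).ne'
  set m : ℝ := (T.size k : ℝ)
  let f : ℝ → ℝ := fun t => m * (logTrace (a t * b t) - logTrace (a t) - logTrace (b t))
  have hf : ContinuousOn f (Set.Icc 0 1) := by
    refine continuousOn_const.mul (((continuousOn_logTrace.comp (ha.mul hb).continuousOn hab).sub
      (continuousOn_logTrace.comp ha.continuousOn ?_)).sub
      (continuousOn_logTrace.comp hb.continuousOn ?_))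
    · exact fun t ht => (ha1 t ht).trans_lt hu2
    · exact fun t ht => (hb1 t ht).trans_lt hv2
  have hint : Set.MapsTo f (Set.Icc 0 1) (Set.range ((↑) : ℤ → ℝ)) := by
    intro t ht
    obtain ⟨x, hx⟩ := hmem u hu t
    obtain ⟨y, hy⟩ := hmem v hv t
    have hx : T.emb k x = a t := hx
    have hy : T.emb k y = b t := hy
    have hxy : T.emb k (x * y) = (a t * b t : unitary A) := by rw [map_mul, hx, hy]; rfl
    have e1 := T.exp_logTrace hx ((ha1 t ht).trans_lt hu2)
    have e2 := T.exp_logTrace hy ((hb1 t ht).trans_lt hv2)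
    have e3 := T.exp_logTrace hxy (hab t ht)
    rw [Matrix.det_mul, ← e1, ← e2, ← Complex.exp_add, Complex.exp_eq_exp_iff_exists_int] at e3
    obtain ⟨n, hn⟩ := e3
    refine ⟨n, ?_⟩
    have hpi : (2 * Real.pi * Complex.I : ℂ) ≠ 0 := Complex.two_pi_I_ne_zero
    have h5 : ((n : ℝ) : ℂ) = (f t : ℝ) := by
      apply mul_left_cancel₀ hpi
      simp only [f]
      push_cast at hn ⊢
      linear_combination -hn
    exact_mod_cast h5
  have hconst := isPreconnected_Icc.constant_of_mapsTo isDiscrete_range_intCast hf hint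
    (Set.right_mem_Icc.mpr zero_le_one) (Set.left_mem_Icc.mpr zero_le_one)
  simp only [f, a, b, one_smul, zero_smul, expUnitary_zero, mul_one, logTrace_one, sub_zero, mul_zero,
    expUnitary_argSelfAdjoint hu2, expUnitary_argSelfAdjoint hv2] at hconst
  rcases mul_eq_zero.mp hconst with h | h
  · exact absurd h hm
  · linarith

lemma MatrixTower.exists_seq_unitary (T : MatrixTower A) (u v : unitary A) :
    ∃ (x y : ℕ → unitary A) (k : ℕ → ℕ), (∀ n, (x n : A) ∈ T.alg (k n)) ∧
      (∀ n, (y n : A) ∈ T.alg (k n)) ∧ Filter.Tendsto x Filter.atTop (nhds u) ∧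
      Filter.Tendsto y Filter.atTop (nhds v) := by
  have h : ∀ n : ℕ, ∃ k, ∃ x y : unitary A, (x : A) ∈ T.alg k ∧ (y : A) ∈ T.alg k ∧
      dist x u < 1 / (n + 1) ∧ dist y v < 1 / (n + 1) := by
    intro n
    have hn : (0 : ℝ) < 1 / (n + 1) := by positivity
    obtain ⟨k, ⟨x, hx, hxu⟩, ⟨y, hy, hyv⟩⟩ :=
      ((T.exists_unitary_near u hn).and (T.exists_unitary_near v hn)).exists
    exact ⟨k, x, y, hx, hy, by rwa [Subtype.dist_eq, dist_eq_norm],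
      by rwa [Subtype.dist_eq, dist_eq_norm]⟩
  choose k x y hx hy hxu hyv using h
  refine ⟨x, y, k, hx, hy, ?_, ?_⟩
  · exact tendsto_iff_dist_tendsto_zero.mpr (squeeze_zero (fun _ => dist_nonneg)
      (fun n => (hxu n).le) tendsto_one_div_add_atTop_nhds_zero_nat)
  · exact tendsto_iff_dist_tendsto_zero.mpr (squeeze_zero (fun _ => dist_nonneg)
      (fun n => (hyv n).le) tendsto_one_div_add_atTop_nhds_zero_nat)

lemma continuousAt_logTrace {u : unitary A} (hu : ‖(u - 1 : A)‖ < 2) :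
    ContinuousAt (logTrace : unitary A → ℝ) u :=
  continuousOn_logTrace.continuousAt ((isOpen_lt (by fun_prop) continuous_const).mem_nhds hu)

/-- Unitaries of the tower are dense, and all three terms are continuous on the region where the
distance to `1` is below two. -/
theorem MatrixTower.logTrace_mul (T : MatrixTower A) {u v : unitary A}
    (huv : ‖(u - 1 : A)‖ + ‖(v - 1 : A)‖ < 2) :
    logTrace (u * v) = logTrace u + logTrace v := by
  have hu2 : ‖(u - 1 : A)‖ < 2 := by linarith [norm_nonneg (v - 1 : A)]
  have hv2 : ‖(v - 1 : A)‖ < 2 := by linarith [norm_nonneg (u - 1 : A)]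
  obtain ⟨x, y, k, hx, hy, hxu, hyv⟩ := T.exists_seq_unitary u v
  have l1 : Filter.Tendsto (fun n => logTrace (x n * y n)) Filter.atTop (nhds (logTrace (u * v))) :=
    (continuousAt_logTrace ((norm_unitary_mul_sub_one_le _ _).trans_lt huv)).tendsto.comp
      (hxu.mul hyv)
  have l2 : Filter.Tendsto (fun n => logTrace (x n) + logTrace (y n)) Filter.atTop
      (nhds (logTrace u + logTrace v)) :=
    ((continuousAt_logTrace hu2).tendsto.comp hxu).add
      ((continuousAt_logTrace hv2).tendsto.comp hyv)
  refine tendsto_nhds_unique l1 (l2.congr' ?_)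
  have hc : Filter.Tendsto (fun n => ‖(x n - 1 : A)‖ + ‖(y n - 1 : A)‖) Filter.atTop
      (nhds (‖(u - 1 : A)‖ + ‖(v - 1 : A)‖)) :=
    (((continuous_subtype_val.tendsto u).comp hxu).sub_const 1).norm.add
      (((continuous_subtype_val.tendsto v).comp hyv).sub_const 1).norm
  filter_upwards [hc.eventually_lt_const huv] with n hn
  exact (T.logTrace_mul_of_mem (hx n) (hy n) hn).symm

lemma norm_inv_sub_one (u : unitary A) : ‖((u⁻¹ : unitary A) - 1 : A)‖ = ‖(u - 1 : A)‖ := by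
  rw [← norm_star (u - 1 : A), star_sub, star_one]; rfl

lemma MatrixTower.logTrace_inv (T : MatrixTower A) {u : unitary A} (hu : ‖(u - 1 : A)‖ < 1) :
    logTrace u⁻¹ = -logTrace u := by
  have := T.logTrace_mul (u := u) (v := u⁻¹) (by rw [norm_inv_sub_one]; linarith)
  rw [mul_inv_cancel, logTrace_one] at this
  linarith

lemma argSelfAdjoint_map (α : A ≃⋆ₐ[ℂ] A) {u v : unitary A} (huv : (v : A) = α u)
    (hu : ‖(u - 1 : A)‖ < 2) : (argSelfAdjoint v : A) = α (argSelfAdjoint u) := by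
  have hc : Continuous α := (StarAlgEquiv.isometry α).continuous
  rw [argSelfAdjoint_coe, argSelfAdjoint_coe, huv]
  refine (StarAlgHomClass.map_cfc (R := ℂ) (S := ℂ) α _ (u : A) ?_ hc).symm
  exact Complex.continuous_ofReal.comp_continuousOn (Complex.continuousOn_arg.mono
    ((spectrum_subset_slitPlane_iff_norm_lt_two u.2).mpr hu))

lemma MatrixTower.logTrace_map (T : MatrixTower A) (α : A ≃⋆ₐ[ℂ] A) {u v : unitary A}
    (huv : (v : A) = α u) (hu : ‖(u - 1 : A)‖ < 2) : logTrace v = logTrace u := by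
  rw [logTrace, logTrace, argSelfAdjoint_map α huv hu, T.tracialState_map]

lemma MatrixTower.logTrace_conj (T : MatrixTower A) (w : unitary A) {u : unitary A}
    (hu : ‖(u - 1 : A)‖ < 2) : logTrace (w * u * w⁻¹) = logTrace u :=
  T.logTrace_map (conjStarAlgAut ℂ A w) rfl hu

lemma norm_conj_sub_one (w u : unitary A) :
    ‖((w * u * w⁻¹ : unitary A) - 1 : A)‖ = ‖(u - 1 : A)‖ := by
  have h : ((w * u * w⁻¹ : unitary A) - 1 : A) = w * (u - 1) * (w⁻¹ : unitary A) := by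
    have h1 : (w : A) * (w⁻¹ : unitary A) = 1 := (Unitary.mem_iff.mp w.2).2
    rw [mul_sub, sub_mul, mul_one, h1]; rfl
  rw [h, CStarRing.norm_mul_coe_unitary, CStarRing.norm_coe_unitary_mul]

end LogTrace

/-! ### The determinant along chains of unitaries, and its values on closed chains. -/

section Lift

variable {A : Type u} [CStarAlgebra A]

open Unitary selfAdjoint

/-- The pairs `(u, r)` for which `r` is the value of the de la Harpe-Skandalis determinant along
some chain of unitaries of `C` from `1` to `u`. -/
def detGroup (C : StarSubalgebra ℂ A) : Subgroup (unitary A × Multiplicative ℝ) :=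
  Subgroup.closure {x | (x.1 : A) ∈ C ∧ ‖(x.1 - 1 : A)‖ < 2 ∧
    x.2 = Multiplicative.ofAdd (logTrace x.1)}

/-- `r` is the value of the determinant along some chain of unitaries of `C` from `1` to `u`. -/
def HasDet (C : StarSubalgebra ℂ A) (u : unitary A) (r : ℝ) : Prop :=
  (u, Multiplicative.ofAdd r) ∈ detGroup C

variable {C : StarSubalgebra ℂ A}

lemma HasDet.of_norm_lt {u : unitary A} (hC : (u : A) ∈ C) (hu : ‖(u - 1 : A)‖ < 2) :
    HasDet C u (logTrace u) :=
  Subgroup.subset_closure ⟨hC, hu, rfl⟩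

lemma HasDet.one : HasDet C 1 0 := (detGroup C).one_mem

lemma HasDet.mul {u v : unitary A} {r s : ℝ} (hu : HasDet C u r) (hv : HasDet C v s) :
    HasDet C (u * v) (r + s) := (detGroup C).mul_mem hu hv

lemma HasDet.inv {u : unitary A} {r : ℝ} (hu : HasDet C u r) : HasDet C u⁻¹ (-r) :=
  (detGroup C).inv_mem hu

lemma HasDet.pow {u : unitary A} {r : ℝ} (hu : HasDet C u r) (n : ℕ) :
    HasDet C (u ^ n) (n * r) := by
  induction n with
  | zero => simpa using HasDet.one
  | succ n ih =>
    rw [pow_succ]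
    convert ih.mul hu using 1
    push_cast; ring

lemma HasDet.induction {P : unitary A → ℝ → Prop}
    (near : ∀ u : unitary A, (u : A) ∈ C → ‖(u - 1 : A)‖ < 2 → P u (logTrace u))
    (one : P 1 0) (mul : ∀ u v r s, P u r → P v s → P (u * v) (r + s))
    (inv : ∀ u r, P u r → P u⁻¹ (-r)) {u : unitary A} {r : ℝ} (h : HasDet C u r) : P u r := by
  suffices H : ∀ x ∈ detGroup C, P x.1 x.2.toAdd from H _ h
  intro x hx
  induction hx using Subgroup.closure_induction with
  | mem x hx =>
    obtain ⟨h1, h2, h3⟩ := hx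
    rw [h3]
    exact near _ h1 h2
  | one => exact one
  | mul x y _ _ hx hy => exact mul _ _ _ _ hx hy
  | inv x _ hx => exact inv _ _ hx

lemma HasDet.mem {u : unitary A} {r : ℝ} (h : HasDet C u r) : (u : A) ∈ C :=
  HasDet.induction (P := fun u _ => (u : A) ∈ C) (fun _ h _ => h) (one_mem C)
    (fun _ _ _ _ hu hv => mul_mem hu hv) (fun _ _ hu => StarMemClass.star_mem hu) h

lemma HasDet.conj (T : MatrixTower A) {u w : unitary A} {r : ℝ} (h : HasDet C u r)
    (hw : (w : A) ∈ C) : HasDet C (w * u * w⁻¹) r := by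
  refine HasDet.induction (P := fun u r => HasDet C (w * u * w⁻¹) r) ?_ ?_ ?_ ?_ h
  · intro u hu h2
    rw [← T.logTrace_conj w h2]
    refine HasDet.of_norm_lt (mul_mem (mul_mem hw hu) (StarMemClass.star_mem hw)) ?_
    rwa [norm_conj_sub_one]
  · simpa using HasDet.one
  · intro u v r s hu hv
    convert hu.mul hv using 1
    group
  · intro u r hu
    convert hu.inv using 1
    group

/-- The commutator is `u` times the conjugate of `u⁻¹` by `w`, and conjugation preserves
determinants. Only `u` needs a chain from `1`; for `w` membership in `C` is enough. -/
lemma HasDet.commutator (T : MatrixTower A) {u w : unitary A} {r : ℝ} (h : HasDet C u r)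
    (hw : (w : A) ∈ C) : HasDet C (u * w * u⁻¹ * w⁻¹) 0 := by
  have := h.mul (h.inv.conj T hw)
  rw [add_neg_cancel] at this
  convert this using 1
  group

/-- The scalar unitary `exp (2 π i r)`. -/
def scalarUnitary (A : Type u) [CStarAlgebra A] (r : ℝ) : unitary A :=
  expUnitary ((2 * Real.pi * r) • (1 : selfAdjoint A))

lemma coe_scalarUnitary (r : ℝ) :
    (scalarUnitary A r : A) = Complex.exp (2 * Real.pi * Complex.I * r) • (1 : A) := by
  rw [scalarUnitary, expUnitary_coe, selfAdjoint.val_smul, selfAdjoint.val_one,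
    ← Complex.coe_smul (2 * Real.pi * r), smul_smul, ← Algebra.algebraMap_eq_smul_one,
    ← Algebra.algebraMap_eq_smul_one]
  let _ : NormedAlgebra ℚ A := NormedAlgebra.restrictScalars ℚ ℂ _
  rw [← NormedSpace.algebraMap_exp_comm, Complex.exp_eq_exp_ℂ]
  congr 2
  push_cast
  ring

lemma scalarUnitary_add (r s : ℝ) :
    scalarUnitary A (r + s) = scalarUnitary A r * scalarUnitary A s := by
  ext
  rw [Submonoid.coe_mul, coe_scalarUnitary, coe_scalarUnitary, coe_scalarUnitary, smul_mul_smul_comm,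
    one_mul, ← Complex.exp_add]
  push_cast
  ring_nf

lemma scalarUnitary_zero : scalarUnitary A 0 = 1 := by
  ext; rw [coe_scalarUnitary]; simp

lemma scalarUnitary_nat_mul (n : ℕ) (r : ℝ) :
    scalarUnitary A (n * r) = scalarUnitary A r ^ n := by
  induction n with
  | zero => simp [scalarUnitary_zero]
  | succ n ih => rw [pow_succ, ← ih, ← scalarUnitary_add]; congr 1; push_cast; ring

lemma hasDet_scalarUnitary (T : MatrixTower A) (C : StarSubalgebra ℂ A) (r : ℝ) :
    HasDet C (scalarUnitary A r) r := by
  rcases subsingleton_or_nontrivial A with hs | hs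
  · have h1 := T.isTracialState.map_one
    rw [Subsingleton.elim (1 : A) 0, map_zero] at h1
    exact absurd h1 (by norm_num)
  -- With `N > 2 |r|` the angle `2π r / N` lies strictly between `-π` and `π`, the range of the
  -- principal branch.
  obtain ⟨N, hN⟩ := exists_nat_gt (2 * |r|)
  have hN0 : (0 : ℝ) < N := lt_of_le_of_lt (by positivity) hN
  set s : ℝ := r / N with hs
  have hrs : r = N * s := by rw [hs]; field_simp
  have hlt : ‖(2 * Real.pi * s) • (1 : selfAdjoint A)‖ < Real.pi := by
    change ‖(((2 * Real.pi * s) • (1 : selfAdjoint A) : selfAdjoint A) : A)‖ < Real.pi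
    rw [selfAdjoint.val_smul, selfAdjoint.val_one, norm_smul, norm_one,
      mul_one, Real.norm_eq_abs, abs_mul, abs_of_pos Real.two_pi_pos, hs, abs_div,
      abs_of_pos hN0, mul_div_assoc', div_lt_iff₀ hN0]
    nlinarith [Real.pi_pos]
  have harg := argSelfAdjoint_expUnitary hlt
  have hlog : logTrace (scalarUnitary A s) = s := by
    rw [logTrace, scalarUnitary, harg, selfAdjoint.val_smul, selfAdjoint.val_one,
      ← Complex.coe_smul, map_smul, T.isTracialState.map_one, smul_eq_mul, mul_one,
      Complex.ofReal_re]
    field_simp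
  have hnear : ‖((scalarUnitary A s : unitary A) - 1 : A)‖ < 2 := by
    rw [← sq_lt_sq₀ (norm_nonneg _) zero_le_two, scalarUnitary, norm_sq_expUnitary_sub_one hlt.le]
    have := Real.cos_lt_cos_of_nonneg_of_le_pi (norm_nonneg _) le_rfl hlt
    rw [Real.cos_pi] at this
    linarith
  have hmem : (scalarUnitary A s : A) ∈ C := by
    rw [coe_scalarUnitary]; exact C.smul_mem (one_mem C) _
  have := (HasDet.of_norm_lt hmem hnear).pow N
  rwa [hlog, ← scalarUnitary_nat_mul, ← hrs] at this

/-- Closed chains of unitaries have integral determinants. -/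
theorem MatrixTower.exists_int_of_hasDet_one (T : MatrixTower A) {r : ℝ} (h : HasDet C 1 r) :
    ∃ k, ∃ z : ℤ, r * T.size k = z := by
  -- The statement is proved for all pairs `(u, r)`, with `v` a nearby unitary of the tower:
  -- corrected by the logarithm of `v u⁻¹`, the number `r` is given modulo `ℤ / T.size k` by the
  -- matrix determinant of `v`. This property survives products and inverses, since approximants
  -- multiply and errors are only conjugated.
  have key : ∀ ε : ℝ, 0 < ε → ε < 1 → ∀ᶠ k in Filter.atTop, ∃ (v : unitary A) (x : _),
      T.emb k x = v ∧ ‖((v * (1 : unitary A)⁻¹ : unitary A) - 1 : A)‖ < ε ∧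
      Complex.exp (2 * Real.pi * Complex.I *
        (T.size k * (r + logTrace (v * (1 : unitary A)⁻¹)) : ℝ)) = x.det := by
    refine HasDet.induction (P := fun u r => ∀ ε : ℝ, 0 < ε → ε < 1 →
      ∀ᶠ k in Filter.atTop, ∃ (v : unitary A) (x : _), T.emb k x = v ∧
      ‖((v * u⁻¹ : unitary A) - 1 : A)‖ < ε ∧ Complex.exp (2 * Real.pi * Complex.I *
        (T.size k * (r + logTrace (v * u⁻¹)) : ℝ)) = x.det) ?_ ?_ ?_ ?_ h
    · intro u _ hu ε hε hε1
      have hδ : 0 < min ε (2 - ‖(u - 1 : A)‖) := lt_min hε (by linarith)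
      filter_upwards [T.exists_unitary_near u hδ] with k hk
      obtain ⟨v, ⟨x, hx⟩, hvu⟩ := hk
      have hvu' : ‖((v * u⁻¹ : unitary A) - 1 : A)‖ < min ε (2 - ‖(u - 1 : A)‖) := by
        rwa [norm_sub_eq] at hvu
      have h3 : ‖((v * u⁻¹ : unitary A) - 1 : A)‖ + ‖(u - 1 : A)‖ < 2 := by
        have := hvu'.trans_le (min_le_right _ _)
        linarith
      refine ⟨v, x, hx, hvu'.trans_le (min_le_left _ _), ?_⟩
      have h1 := T.logTrace_mul h3
      have h4 := norm_unitary_mul_sub_one_le (v * u⁻¹) u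
      rw [inv_mul_cancel_right] at h1 h4
      rw [add_comm, ← h1]
      exact T.exp_logTrace hx (h4.trans_lt h3)
    · intro ε hε _
      exact Filter.Eventually.of_forall fun k => ⟨1, 1, by simp, by simpa using hε,
        by simp [logTrace_one]⟩
    · intro u v r s hu hv ε hε hε1
      filter_upwards [hu (ε / 2) (by positivity) (by linarith),
        hv (ε / 2) (by positivity) (by linarith)] with k hk1 hk2
      obtain ⟨a, x, hx, ha, hxd⟩ := hk1
      obtain ⟨b, y, hy, hb, hyd⟩ := hk2
      have e1 : a * b * (u * v)⁻¹ = (a * (b * v⁻¹) * a⁻¹) * (a * u⁻¹) := by group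
      have h2 : ‖((a * (b * v⁻¹) * a⁻¹ : unitary A) - 1 : A)‖ < ε / 2 := by
        rwa [norm_conj_sub_one]
      refine ⟨a * b, x * y, by rw [map_mul, hx, hy]; rfl, ?_, ?_⟩
      · rw [e1]
        refine (norm_unitary_mul_sub_one_le _ _).trans_lt ?_
        linarith
      · rw [e1, T.logTrace_mul (by linarith), T.logTrace_conj a (by linarith), Matrix.det_mul, ← hxd,
          ← hyd, ← Complex.exp_add]
        congr 1
        push_cast
        ring
    · intro u r hu ε hε hε1
      filter_upwards [hu ε hε hε1] with k hk
      obtain ⟨a, x, hx, ha, hxd⟩ := hk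
      have hsx : T.emb k (star x) = (a⁻¹ : unitary A) := by
        rw [map_star, hx]; rfl
      have hxx : star x * x = 1 := by
        apply T.injective k
        rw [map_mul, hsx, hx, map_one]
        exact (Unitary.mem_iff.mp a.2).1
      have hdet : (star x).det * x.det = 1 := by rw [← Matrix.det_mul, hxx, Matrix.det_one]
      have e1 : a⁻¹ * u⁻¹⁻¹ = a⁻¹ * (a * u⁻¹)⁻¹ * a⁻¹⁻¹ := by group
      refine ⟨a⁻¹, star x, hsx, ?_, ?_⟩
      · rwa [e1, norm_conj_sub_one, norm_inv_sub_one]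
      · rw [e1, T.logTrace_conj _ (by rw [norm_inv_sub_one]; linarith),
          T.logTrace_inv (by linarith), eq_comm]
        refine (eq_inv_of_mul_eq_one_left hdet).trans ?_
        rw [← hxd, ← Complex.exp_neg]
        congr 1
        push_cast
        ring
  obtain ⟨k, v, x, hx, hv, hdet⟩ := (key (1 / 2) (by norm_num) (by norm_num)).exists
  rw [inv_one, mul_one] at hv hdet
  -- For `u = 1` the determinant of `v` is also given by its own logarithm; the two formulas differ
  -- exactly by the term with `r`.
  rw [← T.exp_logTrace hx (by linarith), Complex.exp_eq_exp_iff_exists_int] at hdet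
  obtain ⟨n, hn⟩ := hdet
  refine ⟨k, n, ?_⟩
  have h5 : ((r * T.size k : ℝ) : ℂ) = ((n : ℝ) : ℂ) := by
    apply mul_left_cancel₀ Complex.two_pi_I_ne_zero
    push_cast at hn ⊢
    linear_combination hn
  exact_mod_cast h5

/-- Multiplied by `e`, the series is that of `exp y`; multiplied by `1 - e`, only its constant term
survives. -/
lemma exp_mul_idempotent {y e : A} (he : e * e = e) (hye : y * e = e * y) :
    NormedSpace.exp (y * e) = NormedSpace.exp y * e + (1 - e) := by
  have hpow : ∀ n : ℕ, (y * e) ^ n * e = y ^ n * e := by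
    intro n
    have hc : Commute y e := hye
    rw [hc.mul_pow, mul_assoc, ← pow_succ, IsIdempotentElem.pow_succ_eq n he]
  have h1 : NormedSpace.exp (y * e) * e = NormedSpace.exp y * e := by
    have a1 := (NormedSpace.exp_series_hasSum_exp' (𝕂 := ℂ) (y * e)).mul_right e
    have a2 := (NormedSpace.exp_series_hasSum_exp' (𝕂 := ℂ) y).mul_right e
    simp only [smul_mul_assoc, hpow] at a1 a2
    exact a1.unique a2
  have h2 : NormedSpace.exp (y * e) * (1 - e) = 1 - e := by
    have a1 := (NormedSpace.exp_series_hasSum_exp' (𝕂 := ℂ) (y * e)).mul_right (1 - e)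
    have a2 := hasSum_single (f := fun n : ℕ => ((n.factorial : ℂ)⁻¹ • (y * e) ^ n) * (1 - e)) 0
      (by
        intro n hn
        obtain ⟨m, rfl⟩ := Nat.exists_eq_succ_of_ne_zero hn
        have : e * (1 - e) = 0 := by rw [mul_sub, mul_one, he, sub_self]
        rw [pow_succ, smul_mul_assoc, mul_assoc, mul_assoc y, this]
        simp)
    rw [a1.unique a2]
    simp
  calc NormedSpace.exp (y * e) = NormedSpace.exp (y * e) * e + NormedSpace.exp (y * e) * (1 - e) := by
        rw [← mul_add]; simp
    _ = _ := by rw [h1, h2]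

variable {θ : ℕ} (φ : Matrix (Fin θ) (Fin θ) ℂ →⋆ₐ[ℂ] A)

/-- The relative commutant of a full matrix subalgebra. -/
abbrev relCommutant (φ : Matrix (Fin θ) (Fin θ) ℂ →⋆ₐ[ℂ] A) : StarSubalgebra ℂ A :=
  StarSubalgebra.centralizer ℂ (φ.range : Set A)

lemma mul_map_eq_of_mem_relCommutant {c : A} (hc : c ∈ relCommutant φ) (x) :
    c * φ x = φ x * c :=
  (((StarSubalgebra.mem_centralizer_iff ℂ).mp hc _ ⟨x, rfl⟩).1).symm

lemma isClosed_centralizer (s : Set A) :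
    IsClosed (StarSubalgebra.centralizer ℂ s : Set A) := by
  have : (StarSubalgebra.centralizer ℂ s : Set A) =
      ⋂ g ∈ s, {z | g * z = z * g ∧ star g * z = z * star g} := by
    ext z
    rw [SetLike.mem_coe, StarSubalgebra.mem_centralizer_iff]
    simp only [Set.mem_iInter, Set.mem_ofPred_eq]
  rw [this]
  exact isClosed_biInter fun g _ => IsClosed.inter
    (isClosed_eq (by fun_prop) (by fun_prop)) (isClosed_eq (by fun_prop) (by fun_prop))

/-- The `θ` diagonal matrix units sum to `1`, and the off-diagonal ones, which commute with `c`,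
exchange their contributions under the trace. -/
lemma MatrixTower.tracialState_mul_minimal (T : MatrixTower A) {c : A}
    (hc : c ∈ relCommutant φ) (i : Fin θ) :
    tracialState A (c * φ (Matrix.single i i 1)) = tracialState A c / θ := by
  have h : ∀ j, tracialState A (c * φ (Matrix.single j j 1)) =
      tracialState A (c * φ (Matrix.single i i 1)) := by
    intro j
    have e1 : φ (Matrix.single j j 1) = φ (Matrix.single j i 1) * φ (Matrix.single i j 1) := by
      rw [← map_mul]; simp
    have e2 : φ (Matrix.single i i 1) = φ (Matrix.single i j 1) * φ (Matrix.single j i 1) := by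
      rw [← map_mul]; simp
    rw [e1, e2, ← mul_assoc, T.isTracialState.trace, ← mul_assoc, ← mul_assoc,
      mul_map_eq_of_mem_relCommutant φ hc]
  have h1 : ∑ j, φ (Matrix.single j j 1) = 1 := by
    rw [← map_sum, Matrix.sum_single_eq_diagonal]
    exact map_one φ
  have h2 : tracialState A c = ∑ j, tracialState A (c * φ (Matrix.single j j 1)) := by
    rw [← map_sum, ← Finset.mul_sum, h1, mul_one]
  have hθ : (θ : ℂ) ≠ 0 := by
    have := i.pos
    exact_mod_cast this.ne'
  rw [h2, Finset.sum_congr rfl fun j _ => h j, eq_div_iff hθ]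
  simp [mul_comm]

/-- The map `u ↦ u e + (1 - e)` is multiplicative on the commutant and turns `log u` into `(log u)
e`, whose trace is smaller by the factor `θ`. -/
lemma HasDet.compress (T : MatrixTower A) {u : unitary A} {r : ℝ}
    (h : HasDet (relCommutant φ) u r) (i : Fin θ) :
    ∃ v : unitary A, (v : A) = u * φ (Matrix.single i i 1) + (1 - φ (Matrix.single i i 1)) ∧
      HasDet ⊤ v (r / θ) := by
  set e : A := φ (Matrix.single i i 1) with he
  have hee : e * e = e := by rw [he, ← map_mul]; simp
  have hes : star e = e := by rw [he, ← map_star, Matrix.star_eq_conjTranspose]; simp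
  have hproj : IsStarProjection e := ⟨hee, hes⟩
  have he1 : e * (1 - e) = 0 := by rw [mul_sub, mul_one, hee, sub_self]
  have he2 : (1 - e) * e = 0 := by rw [sub_mul, one_mul, hee, sub_self]
  have he3 : (1 - e) * (1 - e) = 1 - e := by rw [mul_sub, mul_one, he2, sub_zero]
  have hmulform : ∀ a b : A, b * e = e * b →
      (a * e + (1 - e)) * (b * e + (1 - e)) = (a * b) * e + (1 - e) := by
    intro a b hb
    have hb' : (1 - e) * (b * e) = 0 := by rw [hb, ← mul_assoc, he2, zero_mul]
    rw [add_mul, mul_add, mul_add, hb', he3, mul_assoc a e (1 - e), he1, mul_assoc a e, ← mul_assoc e,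
      ← hb, mul_assoc b, hee, mul_assoc]
    simp
  suffices H : (u : A) ∈ relCommutant φ ∧ ∃ v : unitary A, (v : A) = (u : A) * e + (1 - e) ∧
      HasDet ⊤ v (r / θ) from H.2
  refine HasDet.induction (P := fun u r => (u : A) ∈ relCommutant φ ∧
    ∃ v : unitary A, (v : A) = (u : A) * e + (1 - e) ∧ HasDet ⊤ v (r / θ)) ?_ ?_ ?_ ?_ h
  · intro u hu h2
    refine ⟨hu, ?_⟩
    have hue := mul_map_eq_of_mem_relCommutant φ hu (Matrix.single i i 1)
    rw [← he] at hue
    have ha := argSelfAdjoint_mem (isClosed_centralizer _) hu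
    have hae := mul_map_eq_of_mem_relCommutant φ ha (Matrix.single i i 1)
    rw [← he] at hae
    let b : selfAdjoint A := ⟨(argSelfAdjoint u : A) * e, by
      rw [selfAdjoint.mem_iff, star_mul, hes, (argSelfAdjoint u).2, hae]⟩
    have hexp : (expUnitary b : A) = u * e + (1 - e) := by
      rw [expUnitary_coe]
      change NormedSpace.exp (Complex.I • ((argSelfAdjoint u : A) * e)) = _
      rw [← smul_mul_assoc, exp_mul_idempotent hee, exp_I_smul_argSelfAdjoint h2]
      rw [smul_mul_assoc, hae, mul_smul_comm]
    have hnorm : ‖b‖ < Real.pi := by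
      refine lt_of_le_of_lt (b := ‖argSelfAdjoint u‖) ?_ ?_
      · change ‖(argSelfAdjoint u : A) * e‖ ≤ ‖(argSelfAdjoint u : A)‖
        refine (norm_mul_le _ _).trans ?_
        exact mul_le_of_le_one_right (norm_nonneg _) hproj.norm_le
      · have := openPartialHomeomorph (A := A) |>.map_source (x := u)
          (by simpa [openPartialHomeomorph, Subtype.dist_eq, dist_eq_norm] using h2)
        simpa [openPartialHomeomorph] using this
    have hlog : logTrace (expUnitary b) = logTrace u / θ := by
      rw [logTrace, argSelfAdjoint_expUnitary hnorm, logTrace]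
      change _ * (tracialState A ((argSelfAdjoint u : A) * e)).re = _
      rw [he, T.tracialState_mul_minimal φ ha, Complex.div_natCast_re, mul_div_assoc]
    refine ⟨expUnitary b, hexp, ?_⟩
    rw [← hlog]
    refine HasDet.of_norm_lt trivial ?_
    have : ((expUnitary b : unitary A) - 1 : A) = (u - 1) * e := by
      rw [hexp, sub_mul, one_mul]; abel
    rw [this]
    refine (norm_mul_le _ _).trans_lt (lt_of_le_of_lt ?_ h2)
    exact mul_le_of_le_one_right (norm_nonneg _) hproj.norm_le
  · exact ⟨one_mem _, 1, by simp, by simpa using HasDet.one⟩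
  · rintro u v r s ⟨hu, u', hu', hud⟩ ⟨hv, v', hv', hvd⟩
    refine ⟨mul_mem hu hv, u' * v', ?_, ?_⟩
    · have hve := mul_map_eq_of_mem_relCommutant φ hv (Matrix.single i i 1)
      rw [Submonoid.coe_mul, Submonoid.coe_mul, hu', hv', hmulform _ _ hve]
    · rw [add_div]; exact hud.mul hvd
  · rintro u r ⟨hu, u', hu', hud⟩
    refine ⟨StarMemClass.star_mem hu, u'⁻¹, ?_, ?_⟩
    · have hue := mul_map_eq_of_mem_relCommutant φ (StarMemClass.star_mem hu) (Matrix.single i i 1)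
      change star (u' : A) = star (u : A) * e + (1 - e)
      rw [hu', star_add, star_mul, hes, star_sub, star_one, hes, hue]
    · rw [neg_div]; exact hud.inv

/-- Closed chains of unitaries in the commutant of a copy of `M_θ(ℂ)`. -/
theorem MatrixTower.mem_traceK0_of_hasDet_one (T : MatrixTower A) (hθ : 0 < θ) {r : ℝ}
    (h : HasDet (relCommutant φ) 1 r) : r ∈ traceK0 (relCommutant φ) := by
  -- Integrality applied to `r` itself would only place it in `ℤ / T.size k`. In the corner it
  -- places `r / θ` there, hence `r` in `θ ℤ / T.size k`, which consists of traces of the commutant.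
  obtain ⟨v, hv, hvd⟩ := h.compress φ T ⟨0, hθ⟩
  have hv1 : v = 1 := by ext; rw [hv]; simp
  rw [hv1] at hvd
  obtain ⟨k, z, hz⟩ := T.exists_int_of_hasDet_one hvd
  have hk : (T.size k : ℝ) ≠ 0 := by exact_mod_cast (T.size_pos k).ne'
  have hθ' : (θ : ℝ) ≠ 0 := by exact_mod_cast hθ.ne'
  have := T.theta_div_mem_traceK0 φ k z
  rwa [← hz, mul_div_cancel_right₀ _ hk, mul_div_cancel₀ _ hθ'] at this

end Lift

/-! ### Path integrals as determinants of chains. -/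

section Path

variable {A : Type u} [CStarAlgebra A]

open Unitary selfAdjoint Filter Topology Asymptotics

/-- The real part of `(2 π i)⁻¹ τ`. -/
def detForm (A : Type u) [CStarAlgebra A] : A →L[ℝ] ℝ :=
  Complex.reCLM.comp
    (((2 * Real.pi * Complex.I)⁻¹ • tracialState A : A →L[ℂ] ℂ).restrictScalars ℝ)

lemma detForm_apply (a : A) :
    detForm A a = ((2 * Real.pi * Complex.I)⁻¹ * tracialState A a).re := rfl

lemma detForm_I_smul_argSelfAdjoint (u : unitary A) :
    detForm A (Complex.I • (argSelfAdjoint u : A)) = logTrace u := by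
  rw [detForm_apply, map_smul, logTrace, smul_eq_mul, mul_inv, mul_assoc, ← mul_assoc Complex.I⁻¹,
    inv_mul_cancel₀ Complex.I_ne_zero, one_mul, ← Complex.re_ofReal_mul]
  push_cast
  rfl

/-- The exponential is tangent to `1 + x` at `x = 0`, so the logarithm of `f t` and `f t - 1` agree
up to `o(t - t₀)`. -/
lemma hasDerivAt_logTrace_of_eq_one {f : ℝ → unitary A} {f' : A} {t₀ : ℝ}
    (hf : HasDerivAt (fun t => (f t : A)) f' t₀) (h1 : f t₀ = 1) :
    HasDerivAt (fun t => logTrace (f t)) (detForm A f') t₀ := by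
  have hcont : ContinuousAt f t₀ :=
    IsInducing.subtypeVal.continuousAt_iff.mpr hf.continuousAt
  let x : ℝ → A := fun t => Complex.I • (argSelfAdjoint (f t) : A)
  have harg : ContinuousAt (fun u : unitary A => (argSelfAdjoint u : A)) (f t₀) := by
    refine continuous_subtype_val.continuousAt.comp
      (continuousOn_argSelfAdjoint.continuousAt ?_)
    rw [h1]; exact Metric.ball_mem_nhds 1 two_pos
  have hx0 : x t₀ = 0 := by
    simp [x, h1]
  have hxc : Tendsto x (𝓝 t₀) (𝓝 0) := by
    have : ContinuousAt x t₀ := (harg.comp hcont).const_smul _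
    rw [← hx0]; exact this
  have hexp : ∀ᶠ t in 𝓝 t₀, NormedSpace.exp (x t) = (f t : A) := by
    have : ∀ᶠ t in 𝓝 t₀, ‖(f t - 1 : A)‖ < 2 := by
      have hc : ContinuousAt (fun t => ‖(f t - 1 : A)‖) t₀ := (hf.continuousAt.sub_const 1).norm
      exact hc.eventually_lt continuousAt_const (by rw [h1]; simp)
    filter_upwards [this] with t ht using exp_I_smul_argSelfAdjoint ht
  have ho : (fun t => NormedSpace.exp (x t) - 1 - x t) =o[𝓝 t₀] x := by
    have := (hasFDerivAt_exp_zero (𝕂 := ℂ) (𝔸 := A)).isLittleO.comp_tendsto hxc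
    simpa [Function.comp_def, NormedSpace.exp_zero] using this
  have heq : (fun t => (f t - 1 : A)) ~[𝓝 t₀] x := by
    refine ho.congr' ?_ EventuallyEq.rfl
    filter_upwards [hexp] with t ht
    simp [ht]
  have ho2 : (fun t => x t - (f t - 1 : A)) =o[𝓝 t₀] fun t => t - t₀ := by
    refine heq.symm.isLittleO.trans_isBigO ?_
    have := hf.isBigO_sub
    simpa [h1] using this
  have hxd : HasDerivAt x f' t₀ := by
    rw [hasDerivAt_iff_isLittleO] at hf ⊢
    have := ho2.add hf
    refine this.congr_left fun t => ?_
    rw [hx0, h1]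
    simp only [Submonoid.coe_one]
    abel
  have := (detForm A).hasFDerivAt.comp_hasDerivAt t₀ hxd
  refine this.congr_of_eventuallyEq (Eventually.of_forall fun t => ?_)
  exact (detForm_I_smul_argSelfAdjoint _).symm

/-- Additivity reduces the derivative at `t₀` to that of the translate `f t * (f t₀)⁻¹`, which
passes through `1`. -/
lemma MatrixTower.hasDerivAt_logTrace (T : MatrixTower A) {f : ℝ → unitary A} {f' : A} {t₀ : ℝ}
    (hf : HasDerivAt (fun t => (f t : A)) f' t₀) (h2 : ‖(f t₀ - 1 : A)‖ < 2) :
    HasDerivAt (fun t => logTrace (f t)) (detForm A (f' * star (f t₀ : A))) t₀ := by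
  have h3 : HasDerivAt (fun t => ((f t * (f t₀)⁻¹ : unitary A) : A)) (f' * star (f t₀ : A)) t₀ :=
    hf.mul_const _
  have h4 := (hasDerivAt_logTrace_of_eq_one h3 (mul_inv_cancel _)).add_const (logTrace (f t₀))
  refine h4.congr_of_eventuallyEq ?_
  have hc : ContinuousAt (fun t => ‖((f t * (f t₀)⁻¹ : unitary A) - 1 : A)‖ + ‖(f t₀ - 1 : A)‖) t₀ :=
    ((h3.continuousAt.sub_const 1).norm).add_const _
  filter_upwards [hc.eventually_lt continuousAt_const (by simpa using h2)] with t ht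
  rw [← T.logTrace_mul ht, inv_mul_cancel_right]

variable {h : ℝ → A} {w : A}

/-- A path of unitaries, as a function with values in the unitary group. -/
def unitaryPath (h : ℝ → A) (t : ℝ) : unitary A :=
  open scoped Classical in if ht : h t ∈ unitary A then ⟨h t, ht⟩ else 1

lemma IsUnitaryPath.coe_unitaryPath (hh : IsUnitaryPath h w) {t : ℝ} (ht : t ∈ Set.Icc (0 : ℝ) 1) :
    (unitaryPath h t : A) = h t := by
  rw [unitaryPath, dif_pos (hh.mem_unitary t ht)]

lemma IsUnitaryPath.intervalIntegrable (hh : IsUnitaryPath h w) :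
    IntervalIntegrable (fun t => tracialState A (deriv h t * star (h t)))
      MeasureTheory.volume 0 1 := by
  obtain ⟨N, s, hs, h0, h1, hsm⟩ := hh.piecewise
  rw [← h0, ← h1]
  refine IntervalIntegrable.trans_iterate fun k hk => ?_
  rcases (hs (Nat.le_succ k)).eq_or_lt with heq | hlt
  · rw [Nat.succ_eq_add_one] at heq
    rw [heq]
  have hc : ContinuousOn (fun t => tracialState A
      (derivWithin h (Set.Icc (s k) (s (k + 1))) t * star (h t))) (Set.Icc (s k) (s (k + 1))) := by
    refine (tracialState A).continuous.comp_continuousOn (ContinuousOn.mul ?_ ?_)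
    · exact (hsm k hk).continuousOn_derivWithin (uniqueDiffOn_Icc hlt) (by norm_cast)
    · exact continuous_star.comp_continuousOn (hsm k hk).continuousOn
  have hi := hc.intervalIntegrable_of_Icc (μ := MeasureTheory.volume) hlt.le
  refine hi.congr_uIoo fun t ht => ?_
  rw [Set.uIoo_of_le hlt.le] at ht
  change tracialState A (derivWithin h _ t * _) = _
  rw [derivWithin_of_mem_nhds (Icc_mem_nhds ht.1 ht.2)]

lemma exists_Ioo_of_notMem_range {s : ℕ → ℝ} {N : ℕ} {t : ℝ}
    (h0 : s 0 < t) (h1 : t < s N) (ht : t ∉ Set.range s) :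
    ∃ i < N, t ∈ Set.Ioo (s i) (s (i + 1)) := by
  induction N with
  | zero => exact absurd (h0.trans h1) (lt_irrefl _)
  | succ n ih =>
    rcases lt_trichotomy t (s n) with h | h | h
    · obtain ⟨i, hi, hm⟩ := ih h
      exact ⟨i, hi.trans (Nat.lt_succ_self n), hm⟩
    · exact absurd ⟨n, h.symm⟩ ht
    · exact ⟨n, Nat.lt_succ_self n, h, h1⟩

/-- The partial integrals of the determinant form along a path. -/
def partialValue (h : ℝ → A) (t : ℝ) : ℝ :=
  ∫ s in (0 : ℝ)..t, detForm A (deriv h s * star (h s))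

lemma IsUnitaryPath.intervalIntegrable_detForm (hh : IsUnitaryPath h w) :
    IntervalIntegrable (fun t => detForm A (deriv h t * star (h t))) MeasureTheory.volume 0 1 := by
  have h2 := hh.intervalIntegrable.const_mul ((2 * Real.pi * Complex.I)⁻¹)
  exact ⟨h2.1.re, h2.2.re⟩

lemma IsUnitaryPath.partialValue_one (hh : IsUnitaryPath h w) :
    partialValue h 1 = pathValue h := by
  have h2 := hh.intervalIntegrable.const_mul ((2 * Real.pi * Complex.I)⁻¹)
  have h3 := ContinuousLinearMap.intervalIntegral_comp_comm Complex.reCLM h2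
  rw [pathValue, ← intervalIntegral.integral_const_mul]
  exact h3

/-- Away from the breakpoints the integrand is the derivative of the log-trace, so this is the
fundamental theorem of calculus off a countable set. The bound by `2` keeps the path in the domain
of the principal branch. -/
lemma IsUnitaryPath.partialValue_sub (hh : IsUnitaryPath h w) (T : MatrixTower A) {s t : ℝ}
    (hs : s ∈ Set.Icc (0 : ℝ) 1) (ht : t ∈ Set.Icc (0 : ℝ) 1)
    (hst : ∀ r ∈ Set.uIcc s t, ‖h r - h s‖ < 2) :
    partialValue h t - partialValue h s = logTrace (unitaryPath h t * (unitaryPath h s)⁻¹) := by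
  have hsub : Set.uIcc s t ⊆ Set.Icc 0 1 := Set.uIcc_subset_Icc hs ht
  have h01 : Set.uIcc (0 : ℝ) 1 = Set.Icc 0 1 := Set.uIcc_of_le zero_le_one
  have hint := hh.intervalIntegrable_detForm
  have i1 : IntervalIntegrable (fun t => detForm A (deriv h t * star (h t)))
      MeasureTheory.volume 0 t := hint.mono_set (by
    rw [h01]; exact Set.uIcc_subset_Icc (Set.left_mem_Icc.mpr zero_le_one) ht)
  have i2 : IntervalIntegrable (fun t => detForm A (deriv h t * star (h t)))
      MeasureTheory.volume 0 s := hint.mono_set (by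
    rw [h01]; exact Set.uIcc_subset_Icc (Set.left_mem_Icc.mpr zero_le_one) hs)
  have i3 : IntervalIntegrable (fun t => detForm A (deriv h t * star (h t)))
      MeasureTheory.volume s t := hint.mono_set (by rw [h01]; exact hsub)
  rw [partialValue, partialValue, intervalIntegral.integral_interval_sub_left i1 i2]
  obtain ⟨N, p, hp, hp0, hp1, hsm⟩ := hh.piecewise
  let G : ℝ → ℝ := fun r => logTrace (unitaryPath h r * (unitaryPath h s)⁻¹)
  have hnorm : ∀ r ∈ Set.uIcc s t,
      ‖((unitaryPath h r * (unitaryPath h s)⁻¹ : unitary A) - 1 : A)‖ < 2 := by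
    intro r hr
    have := norm_sub_eq (unitaryPath h r) (unitaryPath h s)
    rw [hh.coe_unitaryPath (hsub hr), hh.coe_unitaryPath hs] at this
    exact this ▸ hst r hr
  have hUc : ContinuousOn (fun r => unitaryPath h r) (Set.Icc 0 1) := by
    rw [IsInducing.subtypeVal.continuousOn_iff]
    exact hh.continuousOn.congr fun r hr => hh.coe_unitaryPath hr
  have hG : ContinuousOn G (Set.uIcc s t) :=
    continuousOn_logTrace.comp ((hUc.mono hsub).mul continuousOn_const) hnorm
  have hder : ∀ r ∈ Set.Ioo (min s t) (max s t) \ Set.range p,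
      HasDerivAt G (detForm A (deriv h r * star (h r))) r := by
    rintro r ⟨hr, hrp⟩
    have hr' : r ∈ Set.uIcc s t := Set.Ioo_subset_Icc_self hr
    have hr01 := hsub hr'
    have hr0 : 0 < r := lt_of_le_of_lt (le_min hs.1 ht.1) hr.1
    have hr1 : r < 1 := lt_of_lt_of_le hr.2 (max_le hs.2 ht.2)
    obtain ⟨i, hi, hmem⟩ := exists_Ioo_of_notMem_range (s := p) (N := N)
      (by rw [hp0]; exact hr0) (by rw [hp1]; exact hr1) hrp
    have hdiff : DifferentiableAt ℝ h r :=
      ((hsm i hi).contDiffAt (Icc_mem_nhds hmem.1 hmem.2)).differentiableAt (by simp)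
    have hd : HasDerivAt (fun r => ((unitaryPath h r * (unitaryPath h s)⁻¹ : unitary A) : A))
        (deriv h r * star (h s)) r := by
      refine (hdiff.hasDerivAt.mul_const (star (h s))).congr_of_eventuallyEq ?_
      filter_upwards [Icc_mem_nhds hr0 hr1] with q hq
      rw [← hh.coe_unitaryPath hq, ← hh.coe_unitaryPath hs]; rfl
    have := T.hasDerivAt_logTrace hd (hnorm r hr')
    convert this using 2
    have e1 : ((unitaryPath h r * (unitaryPath h s)⁻¹ : unitary A) : A) = h r * star (h s) := by
      rw [← hh.coe_unitaryPath hr01, ← hh.coe_unitaryPath hs]; rfl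
    rw [e1, star_mul, star_star, mul_assoc, ← mul_assoc (star (h s)),
      (Unitary.mem_iff.mp (hh.mem_unitary s hs)).1, one_mul]
  rw [MeasureTheory.integral_eq_of_hasDerivAt_off_countable G _ (Set.countable_range p) hG hder i3]
  simp [G, logTrace_one]

/-- The value of a path is the determinant of each chain of unitaries that stays uniformly close
to the path. -/
theorem IsUnitaryPath.hasDet (hh : IsUnitaryPath h w) (T : MatrixTower A) {C : StarSubalgebra ℂ A}
    {k : ℝ → unitary A} {ρ : ℝ} (hρ : ρ < 1) (hk0 : k 0 = 1)
    (hkC : ∀ t ∈ Set.Icc (0 : ℝ) 1, (k t : A) ∈ C)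
    (hkh : ∀ t ∈ Set.Icc (0 : ℝ) 1, ‖(k t : A) - h t‖ ≤ ρ) :
    HasDet C (k 1) (pathValue h + logTrace (k 1 * (unitaryPath h 1)⁻¹)) := by
  have hρ0 : 0 ≤ ρ := (norm_nonneg _).trans (hkh 0 (Set.left_mem_Icc.mpr zero_le_one))
  -- The candidate for the determinant of `k t`: integrate along the path, then jump from the path
  -- to the chain. The relation in `key` is symmetric and transitive, so by connectedness of the
  -- interval it need only hold locally; `k` is not required to be continuous.
  let ψ : ℝ → ℝ := fun t => partialValue h t + logTrace (k t * (unitaryPath h t)⁻¹)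
  have key : HasDet C (k 1 * (k 0)⁻¹) (ψ 1 - ψ 0) := by
    refine isPreconnected_Icc.induction₂ (s := Set.Icc (0 : ℝ) 1)
      (fun s t => HasDet C (k t * (k s)⁻¹) (ψ t - ψ s)) ?_ ?_ ?_
      (Set.left_mem_Icc.mpr zero_le_one) (Set.right_mem_Icc.mpr zero_le_one)
    · intro s hs
      have hcs := hh.continuousOn s hs
      -- The jumps at the two ends cost `ρ` each, so `2 - 2 * ρ` is what remains of the total `2`
      -- allowed by additivity.
      obtain ⟨ε, hε, hball⟩ := Metric.continuousWithinAt_iff.mp hcs (2 - 2 * ρ) (by linarith)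
      filter_upwards [self_mem_nhdsWithin, mem_nhdsWithin_of_mem_nhds (Metric.ball_mem_nhds s hε)]
        with t ht hts
      have hst : ∀ r ∈ Set.uIcc s t, ‖h r - h s‖ < 2 - 2 * ρ := by
        intro r hr
        rw [← dist_eq_norm]
        refine hball (Set.uIcc_subset_Icc hs ht hr) (lt_of_le_of_lt ?_ hts)
        rw [Real.dist_eq, Real.dist_eq]
        exact Set.abs_sub_left_of_mem_uIcc hr
      have hpart := hh.partialValue_sub T hs ht fun r hr => (hst r hr).trans_le (by linarith)
      have n1 : ‖((k t * (unitaryPath h t)⁻¹ : unitary A) - 1 : A)‖ ≤ ρ := by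
        rw [← star_eq_inv, ← norm_sub_eq, hh.coe_unitaryPath ht]; exact hkh t ht
      have n2 : ‖((unitaryPath h t * (unitaryPath h s)⁻¹ : unitary A) - 1 : A)‖ < 2 - 2 * ρ := by
        rw [← star_eq_inv, ← norm_sub_eq, hh.coe_unitaryPath ht, hh.coe_unitaryPath hs]
        exact hst t Set.right_mem_uIcc
      have n3 : ‖((unitaryPath h s * (k s)⁻¹ : unitary A) - 1 : A)‖ ≤ ρ := by
        rw [← star_eq_inv, ← norm_sub_eq, hh.coe_unitaryPath hs, norm_sub_rev]; exact hkh s hs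
      have n3' : logTrace (unitaryPath h s * (k s)⁻¹) = -logTrace (k s * (unitaryPath h s)⁻¹) := by
        rw [← T.logTrace_inv]
        · congr 1; group
        · rw [← star_eq_inv, ← norm_sub_eq, hh.coe_unitaryPath hs]
          exact (hkh s hs).trans_lt hρ
      have e1 : k t * (k s)⁻¹ = (k t * (unitaryPath h t)⁻¹ * (unitaryPath h t * (unitaryPath h s)⁻¹)) *
          (unitaryPath h s * (k s)⁻¹) := by group
      have n12 := norm_unitary_mul_sub_one_le (k t * (unitaryPath h t)⁻¹)
        (unitaryPath h t * (unitaryPath h s)⁻¹)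
      have n123 := norm_unitary_mul_sub_one_le
        (k t * (unitaryPath h t)⁻¹ * (unitaryPath h t * (unitaryPath h s)⁻¹))
        (unitaryPath h s * (k s)⁻¹)
      rw [← e1] at n123
      have hlog : ψ t - ψ s = logTrace (k t * (k s)⁻¹) := by
        rw [e1, T.logTrace_mul (by linarith), T.logTrace_mul (by linarith), ← hpart, n3']
        simp only [ψ]
        ring
      rw [hlog]
      exact HasDet.of_norm_lt (mul_mem (hkC t ht) (StarMemClass.star_mem (hkC s hs))) (by linarith)
    · intro x y z _ _ _ hxy hyz
      convert hyz.mul hxy using 1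
      · group
      · ring
    · intro x y _ _ hxy
      convert hxy.inv using 1
      · group
      · ring
  have hU0 : unitaryPath h 0 = 1 := by
    ext; rw [hh.coe_unitaryPath (Set.left_mem_Icc.mpr zero_le_one), hh.source]; rfl
  have hψ0 : ψ 0 = 0 := by simp [ψ, partialValue, hk0, hU0, logTrace_one]
  rw [hk0, hψ0, inv_one, mul_one, sub_zero] at key
  simpa only [ψ, hh.partialValue_one] using key

end Path

/-! ### Averaging over the unitary group of a finite-dimensional subalgebra. -/

section Average

variable {A : Type u} [CStarAlgebra A]

open Unitary selfAdjoint Filter Topology MeasureTheory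

/-- The group of unitaries of a unital `*`-subalgebra. -/
def unitarySubgroup (B : StarSubalgebra ℂ A) : Subgroup (unitary A) where
  carrier := {u | (u : A) ∈ B}
  mul_mem' {u v} hu hv := by
    rw [Set.mem_ofPred_eq] at *
    exact mul_mem hu hv
  one_mem' := by
    rw [Set.mem_ofPred_eq]
    exact one_mem B
  inv_mem' {u} hu := by
    rw [Set.mem_ofPred_eq] at *
    exact StarMemClass.star_mem hu

lemma mem_unitarySubgroup {B : StarSubalgebra ℂ A} {u : unitary A} :
    u ∈ unitarySubgroup B ↔ (u : A) ∈ B := by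
  change u ∈ {u : unitary A | (u : A) ∈ B} ↔ _
  rw [Set.mem_ofPred_eq]

lemma isCompact_unitaries (B : StarSubalgebra ℂ A) [FiniteDimensional ℂ B] :
    IsCompact (unitaries B) := by
  have hB : IsClosed (B : Set A) := isClosed_of_finiteDimensional B
  have hU : IsClosed (unitary A : Set A) := isClosed_unitary
  have : FiniteDimensional ℂ (Subalgebra.toSubmodule B.toSubalgebra) :=
    inferInstanceAs (FiniteDimensional ℂ B)
  have hp : ProperSpace (Subalgebra.toSubmodule B.toSubalgebra) :=
    FiniteDimensional.proper ℂ _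
  have hK : IsCompact ((↑) '' (Metric.closedBall (0 : Subalgebra.toSubmodule B.toSubalgebra) 1) :
      Set A) := (isCompact_closedBall _ _).image continuous_subtype_val
  refine hK.of_isClosed_subset (hB.inter hU) ?_
  rintro a ⟨haB, haU⟩
  refine ⟨⟨a, haB⟩, ?_, rfl⟩
  rw [mem_closedBall_zero_iff]
  rcases subsingleton_or_nontrivial A with _ | _
  · have : a = 0 := Subsingleton.elim _ _
    simp [this]
  · exact (CStarRing.norm_of_mem_unitary haU).le

instance compactSpace_unitarySubgroup (B : StarSubalgebra ℂ A) [FiniteDimensional ℂ B] :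
    CompactSpace (unitarySubgroup B) := by
  have h : IsEmbedding (fun u : unitarySubgroup B => ((u : unitary A) : A)) :=
    IsEmbedding.subtypeVal.comp IsEmbedding.subtypeVal
  rw [← isCompact_univ_iff, h.isCompact_iff]
  convert isCompact_unitaries B
  ext a
  simp only [Set.image_univ, Set.mem_range, Subtype.exists, unitaries]
  constructor
  · rintro ⟨u, hu, h, rfl⟩; exact ⟨mem_unitarySubgroup.mp h, hu⟩
  · rintro ⟨h, hu⟩; exact ⟨a, hu, mem_unitarySubgroup.mpr h, rfl⟩

lemma mem_span_unitaries {B : StarSubalgebra ℂ A} (hB : IsClosed (B : Set A)) {a : A}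
    (ha : a ∈ B) : a ∈ Submodule.span ℂ (unitaries B) := by
  have : IsClosed (B : Set A) := hB
  have h : (⟨a, ha⟩ : B) ∈ Submodule.span ℂ (unitary B : Set B) := by
    rw [CStarAlgebra.span_unitary]; trivial
  have h2 := Submodule.mem_map_of_mem (f := B.subtype.toAlgHom.toLinearMap) h
  rw [Submodule.map_span] at h2
  refine Submodule.span_mono ?_ h2
  rintro _ ⟨u, hu, rfl⟩
  exact ⟨u.2, Unitary.map_mem B.subtype hu⟩

lemma mem_centralizer_of_unitaries {B : StarSubalgebra ℂ A} (hB : IsClosed (B : Set A)) {b : A}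
    (h : ∀ u ∈ unitaries B, u * b = b * u) : b ∈ StarSubalgebra.centralizer ℂ (B : Set A) := by
  have key : ∀ a ∈ B, a * b = b * a := by
    intro a ha
    have hspan := mem_span_unitaries hB ha
    clear ha
    induction hspan using Submodule.span_induction with
    | mem x hx => exact h x hx
    | zero => simp
    | add x y _ _ hx hy => rw [add_mul, mul_add, hx, hy]
    | smul c x _ hx => rw [smul_mul_assoc, mul_smul_comm, hx]
  rw [StarSubalgebra.mem_centralizer_iff]
  exact fun a ha => ⟨key a ha, key _ (StarMemClass.star_mem ha)⟩

/-- The element is the Haar average of `u a u*` over the compact unitary group of `B`. Left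
invariance puts it in the commutant, since the unitaries span `B`; its distance to `a` is at most
the largest commutator. -/
theorem exists_mem_centralizer_near (B : StarSubalgebra ℂ A) [FiniteDimensional ℂ B] (a : A) :
    ∃ b ∈ StarSubalgebra.centralizer ℂ (B : Set A), ∀ δ : ℝ,
      (∀ u ∈ unitaries B, ‖a * u - u * a‖ ≤ δ) → ‖b - a‖ ≤ δ := by
  let _ : MeasurableSpace (unitarySubgroup B) := borel _
  have : BorelSpace (unitarySubgroup B) := ⟨rfl⟩
  let K : TopologicalSpace.PositiveCompacts (unitarySubgroup B) := ⊤
  let μ := Measure.haarMeasure K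
  have hμ : IsProbabilityMeasure μ := ⟨by
    have := Measure.haarMeasure_self (K₀ := K)
    simpa [K, TopologicalSpace.PositiveCompacts.coe_top] using this⟩
  let c : unitarySubgroup B → A := fun u => u * a * star ((u : unitary A) : A)
  have hc : Continuous c := by fun_prop
  have hint : Integrable c μ := hc.integrable_of_hasCompactSupport (.of_compactSpace c)
  refine ⟨∫ u, c u ∂μ, mem_centralizer_of_unitaries (isClosed_of_finiteDimensional B) ?_, ?_⟩
  · rintro v ⟨hvB, hvU⟩
    let v' : unitarySubgroup B := ⟨⟨v, hvU⟩, mem_unitarySubgroup.mpr hvB⟩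
    have h1 : ∫ u, c u ∂μ = v * (∫ u, c u ∂μ) * star v := by
      have h2 : ∫ u, c (v' * u) ∂μ = ∫ u, c u ∂μ := integral_mul_left_eq_self c v'
      refine h2.symm.trans ?_
      have h3 : ∀ u, c (v' * u) = v * c u * star v := by
        intro u
        simp only [c, v', Subgroup.coe_mul, Submonoid.coe_mul, star_mul, mul_assoc]
      simp_rw [h3]
      rw [integral_mul_const_of_integrable (hint.const_mul v),
        integral_const_mul_of_integrable hint]
    have h4 : star v * v = 1 := (Unitary.mem_iff.mp hvU).1
    conv_rhs => rw [h1]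
    rw [mul_assoc _ _ v, h4, mul_one]
  · intro δ hδ
    have h1 : (∫ u, c u ∂μ) - a = ∫ u, (c u - a) ∂μ := by
      rw [integral_sub hint (integrable_const a), integral_const]; simp
    rw [h1]
    refine (norm_integral_le_of_norm_le_const (C := δ) (Eventually.of_forall fun u => ?_)).trans
      (by simp)
    have h2 := hδ u ⟨mem_unitarySubgroup.mp u.2, (u : unitary A).2⟩
    have h3 : ((u : unitary A) : A) * star ((u : unitary A) : A) = 1 :=
      (Unitary.mem_iff.mp (u : unitary A).2).2
    have h4 : c u - a = (u * a - a * u) * star ((u : unitary A) : A) := by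
      rw [sub_mul, mul_assoc a, h3, mul_one]
    rw [h4, CStarRing.norm_mul_mem_unitary _ (Unitary.star_mem (u : unitary A).2), norm_sub_rev]
    exact h2

end Average

/-! ### The value of the invariant for actions that are inner on each algebra of the tower. -/

section Invariance

variable {A : Type u} [CStarAlgebra A]

open Unitary selfAdjoint Filter Topology MeasureTheory

lemma exists_unitary_mem_centralizer_near (B : StarSubalgebra ℂ A) [FiniteDimensional ℂ B]
    {w : A} (hw : w ∈ unitary A) {η : ℝ} (hη : η < 1)
    (h : ∀ u ∈ unitaries B, ‖w * u - u * w‖ ≤ η) :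
    ∃ v : unitary A, (v : A) ∈ StarSubalgebra.centralizer ℂ (B : Set A) ∧ ‖(v : A) - w‖ ≤ 2 * η := by
  obtain ⟨b, hb, hbδ⟩ := exists_mem_centralizer_near B w
  have hbw := hbδ η h
  exact ⟨⟨polarPart b, polarPart_mem_unitary (isUnit_of_norm_sub_lt_one hw (hbw.trans_lt hη))⟩,
    polarPart_mem (isClosed_centralizer _) hb, norm_polarPart_sub_le hw hη hbw⟩

lemma coe_mul_inv_sub_one (u v : unitary A) :
    ‖((u * v⁻¹ : unitary A) - 1 : A)‖ = ‖(u - v : A)‖ := by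
  rw [← star_eq_inv, ← norm_sub_eq]

/-- By compactness of `[0, 1]` times the unitaries of `B`, the commutators are bounded by some `M <
1 / 2`. Averaging and taking polar parts at each time separately gives a chain in the commutant
within `2 M < 1` of the path. -/
theorem IsUnitaryPath.exists_hasDet (T : MatrixTower A) (B : StarSubalgebra ℂ A)
    [FiniteDimensional ℂ B] {h : ℝ → A} {w : unitary A} (hh : IsUnitaryPath h w)
    (hc : ∀ t ∈ Set.Icc (0 : ℝ) 1, ∀ a ∈ unitaries B, ‖h t * a - a * h t‖ < 1 / 2) :
    ∃ v : unitary A, ‖(v - w : A)‖ < 1 ∧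
      HasDet (StarSubalgebra.centralizer ℂ (B : Set A)) v (pathValue h + logTrace (v * w⁻¹)) := by
  have hcont : ContinuousOn (fun x : ℝ × A => ‖h x.1 * x.2 - x.2 * h x.1‖)
      (Set.Icc 0 1 ×ˢ unitaries B) := by
    have h1 : ContinuousOn (fun x : ℝ × A => h x.1) (Set.Icc 0 1 ×ˢ unitaries B) :=
      hh.continuousOn.comp continuousOn_fst fun x hx => hx.1
    exact ((h1.mul continuousOn_snd).sub (continuousOn_snd.mul h1)).norm
  obtain ⟨⟨t₀, a₀⟩, ⟨ht₀, ha₀⟩, hmax⟩ := (isCompact_Icc.prod (isCompact_unitaries B)).exists_isMaxOn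
    ⟨(0, 1), Set.left_mem_Icc.mpr zero_le_one, one_mem B, one_mem _⟩ hcont
  set M : ℝ := ‖h t₀ * a₀ - a₀ * h t₀‖
  have hM : M < 1 / 2 := hc t₀ ht₀ a₀ ha₀
  have hk : ∀ t, ∃ v : unitary A, (t = 0 → v = 1) ∧ (t ∈ Set.Icc (0 : ℝ) 1 →
      (v : A) ∈ StarSubalgebra.centralizer ℂ (B : Set A) ∧ ‖(v : A) - h t‖ ≤ 2 * M) := by
    intro t
    rcases eq_or_ne t 0 with rfl | h0
    · exact ⟨1, fun _ => rfl, fun _ => ⟨one_mem _, by simp [hh.source, M]⟩⟩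
    by_cases ht : t ∈ Set.Icc (0 : ℝ) 1
    · obtain ⟨v, hv⟩ := exists_unitary_mem_centralizer_near B (hh.mem_unitary t ht)
        (η := M) (by linarith) fun u hu => hmax (Set.mk_mem_prod ht hu)
      exact ⟨v, fun h => absurd h h0, fun _ => hv⟩
    · exact ⟨1, fun _ => rfl, fun h => absurd h ht⟩
  choose k hk0 hk using hk
  have h1 : unitaryPath h 1 = w := by
    ext; rw [hh.coe_unitaryPath (Set.right_mem_Icc.mpr zero_le_one), hh.target]
  refine ⟨k 1, ?_, ?_⟩
  · have := (hk 1 (Set.right_mem_Icc.mpr zero_le_one)).2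
    rw [hh.target] at this
    linarith
  · rw [← h1]
    exact hh.hasDet T (ρ := 2 * M) (by linarith) (hk0 0 rfl) (fun t ht => (hk t ht).1)
      fun t ht => (hk t ht).2

/-- A unitary that commutes exactly with `B` is joined to `1` by an almost commuting path. The
nearby chain in the commutant may end at another unitary, but a last short step inside the commutant
leads to `v`. -/
lemma IsAdmissibleConst.exists_hasDet (T : MatrixTower A) {δ : ℝ} (hδ : IsAdmissibleConst A δ)
    (B : StarSubalgebra ℂ A) [hB : FiniteDimensional ℂ B] {v : unitary A}
    (hv : (v : A) ∈ StarSubalgebra.centralizer ℂ (B : Set A)) :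
    ∃ r, HasDet (StarSubalgebra.centralizer ℂ (B : Set A)) v r := by
  obtain ⟨h, hh, hc⟩ := hδ.2.2 B hB v v.2 fun a ha => by
    rw [((StarSubalgebra.mem_centralizer_iff ℂ).mp hv a ha.1).1, sub_self, norm_zero]
    exact hδ.1
  obtain ⟨w, hw, hd⟩ := hh.exists_hasDet T B fun t ht a ha => (hc t ht a ha).trans (by norm_num)
  have h1 : HasDet (StarSubalgebra.centralizer ℂ (B : Set A)) (v * w⁻¹) (logTrace (v * w⁻¹)) :=
    HasDet.of_norm_lt (mul_mem hv (StarMemClass.star_mem hd.mem)) (by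
      rw [coe_mul_inv_sub_one, norm_sub_rev]; linarith)
  have h2 := h1.mul hd
  rw [inv_mul_cancel_right] at h2
  exact ⟨_, h2⟩

lemma MatrixTower.logTrace_mul_four (T : MatrixTower A) {a b c d : unitary A}
    (hac : logTrace c = -logTrace a) (hbd : logTrace d = -logTrace b)
    (hsum : ‖(a - 1 : A)‖ + ‖(b - 1 : A)‖ + ‖(c - 1 : A)‖ + ‖(d - 1 : A)‖ < 2) :
    logTrace (a * b * c * d) = 0 := by
  have h1 := norm_unitary_mul_sub_one_le a b
  have h2 := norm_unitary_mul_sub_one_le (a * b) c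
  have := norm_nonneg (c - 1 : A)
  have := norm_nonneg (d - 1 : A)
  rw [T.logTrace_mul (by linarith), T.logTrace_mul (by linarith), T.logTrace_mul (by linarith),
    hac, hbd]
  ring

/-- An automorphism, restricted to the unitary group. -/
def unitaryMap (α : A ≃⋆ₐ[ℂ] A) : unitary A →* unitary A :=
  MonoidHom.mk' (fun u => ⟨α u, Unitary.map_mem α u.2⟩) fun _ _ => Subtype.ext (map_mul α _ _)

lemma coe_unitaryMap (α : A ≃⋆ₐ[ℂ] A) (u : unitary A) : (unitaryMap α u : A) = α u := rfl

lemma norm_unitaryMap_sub_one (α : A ≃⋆ₐ[ℂ] A) (u : unitary A) :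
    ‖(unitaryMap α u - 1 : A)‖ = ‖(u - 1 : A)‖ := by
  rw [coe_unitaryMap]
  nth_rewrite 1 [← map_one α]
  rw [← map_sub, StarAlgEquiv.norm_map]

/-- The twisted commutator `u α(v) (v β(u))*`. -/
def twistedCommutator (α β : A ≃⋆ₐ[ℂ] A) (u v : unitary A) : unitary A :=
  u * unitaryMap α v * (v * unitaryMap β u)⁻¹

/-- With `u' = a u` and `v' = b v`, the quotient of the two twisted commutators is a product of
conjugates of `a`, `α b`, `(β a)⁻¹` and `b⁻¹`. By invariance of the trace the four logarithms cancel
in pairs; `κ < 1 / 2` keeps the total distance below two. -/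
lemma MatrixTower.twistedCommutator_perturb (T : MatrixTower A) (α β : A ≃⋆ₐ[ℂ] A)
    {u u' v v' : unitary A} {κ : ℝ} (hκ : κ < 1 / 2) (hu : ‖(u' - u : A)‖ ≤ κ)
    (hv : ‖(v' - v : A)‖ ≤ κ) :
    logTrace (twistedCommutator α β u' v' * (twistedCommutator α β u v)⁻¹) = 0 ∧
      ‖(twistedCommutator α β u' v' - twistedCommutator α β u v : A)‖ ≤ 4 * κ := by
  rw [← coe_mul_inv_sub_one] at hu hv ⊢
  obtain ⟨a, ha⟩ : ∃ a, a = u' * u⁻¹ := ⟨_, rfl⟩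
  obtain ⟨b, hb⟩ : ∃ b, b = v' * v⁻¹ := ⟨_, rfl⟩
  obtain rfl : u' = a * u := by rw [ha]; group
  obtain rfl : v' = b * v := by rw [hb]; group
  rw [mul_inv_cancel_right] at hu hv
  set y := u * unitaryMap α v * (unitaryMap β u)⁻¹ with hy
  have key : twistedCommutator α β (a * u) (b * v) * (twistedCommutator α β u v)⁻¹ =
      a * (u * unitaryMap α b * u⁻¹) * (y * (unitaryMap β a)⁻¹ * y⁻¹) *
        ((y * v⁻¹) * b⁻¹ * (y * v⁻¹)⁻¹) := by
    rw [hy]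
    simp only [twistedCommutator, map_mul]
    group
  have n2 : ‖((u * unitaryMap α b * u⁻¹ : unitary A) - 1 : A)‖ = ‖(b - 1 : A)‖ := by
    rw [norm_conj_sub_one, norm_unitaryMap_sub_one]
  have n3 : ‖((y * (unitaryMap β a)⁻¹ * y⁻¹ : unitary A) - 1 : A)‖ = ‖(a - 1 : A)‖ := by
    rw [norm_conj_sub_one, norm_inv_sub_one, norm_unitaryMap_sub_one]
  have n4 : ‖(((y * v⁻¹) * b⁻¹ * (y * v⁻¹)⁻¹ : unitary A) - 1 : A)‖ = ‖(b - 1 : A)‖ := by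
    rw [norm_conj_sub_one, norm_inv_sub_one]
  rw [key]
  constructor
  · refine T.logTrace_mul_four ?_ ?_ (by rw [n2, n3, n4]; linarith)
    · rw [T.logTrace_conj _ (by rw [norm_inv_sub_one, norm_unitaryMap_sub_one]; linarith),
        T.logTrace_inv (by rw [norm_unitaryMap_sub_one]; linarith),
        T.logTrace_map β (coe_unitaryMap β a) (by linarith)]
    · rw [T.logTrace_conj _ (by rw [norm_inv_sub_one]; linarith), T.logTrace_inv (by linarith),
        T.logTrace_conj _ (by rw [norm_unitaryMap_sub_one]; linarith),
        T.logTrace_map α (coe_unitaryMap α b) (by linarith)]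
  · have h1 := norm_unitary_mul_sub_one_le a (u * unitaryMap α b * u⁻¹)
    have h2 := norm_unitary_mul_sub_one_le (a * (u * unitaryMap α b * u⁻¹))
      (y * (unitaryMap β a)⁻¹ * y⁻¹)
    have h3 := norm_unitary_mul_sub_one_le (a * (u * unitaryMap α b * u⁻¹) *
      (y * (unitaryMap β a)⁻¹ * y⁻¹)) ((y * v⁻¹) * b⁻¹ * (y * v⁻¹)⁻¹)
    rw [n2] at h1; rw [n3] at h2; rw [n4] at h3
    linarith

lemma MatrixTower.eventually_near_of_isCompact (T : MatrixTower A) {K : Set A} (hK : IsCompact K)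
    {ε : ℝ} (hε : 0 < ε) : ∀ᶠ j in atTop, ∀ w ∈ K, ∃ b ∈ T.alg j, ‖b - w‖ < ε := by
  obtain ⟨t, -, htf, htK⟩ := hK.finite_cover_balls (half_pos hε)
  have := (htf.eventually_all (l := atTop) (p := fun a j => ∃ b ∈ T.alg j, ‖b - a‖ < ε / 2)).mpr
    fun a _ => T.eventually_exists_mem_alg_near a (half_pos hε)
  filter_upwards [this] with j hj w hw
  obtain ⟨a, ha, hwa⟩ := Set.mem_iUnion₂.mp (htK hw)
  obtain ⟨b, hb, hba⟩ := hj a ha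
  refine ⟨b, hb, ?_⟩
  rw [mem_ball_iff_norm'] at hwa
  calc ‖b - w‖ = ‖(b - a) + (a - w)‖ := by simp
    _ ≤ ‖b - a‖ + ‖a - w‖ := norm_add_le _ _
    _ < ε := by linarith

lemma IsFullMatrix.exists_hom {B : StarSubalgebra ℂ A} {n : ℕ} (h : IsFullMatrix B n) :
    ∃ φ : Matrix (Fin n) (Fin n) ℂ →⋆ₐ[ℂ] A, Function.Injective φ ∧ φ.range = B := by
  obtain ⟨e⟩ := h
  refine ⟨B.subtype.comp (e : Matrix (Fin n) (Fin n) ℂ →⋆ₐ[ℂ] B),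
    Subtype.val_injective.comp e.injective, ?_⟩
  ext a
  constructor
  · rintro ⟨x, rfl⟩; exact (e x).2
  · intro ha; exact ⟨e.symm ⟨a, ha⟩, by simp⟩

lemma norm_unitary_conj (u : unitary A) (a : A) : ‖(u : A) * a * star (u : A)‖ = ‖a‖ := by
  rw [CStarRing.norm_mul_mem_unitary _ (Unitary.star_mem u.2), CStarRing.norm_mem_unitary_mul _ u.2]

lemma norm_conj_sub_conj_le (u v : unitary A) (a : A) :
    ‖(u : A) * a * star (u : A) - v * a * star (v : A)‖ ≤ 2 * ‖(u - v : A)‖ * ‖a‖ := by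
  have h : (u : A) * a * star (u : A) - v * a * star (v : A) =
      (u - v) * a * star (u : A) + v * a * star (u - v : A) := by rw [star_sub]; noncomm_ring
  rw [h]
  refine (norm_add_le _ _).trans ?_
  rw [CStarRing.norm_mul_mem_unitary _ (Unitary.star_mem u.2), mul_assoc (v : A),
    CStarRing.norm_mem_unitary_mul _ v.2]
  have h1 := norm_mul_le (u - v : A) a
  have h2 := norm_mul_le a (star (u - v : A))
  rw [norm_star] at h2
  linarith

/-- An automorphism which is inner on the algebras of a tower is close to an inner one on a
compact set, and so is each unitary perturbation of it. -/
lemma MatrixTower.norm_commutator_le (T : MatrixTower A) {α : A ≃⋆ₐ[ℂ] A} {j : ℕ} {X û u : unitary A}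
    (hα : ∀ a ∈ T.alg j, α a = X * a * star (X : A)) {w : A} (hw : w ∈ unitary A) {η ε : ℝ}
    (hη : ‖w - u * α w * star (u : A)‖ ≤ η) (hu : ‖(û - u : A)‖ ≤ ε)
    (hwj : ∃ b ∈ T.alg j, ‖b - w‖ < ε) :
    ‖((û * X : unitary A) : A) * w - w * (û * X : unitary A)‖ ≤ η + 4 * ε := by
  obtain ⟨b, hb, hbw⟩ := hwj
  have hw1 : ‖w‖ ≤ 1 := by
    rcases subsingleton_or_nontrivial A with _ | _
    · rw [Subsingleton.elim w 0, norm_zero]; exact zero_le_one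
    · exact (CStarRing.norm_of_mem_unitary hw).le
  have h1 : ‖α w - X * w * star (X : A)‖ ≤ 2 * ε := by
    have h2 : α w - X * w * star (X : A) = X * (b - w) * star (X : A) - α (b - w) := by
      rw [map_sub, hα b hb]; noncomm_ring
    rw [h2]
    refine (norm_sub_le _ _).trans ?_
    rw [norm_unitary_conj, StarAlgEquiv.norm_map]; linarith
  have h2 : ‖u * α w * star (u : A) - û * α w * star (û : A)‖ ≤ 2 * ε := by
    refine (norm_conj_sub_conj_le _ _ _).trans ?_
    rw [StarAlgEquiv.norm_map, norm_sub_rev]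
    nlinarith [norm_nonneg (û - u : A), norm_nonneg w]
  set P : unitary A := û * X with hP
  have h3 : ‖û * α w * star (û : A) - P * w * star (P : A)‖ ≤ 2 * ε := by
    have : û * α w * star (û : A) - P * w * star (P : A) =
        û * (α w - X * w * star (X : A)) * star (û : A) := by
      rw [hP, Submonoid.coe_mul, star_mul]; noncomm_ring
    rw [this, norm_unitary_conj]; exact h1
  have h4 : (P : A) * w - w * P = -((w - P * w * star (P : A)) * P) := by
    have : star (P : A) * P = 1 := (Unitary.mem_iff.mp P.2).1
    rw [sub_mul, mul_assoc _ _ (P : A), this, mul_one, neg_sub]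
  rw [h4, norm_neg, CStarRing.norm_mul_mem_unitary _ P.2]
  calc ‖w - P * w * star (P : A)‖ = ‖(w - u * α w * star (u : A)) +
        (u * α w * star (u : A) - û * α w * star (û : A)) +
        (û * α w * star (û : A) - P * w * star (P : A))‖ := by congr 1; abel
    _ ≤ η + 2 * ε + 2 * ε := (norm_add₃_le).trans (by gcongr)
    _ = η + 4 * ε := by ring

/-- A multiple `x'` of a commutator of unitaries `P`, `Q` of the commutant of `A₀` is close to the
endpoint `x` of the path, with vanishing log-trace of `x' x⁻¹`. Its determinant in the commutant is
`-s j`, that of the path is `pathValue h`, and the two chains together close up. -/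
theorem MatrixTower.eventually_pathValue_add_mem (T : MatrixTower A) {α : Action A}
    {p : primeSet A} {δ : ℝ} {A₀ A₁ : StarSubalgebra ℂ A} {u₁ u₂ : A} {h : ℝ → A}
    (hc : IsChoice 1 α p δ A₀ A₁ u₁ u₂ h) {X Y : ℕ → unitary A} {s : ℕ → ℝ}
    (hX : ∀ j, ∀ a ∈ T.alg j, α.at (1, 0) a = X j * a * star (X j : A))
    (hY : ∀ j, ∀ a ∈ T.alg j, α.at (0, 1) a = Y j * a * star (Y j : A))
    (hXY : ∀ j, X j * Y j = scalarUnitary A (s j) * (Y j * X j)) :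
    ∀ᶠ j in atTop, pathValue h + s j ∈ traceK0 (StarSubalgebra.centralizer ℂ (A₀ : Set A)) := by
  obtain ⟨φ, -, hφ⟩ := hc.full.exists_hom
  have hfin : FiniteDimensional ℂ A₀ := hφ ▸ finiteDimensional_range φ
  have hδ0 := hc.const.1
  have hδ1 := hc.const.2.1
  lift u₁ to unitary A using hc.mem_unitary₁
  lift u₂ to unitary A using hc.mem_unitary₂
  set C := StarSubalgebra.centralizer ℂ (A₀ : Set A) with hC
  have hone : ∀ n a, (1 : Action A).at n a = a := fun _ _ => rfl
  -- The first action being trivial, `w` is close to some `a` for which the perturbation estimate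
  -- holds; passing from `a` back to `w` costs `δ / 7` on either side.
  have hpert : ∀ w ∈ unitaries A₀, ‖w - u₁ * α.at (1, 0) w * star (u₁ : A)‖ ≤ 3 * (δ / 7) ∧
      ‖w - u₂ * α.at (0, 1) w * star (u₂ : A)‖ ≤ 3 * (δ / 7) := by
    intro w hw
    obtain ⟨a, ha, hwa⟩ := (hc.approx w hw).1
    have hp := hc.perturb a (Or.inl (by rwa [hone]))
    rw [hone, hone] at hp
    have aux : ∀ (u : unitary A) (β : A ≃⋆ₐ[ℂ] A), ‖a - u * β a * star (u : A)‖ < δ / 7 →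
        ‖w - u * β w * star (u : A)‖ ≤ 3 * (δ / 7) := by
      intro u β hb
      calc ‖w - u * β w * star (u : A)‖ = ‖(w - a) + (a - u * β a * star (u : A)) -
            u * β (w - a) * star (u : A)‖ := by congr 1; rw [map_sub]; noncomm_ring
        _ ≤ ‖w - a‖ + ‖a - u * β a * star (u : A)‖ + ‖u * β (w - a) * star (u : A)‖ :=
          (norm_sub_le _ _).trans (by gcongr; exact norm_add_le _ _)
        _ ≤ 3 * (δ / 7) := by
          rw [norm_unitary_conj, StarAlgEquiv.norm_map]; linarith
    exact ⟨aux u₁ _ hp.1, aux u₂ _ hp.2⟩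
  -- The commutators below are bounded by `3δ/7 + 4δ/70 = 34δ/70`, just under `δ / 2`; averaging
  -- doubles this to `δ`.
  have hε : 0 < δ / 70 := by positivity
  filter_upwards [T.eventually_near_of_isCompact (isCompact_unitaries A₀) hε,
    T.exists_unitary_near u₁ hε, T.exists_unitary_near u₂ hε] with j hj ⟨v₁, hv₁, hvu₁⟩
      ⟨v₂, hv₂, hvu₂⟩
  have hP : ∀ w ∈ unitaries A₀, ‖((v₁ * X j : unitary A) : A) * w - w * (v₁ * X j : unitary A)‖ ≤
      δ / 2 := fun w hw =>
    (T.norm_commutator_le (hX j) hw.2 (hpert w hw).1 hvu₁.le (hj w hw)).trans (by linarith)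
  have hQ : ∀ w ∈ unitaries A₀, ‖((v₂ * Y j : unitary A) : A) * w - w * (v₂ * Y j : unitary A)‖ ≤
      δ / 2 := fun w hw =>
    (T.norm_commutator_le (hY j) hw.2 (hpert w hw).2 hvu₂.le (hj w hw)).trans (by linarith)
  obtain ⟨P, hPC, hPP⟩ := exists_unitary_mem_centralizer_near A₀ (v₁ * X j).2 (by linarith) hP
  obtain ⟨Q, hQC, hQQ⟩ := exists_unitary_mem_centralizer_near A₀ (v₂ * Y j).2 (by linarith) hQ
  rw [mul_div_cancel₀ _ two_ne_zero] at hPP hQQ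
  obtain ⟨r, hr⟩ := hc.const.exists_hasDet T A₀ hPC
  -- the commutator of `P` and `Q`, corrected by a scalar
  set x' : unitary A := scalarUnitary A (-s j) * (P * Q * P⁻¹ * Q⁻¹) with hx'
  have hdx : HasDet C x' (-s j) := by
    have := (hasDet_scalarUnitary T C (-s j)).mul (hr.commutator T hQC)
    rwa [add_zero] at this
  have hscal : ∀ t, ∀ z : unitary A, scalarUnitary A t * z = z * scalarUnitary A t := by
    intro t z
    ext
    rw [Submonoid.coe_mul, Submonoid.coe_mul, coe_scalarUnitary, smul_mul_assoc, mul_smul_comm,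
      one_mul, mul_one]
  have hs1 : scalarUnitary A (-s j) * scalarUnitary A (s j) = 1 := by
    rw [← scalarUnitary_add, neg_add_cancel, scalarUnitary_zero]
  set x : unitary A := twistedCommutator (α.at (1, 0)) (α.at (0, 1)) u₁ u₂ with hx
  have hxh : IsUnitaryPath h x := by
    convert hc.path using 1
    rfl
  set xt : unitary A := twistedCommutator (α.at (1, 0)) (α.at (0, 1)) v₁ v₂ with hxt
  obtain ⟨hl1, hn1⟩ := T.twistedCommutator_perturb (α.at (1, 0)) (α.at (0, 1)) (u := u₁) (u' := v₁)
    (v := u₂) (v' := v₂) (κ := δ / 70) (by linarith) hvu₁.le hvu₂.le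
  have htriv : ∀ u v : unitary A, twistedCommutator (1 : A ≃⋆ₐ[ℂ] A) 1 u v = u * v * u⁻¹ * v⁻¹ := by
    intro u v
    have : ∀ z : unitary A, unitaryMap (1 : A ≃⋆ₐ[ℂ] A) z = z := fun z => rfl
    rw [twistedCommutator, this, this]; group
  obtain ⟨hl2, hn2⟩ := T.twistedCommutator_perturb 1 1 (u := v₁ * X j) (u' := P)
    (v := v₂ * Y j) (v' := Q) (κ := δ) (by linarith) hPP hQQ
  rw [← coe_mul_inv_sub_one] at hn2 hn1
  rw [htriv, htriv] at hl2 hn2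
  -- Here it matters that `v₁`, `v₂` lie in `T.alg j`, where the action is conjugation by `X j` and
  -- `Y j`: the twisted commutator becomes an ordinary one up to the scalar by which `X j` and `Y j`
  -- fail to commute.
  have hcomm : v₁ * X j * (v₂ * Y j) * (v₁ * X j)⁻¹ * (v₂ * Y j)⁻¹ = scalarUnitary A (s j) * xt := by
    have e1 : unitaryMap (α.at (1, 0)) v₂ = X j * v₂ * (X j)⁻¹ := Subtype.ext (hX j _ hv₂)
    have e2 : unitaryMap (α.at (0, 1)) v₁ = Y j * v₁ * (Y j)⁻¹ := Subtype.ext (hY j _ hv₁)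
    have e3 : Y j * (X j)⁻¹ = (X j)⁻¹ * (scalarUnitary A (s j) * Y j) := by
      rw [eq_inv_mul_iff_mul_eq, ← mul_assoc, hXY]; group
    rw [hxt, twistedCommutator, e1, e2]
    calc v₁ * X j * (v₂ * Y j) * (v₁ * X j)⁻¹ * (v₂ * Y j)⁻¹
        = v₁ * X j * v₂ * (Y j * (X j)⁻¹) * v₁⁻¹ * (Y j)⁻¹ * v₂⁻¹ := by group
      _ = v₁ * X j * v₂ * (X j)⁻¹ * scalarUnitary A (s j) * (Y j * v₁⁻¹ * (Y j)⁻¹ * v₂⁻¹) := by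
          rw [e3]; group
      _ = _ := by rw [← hscal]; group
  rw [hcomm] at hl2 hn2
  have hxx : x' * xt⁻¹ = P * Q * P⁻¹ * Q⁻¹ * (scalarUnitary A (s j) * xt)⁻¹ := by
    have : scalarUnitary A (-s j) = (scalarUnitary A (s j))⁻¹ := eq_inv_of_mul_eq_one_left hs1
    rw [hx', hscal (-s j), this, hscal (s j) xt]; group
  rw [← hxx] at hl2 hn2
  have hxx2 : x' * x⁻¹ = (x' * xt⁻¹) * (xt * x⁻¹) := by group
  have hlog : logTrace (x' * x⁻¹) = 0 := by
    rw [hxx2, T.logTrace_mul (by linarith), hl1, hl2, add_zero]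
  -- The two perturbations cost `4δ` and `4δ/70` with `δ < 1 / 8`. Together with the distance below
  -- `1` from `k` to `x` the total stays below two.
  have hnorm : ‖((x' * x⁻¹ : unitary A) - 1 : A)‖ ≤ 3 / 4 := by
    have := norm_unitary_mul_sub_one_le (x' * xt⁻¹) (xt * x⁻¹)
    rw [← hxx2] at this
    linarith
  obtain ⟨k, hk, hkd⟩ := hxh.exists_hasDet T A₀ hc.almost_commute
  rw [← coe_mul_inv_sub_one] at hk
  have hinv : x * x'⁻¹ = (x' * x⁻¹)⁻¹ := by group
  have hkx : k * x'⁻¹ = (k * x⁻¹) * (x * x'⁻¹) := by group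
  have hnorm2 : ‖((x * x'⁻¹ : unitary A) - 1 : A)‖ ≤ 3 / 4 := by
    rw [hinv, norm_inv_sub_one]; exact hnorm
  have hlog2 : logTrace (k * x'⁻¹) = logTrace (k * x⁻¹) := by
    rw [hkx, T.logTrace_mul (by linarith), hinv, T.logTrace_inv (by linarith), hlog, neg_zero,
      add_zero]
  have hd : HasDet C (k * x'⁻¹) (logTrace (k * x⁻¹)) := by
    rw [← hlog2]
    refine HasDet.of_norm_lt (mul_mem hkd.mem (StarMemClass.star_mem hdx.mem)) ?_
    have := norm_unitary_mul_sub_one_le (k * x⁻¹) (x * x'⁻¹)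
    rw [← hkx] at this
    linarith
  -- The closed chain from `1` back along the path, across to `x'`, and along the scalar times the
  -- commutator; the two terms with `k` cancel.
  have hfinal := (hkd.inv.mul hd).mul hdx
  have hprod : k⁻¹ * (k * x'⁻¹) * x' = 1 := by group
  rw [hprod] at hfinal
  have hφC : relCommutant φ = C := by rw [relCommutant, hφ]
  have := T.mem_traceK0_of_hasDet_one φ (theta_pos p) (r := -(pathValue h + s j)) (by
    rw [hφC]; convert hfinal using 1; ring)
  rw [hφC] at this
  simpa using neg_mem this

end Invariance

/-! ### Semisimplicity of finite-dimensional subalgebras. -/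

section Semisimple

variable {A : Type u} [CStarAlgebra A]

/-- For selfadjoint `x` the C*-identity gives that the norm of `x ^ 2 ^ n` is the `2 ^ n`-th power
of the norm of `x`. -/
lemma eq_zero_of_isNilpotent {x : A} (hx : IsSelfAdjoint x) (hn : IsNilpotent x) : x = 0 := by
  obtain ⟨n, hn⟩ := hn
  have h1 : x ^ 2 ^ n = 0 := pow_eq_zero_of_le Nat.lt_two_pow_self.le hn
  have h2 := hx.nnnorm_pow_two_pow n
  rw [h1, nnnorm_zero] at h2
  exact nnnorm_eq_zero.mp (eq_zero_of_pow_eq_zero h2.symm)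

/-- The Jacobson radical is nilpotent, and with `x` it contains the selfadjoint element `x* x`,
which therefore vanishes. -/
lemma isSemisimpleRing_of_finiteDimensional (B : StarSubalgebra ℂ A) [FiniteDimensional ℂ B] :
    IsSemisimpleRing B := by
  have hB : IsClosed (B : Set A) := isClosed_of_finiteDimensional B
  have hart : IsArtinianRing B := IsArtinianRing.of_finite ℂ B
  rw [IsArtinianRing.isSemisimpleRing_iff_jacobson, eq_bot_iff]
  intro x hx
  obtain ⟨n, hn⟩ := IsArtinianRing.isNilpotent_jacobson_bot (R := B)
  rw [Ideal.jacobson_bot] at hn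
  have h1 : star x * x ∈ Ring.jacobson B := Ideal.mul_mem_left _ _ hx
  have h2 : IsNilpotent (star x * x) := ⟨n, by simpa [hn] using Ideal.pow_mem_pow h1 n⟩
  have h3 : star x * x = 0 := eq_zero_of_isNilpotent (IsSelfAdjoint.star_mul_self x) h2
  exact (CStarRing.star_mul_self_eq_zero_iff x).mp h3

end Semisimple

/-! ### The commutant of a multimatrix algebra, described by its corners. -/

section Corner

variable {A : Type u} [CStarAlgebra A] {n : ℕ} {d : Fin n → ℕ}
  (φ : (∀ i, Matrix (Fin (d i)) (Fin (d i)) ℂ) →ₐ[ℂ] A)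

/-- The images of the matrix units of a multimatrix algebra. -/
def matUnit (i : Fin n) (a b : Fin (d i)) : A := φ (Pi.single i (Matrix.single a b 1))

lemma matUnit_mul_same (i : Fin n) (a b c : Fin (d i)) :
    matUnit φ i a b * matUnit φ i b c = matUnit φ i a c := by
  rw [matUnit, matUnit, ← map_mul, ← Pi.single_mul, Matrix.single_mul_single_same, mul_one, matUnit]

lemma matUnit_mul_of_ne (i : Fin n) {a b b' c : Fin (d i)} (h : b ≠ b') :
    matUnit φ i a b * matUnit φ i b' c = 0 := by
  rw [matUnit, matUnit, ← map_mul, ← Pi.single_mul, Matrix.single_mul_single_of_ne (h := h),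
    Pi.single_zero, map_zero]

lemma matUnit_mul_of_ne' {i j : Fin n} (h : i ≠ j) {a b : Fin (d i)} {a' b' : Fin (d j)} :
    matUnit φ i a b * matUnit φ j a' b' = 0 := by
  rw [matUnit, matUnit, ← map_mul]
  have : (Pi.single i (Matrix.single a b 1) : ∀ i, Matrix (Fin (d i)) (Fin (d i)) ℂ) *
      Pi.single j (Matrix.single a' b' 1) = 0 := by
    funext k
    rw [Pi.mul_apply]
    rcases eq_or_ne k i with rfl | hk
    · rw [Pi.single_eq_of_ne h, mul_zero]; rfl
    · rw [Pi.single_eq_of_ne hk, zero_mul]; rfl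
  rw [this, map_zero]

lemma sum_matUnit : ∑ i, ∑ a, matUnit φ i a a = 1 := by
  have : (1 : ∀ i, Matrix (Fin (d i)) (Fin (d i)) ℂ) =
      ∑ i, ∑ a, Pi.single i (Matrix.single a a 1) := by
    funext k
    simp_rw [Finset.sum_apply]
    rw [Finset.sum_eq_single k]
    · simp [Matrix.sum_single_one]
    · intro j _ hj
      simp [Pi.single_eq_of_ne hj.symm]
    · simp
  rw [← map_one φ, this]
  simp [map_sum, matUnit]

lemma commute_of_matUnit {c : A}
    (h : ∀ i a b, matUnit φ i a b * c = c * matUnit φ i a b) (x) : φ x * c = c * φ x := by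
  have hx : x = ∑ i, ∑ a, ∑ b, x i a b • Pi.single i (Matrix.single a b (1 : ℂ)) := by
    funext k
    simp_rw [Finset.sum_apply]
    rw [Finset.sum_eq_single k]
    · conv_lhs => rw [Matrix.matrix_eq_sum_single (x k)]
      simp [Matrix.smul_single]
    · intro j _ hj
      simp [Pi.single_eq_of_ne hj.symm]
    · simp
  rw [hx]
  simp only [map_sum, map_smul, Finset.sum_mul, Finset.mul_sum, smul_mul_assoc, mul_smul_comm]
  refine Finset.sum_congr rfl fun i _ => Finset.sum_congr rfl fun a _ =>
    Finset.sum_congr rfl fun b _ => ?_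
  exact congrArg _ (h i a b)

variable [∀ i, NeZero (d i)]

/-- The element of the commutant with prescribed corners. -/
def cornerLift (g : Fin n → A) : A := ∑ i, ∑ a, matUnit φ i a 0 * g i * matUnit φ i 0 a

lemma continuous_cornerLift : Continuous (cornerLift φ) := by
  unfold cornerLift
  fun_prop

lemma cornerLift_const {w : A} (hw : ∀ x, φ x * w = w * φ x) : cornerLift φ (fun _ => w) = w := by
  have : ∀ i a, matUnit φ i a 0 * w * matUnit φ i 0 a = w * matUnit φ i a a := by
    intro i a
    have := hw (Pi.single i (Matrix.single a 0 1))
    rw [matUnit, this, mul_assoc]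
    exact congrArg _ (matUnit_mul_same φ i a 0 a)
  simp only [cornerLift, this]
  simp_rw [← Finset.mul_sum]
  rw [sum_matUnit, mul_one]

lemma matUnit_mul_cornerLift (g : Fin n → A) (i : Fin n) (a b : Fin (d i)) :
    matUnit φ i a b * cornerLift φ g = matUnit φ i a 0 * g i * matUnit φ i 0 b := by
  simp only [cornerLift, Finset.mul_sum]
  rw [Finset.sum_eq_single i, Finset.sum_eq_single b]
  · rw [← mul_assoc, ← mul_assoc, matUnit_mul_same]
  · intro c _ hc
    rw [← mul_assoc, ← mul_assoc, matUnit_mul_of_ne φ i hc.symm, zero_mul, zero_mul]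
  · simp
  · intro j _ hj
    refine Finset.sum_eq_zero fun c _ => ?_
    rw [← mul_assoc, ← mul_assoc, matUnit_mul_of_ne' φ hj.symm, zero_mul, zero_mul]
  · simp

lemma cornerLift_mul_matUnit (g : Fin n → A) (i : Fin n) (a b : Fin (d i)) :
    cornerLift φ g * matUnit φ i a b = matUnit φ i a 0 * g i * matUnit φ i 0 b := by
  simp only [cornerLift, Finset.sum_mul]
  rw [Finset.sum_eq_single i, Finset.sum_eq_single a]
  · rw [mul_assoc _ _ (matUnit φ i a b), matUnit_mul_same]
  · intro c _ hc
    rw [mul_assoc _ _ (matUnit φ i a b), matUnit_mul_of_ne φ i hc, mul_zero]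
  · simp
  · intro j _ hj
    refine Finset.sum_eq_zero fun c _ => ?_
    rw [mul_assoc _ _ (matUnit φ i a b), matUnit_mul_of_ne' φ hj, mul_zero]
  · simp

lemma cornerLift_commute (g : Fin n → A) (x) : φ x * cornerLift φ g = cornerLift φ g * φ x :=
  commute_of_matUnit φ (fun i a b => by rw [matUnit_mul_cornerLift, cornerLift_mul_matUnit]) x

lemma cornerLift_mul {g h : Fin n → A}
    (hg : ∀ i, g i * matUnit φ i 0 0 = matUnit φ i 0 0 * g i) :
    cornerLift φ g * cornerLift φ h = cornerLift φ fun i => g i * h i := by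
  conv_lhs => enter [1]; rw [cornerLift]
  simp only [Finset.sum_mul]
  conv_rhs => rw [cornerLift]
  refine Finset.sum_congr rfl fun i _ => Finset.sum_congr rfl fun a _ => ?_
  rw [mul_assoc, matUnit_mul_cornerLift]
  calc matUnit φ i a 0 * g i * (matUnit φ i 0 0 * h i * matUnit φ i 0 a)
      = matUnit φ i a 0 * (g i * matUnit φ i 0 0) * h i * matUnit φ i 0 a := by
        simp only [mul_assoc]
    _ = matUnit φ i a 0 * matUnit φ i 0 0 * (g i * h i) * matUnit φ i 0 a := by
        rw [hg]; simp only [mul_assoc]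
    _ = _ := by rw [matUnit_mul_same]

/-- The homomorphism `φ` need not respect the involution, so the corners are cut by idempotents and
the argument is carried out with invertible elements rather than unitaries. -/
lemma isUnit_cornerLift {g : Fin n → A} (hu : ∀ i, IsUnit (g i))
    (hg : ∀ i, g i * matUnit φ i 0 0 = matUnit φ i 0 0 * g i) : IsUnit (cornerLift φ g) := by
  choose v hv using hu
  have hv' : ∀ i, (↑(v i)⁻¹ : A) * matUnit φ i 0 0 = matUnit φ i 0 0 * ↑(v i)⁻¹ := fun i =>
    (Commute.units_inv_left (u := v i) (a := matUnit φ i 0 0) (by rw [hv]; exact hg i))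
  have h1 : cornerLift φ (fun _ => 1) = 1 := cornerLift_const φ fun x => by simp
  refine ⟨⟨cornerLift φ g, cornerLift φ fun i => ↑(v i)⁻¹, ?_, ?_⟩, rfl⟩
  · rw [cornerLift_mul φ hg]
    simp only [← hv, Units.mul_inv, h1]
  · rw [cornerLift_mul φ hv']
    simp only [← hv, Units.inv_mul, h1]

end Corner

/-! ### Connectedness of the unitary group of a commutant; an admissible constant. -/

section Connected

variable {A : Type u} [CStarAlgebra A]

open Unitary selfAdjoint Filter Topology

/-- The invertible elements commuting with `f`. -/
def unitsCommuting (f : A) : Set A := {x | IsUnit x ∧ x * f = f * x}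

lemma mem_unitsCommuting {f x : A} : x ∈ unitsCommuting f ↔ IsUnit x ∧ x * f = f * x := by
  rw [unitsCommuting, Set.mem_ofPred_eq]

lemma joinedIn_conj {f q x y : A} (v : Aˣ) (hv : v * f = q * v)
    (h : JoinedIn (unitsCommuting q) x y) :
    JoinedIn (unitsCommuting f) (↑v⁻¹ * x * v) (↑v⁻¹ * y * v) := by
  have hc : Continuous fun x : A => ↑v⁻¹ * x * v := by fun_prop
  refine (h.map hc).mono ?_
  rintro _ ⟨z, hz, rfl⟩
  rw [mem_unitsCommuting] at hz ⊢
  have hv' : f * ↑v⁻¹ = ↑v⁻¹ * q := by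
    rw [Units.mul_inv_eq_iff_eq_mul, mul_assoc, ← hv, Units.inv_mul_cancel_left]
  refine ⟨(v⁻¹.isUnit.mul hz.1).mul v.isUnit, ?_⟩
  calc ↑v⁻¹ * z * v * f = ↑v⁻¹ * (z * q) * v := by rw [mul_assoc _ _ f, hv]; simp only [mul_assoc]
    _ = (↑v⁻¹ * q) * z * v := by rw [hz.2]; simp only [mul_assoc]
    _ = f * (↑v⁻¹ * z * v) := by rw [← hv']; simp only [mul_assoc]

lemma joinedIn_one_of_emb {ι : Type*} [Fintype ι] [DecidableEq ι] {φ : Matrix ι ι ℂ →⋆ₐ[ℂ] A}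
    (hφ : Function.Injective φ) {q : A} {b : Matrix ι ι ℂ} (hb : IsUnit (φ b))
    (hbq : φ b * q = q * φ b) : JoinedIn (unitsCommuting q) 1 (φ b) := by
  have hb' : IsUnit b := by
    have hcl : IsClosed (φ.range : Set A) :=
      have := finiteDimensional_range φ
      isClosed_of_finiteDimensional _
    have h1 : IsUnit (StarAlgEquiv.ofInjective φ hφ b) :=
      (StarSubalgebra.coe_isUnit (hS := hcl)).mp hb
    have h2 := h1.map (StarAlgEquiv.ofInjective φ hφ).symm
    rwa [StarAlgEquiv.symm_apply_apply] at h2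
  -- The complex line through `1` and `b` consists of elements commuting with `q`, and it is
  -- invertible off the roots of `P`, where `P(0) = 1`. The complement of finitely many points in
  -- `ℂ` is path connected and contains `0` and `1`.
  let P : Polynomial ℂ := (1 + (Polynomial.X : Polynomial ℂ) • (b - 1).map Polynomial.C).det
  have hP : ∀ z : ℂ, P.eval z = (1 + z • (b - 1)).det := by
    intro z
    rw [← Polynomial.coe_evalRingHom, RingHom.map_det]
    congr 1
    ext i j
    by_cases h : i = j
    · simp [h]
    · simp [h]
      ring
  have hP0 : P ≠ 0 := by
    intro h
    have := hP 0
    rw [h] at this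
    simp at this
  have hc : (↑P.roots.toFinset : Set ℂ).Countable := Finset.countable_toSet _
  have hpath := hc.isPathConnected_compl_of_one_lt_rank (by
    rw [Complex.rank_real_complex]; norm_num)
  have hmem : ∀ z : ℂ, z ∈ (↑P.roots.toFinset : Set ℂ)ᶜ → IsUnit (1 + z • (b - 1)) := by
    intro z hz
    rw [Matrix.isUnit_iff_isUnit_det, ← hP, isUnit_iff_ne_zero]
    intro h0
    apply hz
    simpa [hP0] using h0
  have hj := hpath.joinedIn 0 (by simp [hP0, hP]) 1 (by
    have : IsUnit b.det := (Matrix.isUnit_iff_isUnit_det b).mp hb'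
    simp [hP0, hP, this.ne_zero])
  have hcont : Continuous fun z : ℂ => 1 + z • (φ b - 1) := by fun_prop
  have h2 := hj.map hcont
  simp only [zero_smul, add_zero, one_smul, add_sub_cancel] at h2
  refine h2.mono ?_
  rintro _ ⟨z, hz, rfl⟩
  rw [mem_unitsCommuting]
  constructor
  · have := (hmem z hz).map φ
    simpa using this
  · rw [add_mul, mul_add, smul_mul_assoc, mul_smul_comm, sub_mul, mul_sub, hbq, one_mul, mul_one]

/-- A similarity moves `f` into the tower. There an invertible element commuting with the idempotent
is approximated by one in a matrix algebra that still commutes with it, and the matrix case applies.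
-/
lemma MatrixTower.joinedIn_one (T : MatrixTower A) {f g : A} (hf : f * f = f)
    (hg : g ∈ unitsCommuting f) : JoinedIn (unitsCommuting f) 1 g := by
  rw [mem_unitsCommuting] at hg
  have hM : 0 < ‖2 * f - 1‖ + 1 := by positivity
  obtain ⟨η, hη, hnear⟩ := exists_idempotent_near hf (ε := (‖2 * f - 1‖ + 1)⁻¹) (by positivity)
  obtain ⟨k, b, hb, hbf⟩ := T.exists_mem_alg_near f hη
  obtain ⟨q, hq, hqf, hqS⟩ := hnear b hbf
  have hqk : q ∈ T.alg k := hqS _ (T.isClosed_alg k) (fun x hx => idemStep_mem hx) hb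
  have hz : IsUnit (intertwiner f q) := by
    refine isUnit_of_norm_sub_lt_one (one_mem _) ?_
    rw [intertwiner_sub_one hf]
    calc ‖(q - f) * (2 * f - 1)‖ ≤ ‖q - f‖ * ‖2 * f - 1‖ := norm_mul_le _ _
      _ ≤ (‖2 * f - 1‖ + 1)⁻¹ * ‖2 * f - 1‖ := by gcongr
      _ < (‖2 * f - 1‖ + 1)⁻¹ * (‖2 * f - 1‖ + 1) := by gcongr; linarith
      _ = 1 := inv_mul_cancel₀ hM.ne'
  obtain ⟨v, hv⟩ := hz
  have hvf : v * f = q * v := by rw [hv]; exact intertwiner_mul hf hq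
  set g' : A := v * g * ↑v⁻¹ with hg'
  have hqv : f * ↑v⁻¹ = ↑v⁻¹ * q := by
    rw [Units.mul_inv_eq_iff_eq_mul, mul_assoc, ← hvf, Units.inv_mul_cancel_left]
  have hg'u : IsUnit g' := (v.isUnit.mul hg.1).mul v⁻¹.isUnit
  have hg'q : g' * q = q * g' := by
    calc v * g * ↑v⁻¹ * q = v * (g * f) * ↑v⁻¹ := by rw [mul_assoc _ _ q, ← hqv]; simp only [mul_assoc]
      _ = (v * f) * g * ↑v⁻¹ := by rw [hg.2]; simp only [mul_assoc]
      _ = _ := by rw [hvf]; simp only [hg', mul_assoc]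
  suffices H : JoinedIn (unitsCommuting q) 1 g' by
    have := joinedIn_conj v hvf H
    simpa [hg', mul_assoc] using this
  -- approximate `g'` by block diagonal elements
  obtain ⟨ρ, hρ, hball⟩ := Metric.isOpen_iff.mp (Units.isOpen (R := A)) g' hg'u
  -- The projection onto the block diagonal elements: it fixes `g'`, is continuous, and preserves
  -- every algebra of the tower that contains `q`.
  let D : A → A := fun x => q * x * q + (1 - q) * x * (1 - q)
  have hDc : Continuous D := by fun_prop
  have hqq : q * (1 - q) = 0 := by rw [mul_sub, mul_one, hq, sub_self]
  have hqq' : (1 - q) * q = 0 := by rw [sub_mul, one_mul, hq, sub_self]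
  have hDq : ∀ x, D x * q = q * D x := by
    intro x
    simp only [D, add_mul, mul_add, mul_assoc, hq, hqq', mul_zero, add_zero]
    simp only [← mul_assoc, hq, hqq, zero_mul, add_zero]
  have hDg : D g' = g' := by
    have e1 : q * g' * q = q * g' := by rw [mul_assoc, hg'q, ← mul_assoc, hq]
    simp only [D, e1]
    simp only [sub_mul, mul_sub, one_mul, mul_one, e1, hg'q]
    abel
  obtain ⟨σ, hσ, hσball⟩ := Metric.continuous_iff.mp hDc g' ρ hρ
  obtain ⟨m₀, b₀, hb₀, hbg⟩ := T.exists_mem_alg_near g' hσ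
  set m := max k m₀
  have hbm : D b₀ ∈ T.alg m := by
    have h1 : q ∈ T.alg m := T.alg_mono (le_max_left _ _) hqk
    have h2 : b₀ ∈ T.alg m := T.alg_mono (le_max_right _ _) hb₀
    have h3 : 1 - q ∈ T.alg m := sub_mem (one_mem _) h1
    exact add_mem (mul_mem (mul_mem h1 h2) h1) (mul_mem (mul_mem h3 h2) h3)
  have hDb : D b₀ ∈ Metric.ball g' ρ := by
    have := hσball b₀ (by rwa [dist_eq_norm])
    rwa [hDg] at this
  obtain ⟨y, hy⟩ := hbm
  have hy : T.emb m y = D b₀ := hy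
  have j1 : JoinedIn (unitsCommuting q) 1 (D b₀) := by
    rw [← hy]
    exact joinedIn_one_of_emb (T.injective m) (by rw [hy]; exact hball hDb) (by rw [hy]; exact hDq _)
  refine j1.trans ?_
  have hseg : segment ℝ (D b₀) g' ⊆ unitsCommuting q := by
    intro x hx
    rw [mem_unitsCommuting]
    refine ⟨hball ((convex_ball g' ρ).segment_subset hDb (Metric.mem_ball_self hρ) hx), ?_⟩
    obtain ⟨s, t, -, -, -, rfl⟩ := hx
    simp only [add_mul, mul_add, smul_mul_assoc, mul_smul_comm, hDq, hg'q]
  exact (JoinedIn.of_segment_subset hseg)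

/-- The subgroup generated by the unitaries of `C` at distance less than two from `1`. -/
def nearSubgroup (C : StarSubalgebra ℂ A) : Subgroup (unitary A) :=
  Subgroup.closure {u | (u : A) ∈ C ∧ ‖(u - 1 : A)‖ < 2}

lemma mem_nearSubgroup {C : StarSubalgebra ℂ A} {u : unitary A} (hC : (u : A) ∈ C)
    (hu : ‖(u - 1 : A)‖ < 2) : u ∈ nearSubgroup C :=
  Subgroup.subset_closure (by rw [Set.mem_ofPred_eq]; exact ⟨hC, hu⟩)

lemma mem_nearSubgroup_of_joinedIn {C : StarSubalgebra ℂ A} {w : unitary A}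
    (h : JoinedIn (unitaries C) 1 (w : A)) : w ∈ nearSubgroup C := by
  have hγ := h.somePath_mem
  let k : unitInterval → unitary A := fun t => ⟨h.somePath t, (hγ t).2⟩
  have hk : Continuous k := h.somePath.continuous.subtype_mk _
  have hsym : Std.Symm fun s t => k t * (k s)⁻¹ ∈ nearSubgroup C := ⟨fun s t hst => by
    have := inv_mem hst
    rwa [mul_inv_rev, inv_inv] at this⟩
  have key := PreconnectedSpace.induction₂ (fun s t => k t * (k s)⁻¹ ∈ nearSubgroup C)
    (fun s => ?_) ⟨fun r s t hrs hst => ?_⟩ 0 1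
  · have h0 : k 0 = 1 := Subtype.ext h.somePath.source
    have h1 : k 1 = w := Subtype.ext h.somePath.target
    rwa [h0, h1, inv_one, mul_one] at key
  · filter_upwards [hk.continuousAt.preimage_mem_nhds (Metric.ball_mem_nhds (k s) two_pos)]
      with t ht
    refine mem_nearSubgroup (mul_mem (hγ t).1 (StarMemClass.star_mem (hγ s).1)) ?_
    rw [coe_mul_inv_sub_one, ← dist_eq_norm]
    exact ht
  · have := mul_mem hst hrs
    rwa [mul_assoc, inv_mul_cancel_left] at this

/-- By Wedderburn's theorem `B` is a multimatrix algebra. For each block, `w` is joined to `1`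
through invertibles commuting with one minimal idempotent of the block; the corner lift turns these
paths into one path of invertibles in the commutant, and polar parts make it unitary. -/
theorem MatrixTower.mem_nearSubgroup_centralizer (T : MatrixTower A) (B : StarSubalgebra ℂ A)
    [FiniteDimensional ℂ B] {w : unitary A}
    (hw : (w : A) ∈ StarSubalgebra.centralizer ℂ (B : Set A)) :
    w ∈ nearSubgroup (StarSubalgebra.centralizer ℂ (B : Set A)) := by
  have := isSemisimpleRing_of_finiteDimensional B
  obtain ⟨n, d, hd, ⟨e⟩⟩ := IsSemisimpleRing.exists_algEquiv_pi_matrix_of_isAlgClosed ℂ B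
  let φ : (∀ i, Matrix (Fin (d i)) (Fin (d i)) ℂ) →ₐ[ℂ] A :=
    B.subtype.toAlgHom.comp (e.symm : _ →ₐ[ℂ] B)
  have hφB : ∀ x, φ x ∈ B := fun x => (e.symm x).2
  have hBφ : ∀ b ∈ B, ∃ x, φ x = b := fun b hb => ⟨e ⟨b, hb⟩, by simp [φ]⟩
  have hCφ : ∀ c, (∀ x, φ x * c = c * φ x) → c ∈ StarSubalgebra.centralizer ℂ (B : Set A) := by
    intro c hc
    have : ∀ b ∈ B, b * c = c * b := by
      rintro b hb
      obtain ⟨x, rfl⟩ := hBφ b hb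
      exact hc x
    rw [StarSubalgebra.mem_centralizer_iff]
    exact fun b hb => ⟨this b hb, this _ (StarMemClass.star_mem hb)⟩
  have hwφ : ∀ x, φ x * w = w * φ x := fun x =>
    ((StarSubalgebra.mem_centralizer_iff ℂ).mp hw _ (hφB x)).1
  have hwu : IsUnit (w : A) := ⟨Unitary.toUnits w, rfl⟩
  have j1 : ∀ i, JoinedIn (unitsCommuting (matUnit φ i 0 0)) 1 (w : A) := fun i =>
    T.joinedIn_one (matUnit_mul_same φ i 0 0 0)
      (mem_unitsCommuting.mpr ⟨hwu, (hwφ _).symm⟩)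
  set C := StarSubalgebra.centralizer ℂ (B : Set A)
  have j2 := (JoinedIn.pi j1).map (continuous_cornerLift φ)
  rw [cornerLift_const φ hwφ, cornerLift_const φ fun x => by simp] at j2
  have j3 : JoinedIn {x | IsUnit x ∧ x ∈ C} 1 (w : A) := by
    refine j2.mono ?_
    rintro _ ⟨g, hg, rfl⟩
    rw [Set.mem_univ_pi] at hg
    simp only [mem_unitsCommuting] at hg
    rw [Set.mem_ofPred_eq]
    exact ⟨isUnit_cornerLift φ (fun i => (hg i).1) fun i => (hg i).2,
      hCφ _ (cornerLift_commute φ g)⟩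
  have j4 := j3.map_continuousOn (continuousOn_polarPart.mono fun x hx => by
    rw [Set.mem_ofPred_eq] at *; exact hx.1)
  have hpol : ∀ u ∈ unitary A, polarPart u = u := by
    intro u hu
    have := norm_polarPart_sub_le hu (g := u) (η := 0) one_pos (by simp)
    rw [mul_zero] at this
    exact sub_eq_zero.mp (norm_le_zero_iff.mp this)
  rw [hpol _ (one_mem _), hpol _ w.2] at j4
  refine mem_nearSubgroup_of_joinedIn (j4.mono ?_)
  rintro _ ⟨x, hx, rfl⟩
  rw [Set.mem_ofPred_eq] at hx
  exact ⟨polarPart_mem (isClosed_centralizer _) hx.2, polarPart_mem_unitary hx.1⟩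

lemma contDiff_expUnitary_smul (a : selfAdjoint A) :
    ContDiff ℝ ∞ fun t : ℝ => (expUnitary (t • a) : A) := by
  have h : (fun t : ℝ => (expUnitary (t • a) : A)) =
      fun t : ℝ => NormedSpace.exp (t • (Complex.I • (a : A))) := by
    funext t
    rw [expUnitary_coe, selfAdjoint.val_smul, smul_comm]
  have hexp : ContDiff ℝ ∞ (NormedSpace.exp : A → A) :=
    contDiff_iff_contDiffAt.mpr fun x => (NormedSpace.exp_analytic (𝕂 := ℝ) x).contDiffAt
  rw [h]
  exact hexp.comp (contDiff_id.smul contDiff_const)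

/-- A smooth path of unitaries in a `*`-subalgebra. -/
lemma exists_smooth_path {C : StarSubalgebra ℂ A} (hC : IsClosed (C : Set A)) {w : unitary A}
    (hw : w ∈ nearSubgroup C) : ∃ h : ℝ → A, ContDiff ℝ ∞ h ∧ (∀ t, h t ∈ unitary A) ∧ h 0 = 1 ∧
      h 1 = w ∧ ∀ t, h t ∈ C := by
  induction hw using Subgroup.closure_induction with
  | mem u hu =>
    rw [Set.mem_ofPred_eq] at hu
    refine ⟨fun t => expUnitary (t • argSelfAdjoint u), ?_, fun t => SetLike.coe_mem _, ?_, ?_, ?_⟩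
    · exact contDiff_expUnitary_smul _
    · simp
    · simp [expUnitary_argSelfAdjoint hu.2]
    · intro t
      exact expUnitary_mem hC (by
        rw [selfAdjoint.val_smul, ← Complex.coe_smul]
        exact C.smul_mem (argSelfAdjoint_mem hC hu.1) _)
  | one => exact ⟨fun _ => 1, contDiff_const, fun _ => one_mem _, rfl, rfl, fun _ => one_mem _⟩
  | mul u v _ _ hu hv =>
    obtain ⟨h, h1, h2, h3, h4, h5⟩ := hu
    obtain ⟨k, k1, k2, k3, k4, k5⟩ := hv
    exact ⟨fun t => h t * k t, h1.mul k1, fun t => mul_mem (h2 t) (k2 t), by simp [h3, k3],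
      by simp [h4, k4], fun t => mul_mem (h5 t) (k5 t)⟩
  | inv u _ hu =>
    obtain ⟨h, h1, h2, h3, h4, h5⟩ := hu
    refine ⟨fun t => star (h t), ?_, fun t => Unitary.star_mem (h2 t), by simp [h3],
      congrArg star h4, fun t => StarMemClass.star_mem (h5 t)⟩
    exact (starL' ℝ : A ≃L[ℝ] A).contDiff.comp h1

lemma isUnitaryPath_of_contDiff {h : ℝ → A} {w : A} (hs : ContDiff ℝ ∞ h)
    (hu : ∀ t, h t ∈ unitary A) (h0 : h 0 = 1) (h1 : h 1 = w) : IsUnitaryPath h w where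
  mem_unitary t _ := hu t
  source := h0
  target := h1
  continuousOn := hs.continuous.continuousOn
  piecewise := ⟨1, fun i => i, Nat.mono_cast, by simp, by simp, fun _ _ => hs.contDiffOn⟩

/-- Averaging gives `v` in the commutant within `1 / 32` of `w`. An exactly commuting path to `v`,
multiplied by `exp (t log (w v⁻¹))`, commutes up to twice `1 / 32`, which is below `1 / 8`. -/
theorem MatrixTower.isAdmissibleConst (T : MatrixTower A) : IsAdmissibleConst A (1 / 64) := by
  refine ⟨by norm_num, by norm_num, fun B hB w hw hcomm => ?_⟩
  obtain ⟨v, hvC, hvw⟩ := exists_unitary_mem_centralizer_near B hw (η := 1 / 64) (by norm_num)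
    fun u hu => (hcomm u hu).le
  lift w to unitary A using hw
  obtain ⟨h, h1, h2, h3, h4, h5⟩ := exists_smooth_path (isClosed_centralizer _)
    (T.mem_nearSubgroup_centralizer B hvC)
  have hnear : ‖((w * v⁻¹ : unitary A) - 1 : A)‖ ≤ 1 / 32 := by
    rw [coe_mul_inv_sub_one, norm_sub_rev]; linarith
  set a := argSelfAdjoint (w * v⁻¹ : unitary A)
  refine ⟨fun t => expUnitary (t • a) * h t, isUnitaryPath_of_contDiff
    ((contDiff_expUnitary_smul a).mul h1) (fun t => mul_mem (SetLike.coe_mem _) (h2 t))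
    (by simp [h3]) ?_, fun t ht b hb => ?_⟩
  · rw [one_smul, expUnitary_argSelfAdjoint (by linarith), h4, ← Submonoid.coe_mul,
      inv_mul_cancel_right]
  · have hx := norm_expUnitary_smul_argSelfAdjoint_sub_one_le (w * v⁻¹) ht (by linarith)
    have hhb : h t * b = b * h t :=
      (((StarSubalgebra.mem_centralizer_iff ℂ).mp (h5 t) b hb.1).1).symm
    set x : A := ((expUnitary (t • a) : unitary A) : A)
    have e : x * h t * b - b * (x * h t) = ((x - 1) * b - b * (x - 1)) * h t := by
      rw [mul_assoc, hhb]; noncomm_ring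
    rw [e, CStarRing.norm_mul_mem_unitary _ (h2 t)]
    refine (norm_sub_le _ _).trans_lt ?_
    rw [CStarRing.norm_mul_mem_unitary _ hb.2, CStarRing.norm_mem_unitary_mul _ hb.2]
    linarith

end Connected

/-! ### Unital inclusions of full matrix algebras as amplifications. -/

section Amplification

open Matrix
open scoped Kronecker

variable {ι κ : Type*} [Fintype ι] [DecidableEq ι] [Fintype κ] [DecidableEq κ]

/-- Relabelling the indices of matrices. -/
def reindexHom (e : ι ≃ κ) : Matrix ι ι ℂ ≃⋆ₐ[ℂ] Matrix κ κ ℂ :=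
  StarAlgEquiv.ofAlgEquiv (Matrix.reindexAlgEquiv ℂ ℂ e) fun x => by
    simp [Matrix.star_eq_conjTranspose, Matrix.conjTranspose_submatrix]

lemma reindexHom_apply (e : ι ≃ κ) (x : Matrix ι ι ℂ) :
    reindexHom e x = Matrix.reindex e e x := rfl

/-- The amplification `x ↦ x ⊗ 1`. -/
def kronLeft (κ : Type*) [Fintype κ] [DecidableEq κ] :
    Matrix ι ι ℂ →⋆ₐ[ℂ] Matrix (ι × κ) (ι × κ) ℂ where
  toFun x := x ⊗ₖ (1 : Matrix κ κ ℂ)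
  map_one' := Matrix.one_kronecker_one
  map_mul' x y := by rw [← Matrix.mul_kronecker_mul, one_mul]
  map_zero' := Matrix.zero_kronecker _
  map_add' x y := Matrix.add_kronecker _ _ _
  commutes' c := by
    rw [Algebra.algebraMap_eq_smul_one, Matrix.smul_kronecker, Matrix.one_kronecker_one,
      ← Algebra.algebraMap_eq_smul_one]
  map_star' x := by
    rw [Matrix.star_eq_conjTranspose, Matrix.star_eq_conjTranspose,
      Matrix.conjTranspose_kronecker, Matrix.conjTranspose_one]

/-- The amplification `y ↦ 1 ⊗ y`. -/
def kronRight (ι : Type*) [Fintype ι] [DecidableEq ι] :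
    Matrix κ κ ℂ →⋆ₐ[ℂ] Matrix (ι × κ) (ι × κ) ℂ where
  toFun y := (1 : Matrix ι ι ℂ) ⊗ₖ y
  map_one' := Matrix.one_kronecker_one
  map_mul' x y := by rw [← Matrix.mul_kronecker_mul, one_mul]
  map_zero' := Matrix.kronecker_zero _
  map_add' x y := Matrix.kronecker_add _ _ _
  commutes' c := by
    rw [Algebra.algebraMap_eq_smul_one, Matrix.kronecker_smul, Matrix.one_kronecker_one,
      ← Algebra.algebraMap_eq_smul_one]
  map_star' x := by
    rw [Matrix.star_eq_conjTranspose, Matrix.star_eq_conjTranspose,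
      Matrix.conjTranspose_kronecker, Matrix.conjTranspose_one]

lemma kronLeft_apply (x : Matrix ι ι ℂ) : kronLeft κ x = x ⊗ₖ (1 : Matrix κ κ ℂ) := rfl

lemma kronRight_apply (y : Matrix κ κ ℂ) : kronRight ι y = (1 : Matrix ι ι ℂ) ⊗ₖ y := rfl

lemma kronLeft_mul_kronRight (x : Matrix ι ι ℂ) (y : Matrix κ κ ℂ) :
    kronLeft κ x * kronRight ι y = x ⊗ₖ y := by
  rw [kronLeft_apply, kronRight_apply, ← Matrix.mul_kronecker_mul, mul_one, one_mul]

lemma kronRight_mul_kronLeft (x : Matrix ι ι ℂ) (y : Matrix κ κ ℂ) :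
    kronRight ι y * kronLeft κ x = x ⊗ₖ y := by
  rw [kronLeft_apply, kronRight_apply, ← Matrix.mul_kronecker_mul, mul_one, one_mul]

lemma kronRight_injective [Nonempty ι] : Function.Injective (kronRight ι : Matrix κ κ ℂ →⋆ₐ[ℂ] _) := by
  intro x y hxy
  obtain ⟨i⟩ := ‹Nonempty ι›
  ext a b
  have := congrFun (congrFun hxy (i, a)) (i, b)
  simpa [kronRight_apply, Matrix.kronecker_apply] using this

lemma kronLeft_injective [Nonempty κ] : Function.Injective (kronLeft κ : Matrix ι ι ℂ →⋆ₐ[ℂ] _) := by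
  intro x y hxy
  obtain ⟨i⟩ := ‹Nonempty κ›
  ext a b
  have := congrFun (congrFun hxy (a, i)) (b, i)
  simpa [kronLeft_apply, Matrix.kronecker_apply] using this

lemma exists_isometry_of_isStarProjection {e : Matrix ι ι ℂ} (he : IsStarProjection e) :
    ∃ (r : ℕ) (V : Matrix ι (Fin r) ℂ), Vᴴ * V = 1 ∧ V * Vᴴ = e := by
  have hh : e.IsHermitian := he.isSelfAdjoint
  set U : Matrix ι ι ℂ := (hh.eigenvectorUnitary : Matrix.unitaryGroup ι ℂ).1
  have hUU : U * Uᴴ = 1 := (Unitary.mem_iff.mp hh.eigenvectorUnitary.2).2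
  have hUU' : Uᴴ * U = 1 := (Unitary.mem_iff.mp hh.eigenvectorUnitary.2).1
  set D : ι → ℂ := fun i => (hh.eigenvalues i : ℂ)
  have hspec : e = U * Matrix.diagonal D * Uᴴ := by
    have := hh.spectral_theorem
    rwa [Unitary.conjStarAlgAut_apply] at this
  have hD : ∀ i, D i * D i = D i := by
    have h1 : Matrix.diagonal D = Uᴴ * e * U := by
      rw [hspec]
      calc Matrix.diagonal D = (Uᴴ * U) * Matrix.diagonal D * (Uᴴ * U) := by
            rw [hUU', one_mul, mul_one]
        _ = _ := by simp only [Matrix.mul_assoc]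
    have h2 : Matrix.diagonal D * Matrix.diagonal D = Matrix.diagonal D := by
      rw [h1]
      calc Uᴴ * e * U * (Uᴴ * e * U) = Uᴴ * e * (U * Uᴴ) * e * U := by
            simp only [Matrix.mul_assoc]
        _ = Uᴴ * (e * e) * U := by rw [hUU, mul_one]; simp only [Matrix.mul_assoc]
        _ = _ := by rw [he.isIdempotentElem.eq]
    intro i
    rw [Matrix.diagonal_mul_diagonal] at h2
    exact congrFun (Matrix.diagonal_injective h2) i
  let f := (Fintype.equivFin {i // D i = 1}).symm
  refine ⟨_, U.submatrix id fun k => (f k : ι), ?_, ?_⟩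
  · ext a b
    have := congrFun (congrFun hUU' (f a)) (f b)
    rw [Matrix.mul_apply] at this ⊢
    simp only [Matrix.conjTranspose_apply, Matrix.submatrix_apply, id] at this ⊢
    rw [this, Matrix.one_apply, Matrix.one_apply]
    simp [Subtype.ext_iff.symm]
  · ext i j
    rw [hspec, Matrix.mul_apply, Matrix.mul_apply]
    simp only [Matrix.conjTranspose_apply, Matrix.submatrix_apply, id, Matrix.mul_diagonal]
    rw [f.sum_comp (fun k : {i // D i = 1} => U i k * star (U j k)),
      ← Finset.sum_subtype (Finset.univ.filter fun k => D k = 1) (by simp)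
        (fun k => U i k * star (U j k)), Finset.sum_filter]
    refine Finset.sum_congr rfl fun k _ => ?_
    rcases eq_or_ne (D k) 1 with h | h
    · rw [if_pos h, h, mul_one]
    · have : D k = 0 := by
        have := hD k
        have h2 : D k * (D k - 1) = 0 := by rw [mul_sub, this]; ring
        exact (mul_eq_zero.mp h2).resolve_right (sub_ne_zero.mpr h)
      rw [if_neg h, this, mul_zero, zero_mul]

/-- Unital homomorphisms between full matrix algebras are amplifications. -/
lemma exists_intertwining_unitary {m m' : ℕ} (hm : 0 < m)
    (φ : Matrix (Fin m) (Fin m) ℂ →⋆ₐ[ℂ] Matrix (Fin m') (Fin m') ℂ) :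
    ∃ (r : ℕ) (U : Matrix (Fin m') (Fin m × Fin r) ℂ), Uᴴ * U = 1 ∧ U * Uᴴ = 1 ∧
      ∀ x, φ x * U = U * (x ⊗ₖ (1 : Matrix (Fin r) (Fin r) ℂ)) := by
  let o : Fin m := ⟨0, hm⟩
  obtain ⟨r, V, hV, hV'⟩ := exists_isometry_of_isStarProjection (e := φ (Matrix.single o o 1))
    ⟨by rw [IsIdempotentElem, ← map_mul]; simp, by
      rw [IsSelfAdjoint, ← map_star]; simp [Matrix.star_eq_conjTranspose]⟩
  -- The range of `φ(e_oo)` is the multiplicity space. The matrix units carry it isometrically onto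
  -- mutually orthogonal copies, which fill the whole space because `φ` is unital.
  let G : Fin m → Matrix (Fin m') (Fin r) ℂ := fun a => φ (Matrix.single a o 1) * V
  have hadj : ∀ a, (φ (Matrix.single a o 1))ᴴ = φ (Matrix.single o a 1) := by
    intro a
    rw [← Matrix.star_eq_conjTranspose, ← map_star]
    simp [Matrix.star_eq_conjTranspose]
  have hGG : ∀ a c, (G a)ᴴ * G c = if a = c then 1 else 0 := by
    intro a c
    have : (G a)ᴴ * G c = Vᴴ * φ (Matrix.single o a 1 * Matrix.single c o 1) * V := by
      simp only [G, Matrix.conjTranspose_mul, hadj, map_mul, Matrix.mul_assoc]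
    rw [this]
    split_ifs with h
    · rw [h, Matrix.single_mul_single_same, mul_one, ← hV']
      calc Vᴴ * (V * Vᴴ) * V = (Vᴴ * V) * (Vᴴ * V) := by simp only [Matrix.mul_assoc]
        _ = 1 := by rw [hV, mul_one]
    · rw [Matrix.single_mul_single_of_ne (h := h), map_zero, Matrix.mul_zero, Matrix.zero_mul]
  have hGG' : ∑ a, G a * (G a)ᴴ = 1 := by
    have : ∀ a, G a * (G a)ᴴ = φ (Matrix.single a a 1) := by
      intro a
      calc G a * (G a)ᴴ = φ (Matrix.single a o 1) * (V * Vᴴ) * φ (Matrix.single o a 1) := by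
            simp only [G, Matrix.conjTranspose_mul, hadj, Matrix.mul_assoc]
        _ = _ := by rw [hV', ← map_mul, ← map_mul]; simp
    simp only [this]
    rw [← map_sum, Matrix.sum_single_one, map_one]
  refine ⟨r, Matrix.of fun i ab => G ab.1 i ab.2, ?_, ?_, fun x => ?_⟩
  · ext ⟨a, b⟩ ⟨c, d⟩
    have := congrFun (congrFun (hGG a c) b) d
    rw [Matrix.mul_apply] at this ⊢
    simp only [Matrix.conjTranspose_apply, Matrix.of_apply] at this ⊢
    rw [this]
    by_cases h : a = c <;> simp [h, Matrix.one_apply, Prod.ext_iff]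
  · ext i j
    have := congrFun (congrFun hGG' i) j
    rw [Matrix.sum_apply] at this
    rw [← this, Matrix.mul_apply, Fintype.sum_prod_type]
    simp only [Matrix.mul_apply, Matrix.conjTranspose_apply, Matrix.of_apply]
  · have hG : ∀ c, φ x * G c = ∑ a, x a c • G a := by
      intro c
      have : x * Matrix.single c o 1 = ∑ a, x a c • Matrix.single a o 1 := by
        ext i j
        rw [Matrix.sum_apply]
        by_cases hj : o = j
        · subst hj
          simp [Matrix.single_apply, Matrix.smul_apply]
        · simp [hj, Matrix.smul_apply, Matrix.mul_apply]
      simp only [G]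
      rw [← Matrix.mul_assoc, ← map_mul, this, map_sum, Matrix.sum_mul]
      simp only [map_smul, Matrix.smul_mul]
    ext i ⟨c, d⟩
    have := congrFun (congrFun (hG c) i) d
    rw [Matrix.mul_apply] at this ⊢
    simp only [Matrix.of_apply]
    rw [this, Matrix.mul_apply, Fintype.sum_prod_type, Matrix.sum_apply]
    refine Finset.sum_congr rfl fun a _ => ?_
    rw [Finset.sum_eq_single d]
    · simp [mul_comm]
    · intro b _ hb
      simp [hb]
    · simp

variable {A : Type u} [CStarAlgebra A]

theorem exists_amplification {m m' : ℕ} (hm : 0 < m)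
    {φ : Matrix (Fin m) (Fin m) ℂ →⋆ₐ[ℂ] A} {ψ : Matrix (Fin m') (Fin m') ℂ →⋆ₐ[ℂ] A}
    (hψ : Function.Injective ψ) (h : φ.range ≤ ψ.range) :
    ∃ (r : ℕ) (Φ : Matrix (Fin m × Fin r) (Fin m × Fin r) ℂ →⋆ₐ[ℂ] A), m * r = m' ∧
      Function.Injective Φ ∧ Φ.range = ψ.range ∧ ∀ x, Φ (kronLeft (Fin r) x) = φ x := by
  let φ' : Matrix (Fin m) (Fin m) ℂ →⋆ₐ[ℂ] Matrix (Fin m') (Fin m') ℂ :=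
    ((StarAlgEquiv.ofInjective ψ hψ).symm : ψ.range →⋆ₐ[ℂ] Matrix (Fin m') (Fin m') ℂ).comp
      ((StarSubalgebra.inclusion h).comp φ.rangeRestrict)
  have hφ' : ∀ x, ψ (φ' x) = φ x := by
    intro x
    have := (StarAlgEquiv.ofInjective ψ hψ).apply_symm_apply
      (StarSubalgebra.inclusion h (φ.rangeRestrict x))
    exact congrArg Subtype.val this
  obtain ⟨r, U, hU, hU', hint⟩ := exists_intertwining_unitary hm φ'
  let Θ : Matrix (Fin m × Fin r) (Fin m × Fin r) ℂ →⋆ₐ[ℂ] Matrix (Fin m') (Fin m') ℂ :=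
    { toFun := fun z => U * z * Uᴴ
      map_one' := by rw [Matrix.mul_one, hU']
      map_mul' := fun x y => by
        have : U * x * Uᴴ * (U * y * Uᴴ) = U * x * (Uᴴ * U) * y * Uᴴ := by
          simp only [Matrix.mul_assoc]
        rw [this, hU, Matrix.mul_one]
        simp only [Matrix.mul_assoc]
      map_zero' := by rw [Matrix.mul_zero, Matrix.zero_mul]
      map_add' := fun x y => by rw [Matrix.mul_add, Matrix.add_mul]
      commutes' := fun c => by
        rw [Algebra.algebraMap_eq_smul_one, Matrix.mul_smul, Matrix.smul_mul, Matrix.mul_one, hU',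
          ← Algebra.algebraMap_eq_smul_one]
      map_star' := fun x => by
        simp only [Matrix.star_eq_conjTranspose, Matrix.conjTranspose_mul,
          Matrix.conjTranspose_conjTranspose, Matrix.mul_assoc] }
  have hΘ : ∀ z, Θ z = U * z * Uᴴ := fun _ => rfl
  have hinv : ∀ z, Uᴴ * Θ z * U = z := by
    intro z
    rw [hΘ]
    calc Uᴴ * (U * z * Uᴴ) * U = (Uᴴ * U) * z * (Uᴴ * U) := by simp only [Matrix.mul_assoc]
      _ = z := by rw [hU, Matrix.one_mul, Matrix.mul_one]
  refine ⟨r, ψ.comp Θ, ?_, hψ.comp (Function.LeftInverse.injective (g := fun z => Uᴴ * z * U) hinv), ?_, fun x => ?_⟩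
  · have h1 := congrArg Matrix.trace hU
    rw [Matrix.trace_mul_comm, hU', Matrix.trace_one, Matrix.trace_one] at h1
    simp only [Fintype.card_prod, Fintype.card_fin] at h1
    exact_mod_cast h1.symm
  · ext a
    constructor
    · rintro ⟨z, rfl⟩; exact ⟨Θ z, rfl⟩
    · rintro ⟨y, rfl⟩
      refine ⟨Uᴴ * y * U, ?_⟩
      change ψ (U * (Uᴴ * y * U) * Uᴴ) = ψ y
      congr 1
      calc U * (Uᴴ * y * U) * Uᴴ = (U * Uᴴ) * y * (U * Uᴴ) := by simp only [Matrix.mul_assoc]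
        _ = y := by rw [hU', Matrix.one_mul, Matrix.mul_one]
  · change ψ (U * (x ⊗ₖ (1 : Matrix (Fin r) (Fin r) ℂ)) * Uᴴ) = φ x
    rw [← hint, Matrix.mul_assoc, hU', Matrix.mul_one, hφ']

end Amplification

/-! ### Refinement of a tower so that sizes grow fast and each prime of `P(A)` enters with its full
power. -/

section Refine

open Matrix
open scoped Kronecker

variable {A : Type u} [CStarAlgebra A]

/-- Once the inclusion has the form `x ↦ x ⊗ 1`, the new factor is the image of `1 ⊗ y`, and
elementary tensors span. -/
theorem MatrixTower.exists_factor (T : MatrixTower A) (j : ℕ) :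
    ∃ (d : ℕ) (κ : Matrix (Fin d) (Fin d) ℂ →⋆ₐ[ℂ] A), T.size j * d = T.size (j + 1) ∧
      Function.Injective κ ∧ κ.range ≤ T.alg (j + 1) ∧ (∀ y, ∀ a ∈ T.alg j, κ y * a = a * κ y) ∧
      T.alg (j + 1) ≤ T.alg j ⊔ κ.range := by
  obtain ⟨d, Φ, hd, hΦ, hr, hx⟩ := exists_amplification (T.size_pos j) (T.injective (j + 1))
    (T.mono (Nat.le_succ j))
  have : Nonempty (Fin (T.size j)) := ⟨⟨0, T.size_pos j⟩⟩
  refine ⟨d, Φ.comp (kronRight _), hd, hΦ.comp kronRight_injective, ?_, ?_, ?_⟩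
  · rw [MatrixTower.alg, ← hr]
    rintro _ ⟨y, rfl⟩
    exact ⟨_, rfl⟩
  · rintro y _ ⟨x, rfl⟩
    change Φ (kronRight _ y) * T.emb j x = T.emb j x * Φ (kronRight _ y)
    rw [← hx, ← map_mul, ← map_mul, kronLeft_mul_kronRight, kronRight_mul_kronLeft]
  · rw [MatrixTower.alg, ← hr]
    rintro _ ⟨z, rfl⟩
    have hz : z = ∑ p : Fin (T.size j) × Fin d, ∑ q : Fin (T.size j) × Fin d,
        z p q • (Matrix.single p.1 q.1 (1 : ℂ) ⊗ₖ Matrix.single p.2 q.2 (1 : ℂ)) := by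
      conv_lhs => rw [Matrix.matrix_eq_sum_single z]
      refine Finset.sum_congr rfl fun p _ => Finset.sum_congr rfl fun q _ => ?_
      rw [Matrix.single_kronecker_single, Matrix.smul_single]
      simp
    change Φ z ∈ _
    rw [hz]
    simp only [map_sum, map_smul]
    refine sum_mem fun p _ => sum_mem fun q _ => SMulMemClass.smul_mem _ ?_
    rw [← kronLeft_mul_kronRight, map_mul, hx]
    exact mul_mem ((le_sup_left : T.alg j ≤ _) (T.emb_mem j _))
      ((le_sup_right : _ ≤ T.alg j ⊔ (Φ.comp (kronRight _)).range) ⟨_, rfl⟩)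

/-- Between two full matrix algebras there are full matrix algebras of all possible sizes. -/
theorem exists_interpolation {m m' t : ℕ} (hm : 0 < m) (hm' : 0 < m')
    {φ : Matrix (Fin m) (Fin m) ℂ →⋆ₐ[ℂ] A} {ψ : Matrix (Fin m') (Fin m') ℂ →⋆ₐ[ℂ] A}
    (hψ : Function.Injective ψ) (h : φ.range ≤ ψ.range) (hmt : m ∣ t) (htm : t ∣ m') :
    ∃ χ : Matrix (Fin t) (Fin t) ℂ →⋆ₐ[ℂ] A, Function.Injective χ ∧ φ.range ≤ χ.range ∧
      χ.range ≤ ψ.range := by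
  obtain ⟨r, Φ, hr, hΦ, hrange, hx⟩ := exists_amplification hm hψ h
  obtain ⟨s, rfl⟩ := hmt
  obtain ⟨q, hq⟩ := htm
  obtain rfl : r = s * q := by
    have : m * r = m * (s * q) := by rw [hr, hq, mul_assoc]
    exact Nat.eq_of_mul_eq_mul_left hm this
  have hq0 : 0 < q := Nat.pos_of_ne_zero fun h0 => by rw [h0, mul_zero] at hq; omega
  have : Nonempty (Fin q) := ⟨⟨0, hq0⟩⟩
  let e : (Fin m × Fin s) × Fin q ≃ Fin m × Fin (s * q) :=
    (Equiv.prodAssoc _ _ _).trans (Equiv.prodCongr (Equiv.refl _) finProdFinEquiv)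
  let χ : Matrix (Fin (m * s)) (Fin (m * s)) ℂ →⋆ₐ[ℂ] A :=
    Φ.comp ((StarAlgHomClass.toStarAlgHom (reindexHom e)).comp ((kronLeft (Fin q)).comp
      (StarAlgHomClass.toStarAlgHom (reindexHom finProdFinEquiv.symm))))
  refine ⟨χ, ?_, ?_, ?_⟩
  · exact hΦ.comp ((reindexHom e).injective.comp (kronLeft_injective.comp (reindexHom _).injective))
  · rintro _ ⟨x, rfl⟩
    refine ⟨(reindexHom finProdFinEquiv.symm).symm (kronLeft (Fin s) x), ?_⟩
    change Φ (reindexHom e (kronLeft (Fin q) (reindexHom _ ((reindexHom _).symm _)))) = φ x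
    rw [StarAlgEquiv.apply_symm_apply, ← hx]
    congr 1
    ext ⟨a, b⟩ ⟨c, d⟩
    obtain ⟨⟨b₁, b₂⟩, rfl⟩ := finProdFinEquiv.surjective b
    obtain ⟨⟨d₁, d₂⟩, rfl⟩ := finProdFinEquiv.surjective d
    simp only [reindexHom_apply, kronLeft_apply, Matrix.reindex_apply, Matrix.submatrix_apply,
      Matrix.kronecker_apply, Matrix.one_apply, e, Equiv.symm_trans_apply, Equiv.prodCongr_symm,
      Equiv.prodCongr_apply, Equiv.refl_symm, Prod.map_apply, Equiv.refl_apply,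
      Equiv.symm_apply_apply, Equiv.prodAssoc_symm_apply, EmbeddingLike.apply_eq_iff_eq,
      Prod.mk.injEq]
    by_cases h1 : b₁ = d₁ <;> by_cases h2 : b₂ = d₂ <;> simp [h1, h2]
  · rw [← hrange]
    rintro _ ⟨x, rfl⟩
    exact ⟨_, rfl⟩

lemma MatrixTower.nontrivial (T : MatrixTower A) : Nontrivial A := by
  have : Nonempty (Fin (T.size 0)) := ⟨⟨0, T.size_pos 0⟩⟩
  exact (T.injective 0).nontrivial

lemma MatrixTower.finrank_alg (T : MatrixTower A) (k : ℕ) :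
    Module.finrank ℂ (T.alg k) = T.size k * T.size k := by
  have e := (StarAlgEquiv.ofInjective (T.emb k) (T.injective k)).toAlgEquiv.toLinearEquiv
  have := e.finrank_eq
  rw [Module.finrank_matrix] at this
  rw [MatrixTower.alg, ← this]
  simp

/-- If the sizes were bounded, the tower would be stationary by dimension count, and a dense,
closed, finite-dimensional subalgebra would be all of `A`. -/
lemma MatrixTower.exists_le_size (T : MatrixTower A) (hA : ¬ FiniteDimensional ℂ A) (N : ℕ) :
    ∃ k, N ≤ T.size k := by
  by_contra! hN
  have hbdd : BddAbove (Set.range T.size) := ⟨N, by rintro _ ⟨k, rfl⟩; exact (hN k).le⟩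
  obtain ⟨k, hk⟩ := Nat.sSup_mem (Set.range_nonempty T.size) hbdd
  have hmax : ∀ j, T.size j ≤ T.size k := fun j => hk ▸ le_csSup hbdd ⟨j, rfl⟩
  have hfd : ∀ j, FiniteDimensional ℂ (T.alg j) := fun j => finiteDimensional_range _
  have heq : ∀ j, T.alg j ≤ T.alg k := by
    intro j
    rcases le_total j k with h | h
    · exact T.alg_mono h
    · have hsize : T.size j = T.size k :=
        le_antisymm (hmax j) (Nat.le_of_dvd (T.size_pos j) (T.size_dvd h))
      have : FiniteDimensional ℂ (Subalgebra.toSubmodule (T.alg j).toSubalgebra) := hfd j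
      have h2 : Subalgebra.toSubmodule (T.alg k).toSubalgebra =
          Subalgebra.toSubmodule (T.alg j).toSubalgebra :=
        Submodule.eq_of_le_of_finrank_eq (T.alg_mono h)
          ((T.finrank_alg k).trans (by rw [← hsize]; exact (T.finrank_alg j).symm))
      intro a ha
      have : a ∈ Subalgebra.toSubmodule (T.alg j).toSubalgebra := ha
      rw [← h2] at this
      exact this
  apply hA
  have htop : T.alg k = ⊤ := by
    rw [eq_top_iff]
    intro a _
    have hd : closure (⋃ j, (T.alg j : Set A)) ⊆ T.alg k :=
      closure_minimal (Set.iUnion_subset fun j => heq j) (T.isClosed_alg k)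
    exact hd (T.dense a)
  have := hfd k
  rw [htop] at this
  exact Module.Finite.of_surjective (⊤ : StarSubalgebra ℂ A).subtype.toAlgHom.toLinearMap
    fun a => ⟨⟨a, trivial⟩, rfl⟩

/-- Stripping off the primes that satisfy `Q` one at a time leaves the required divisor, since a
number without such primes is coprime to each factor removed. -/
lemma exists_dvd_maximal (Q : ℕ → Prop) {n : ℕ} (hn : 0 < n) :
    ∃ t, t ∣ n ∧ (∀ p, p.Prime → p ∣ t → ¬ Q p) ∧
      ∀ m, m ∣ n → (∀ p, p.Prime → p ∣ m → ¬ Q p) → m ∣ t := by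
  induction n using Nat.strong_induction_on with
  | _ n ih =>
    by_cases h : ∃ p, p.Prime ∧ p ∣ n ∧ Q p
    · obtain ⟨p, hp, ⟨n', rfl⟩, hQ⟩ := h
      have hn' : 0 < n' := Nat.pos_of_mul_pos_left hn
      obtain ⟨t, ht, ht1, ht2⟩ := ih n' (lt_mul_of_one_lt_left hn' hp.one_lt) hn'
      refine ⟨t, ht.mul_left p, ht1, fun m hm hmQ => ht2 m ?_ hmQ⟩
      have : Nat.Coprime m p := ((Nat.Prime.coprime_iff_not_dvd hp).mpr fun hpm =>
        hmQ p hp hpm hQ).symm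
      exact this.dvd_of_dvd_mul_left hm
    · push Not at h
      exact ⟨n, dvd_rfl, h, fun m hm _ => hm⟩

lemma MatrixTower.exists_theta_dvd_size (T : MatrixTower A) (n k : ℕ) (hn : 0 < n) :
    ∃ k' ≥ k, ∀ p : primeSet A, (p : ℕ) ∣ n → theta A p ∣ T.size k' := by
  have hfin : {p : primeSet A | (p : ℕ) ∣ n}.Finite := by
    refine Set.Finite.of_finite_image (f := Subtype.val) ((Set.finite_Iic n).subset ?_)
      Subtype.val_injective.injOn
    rintro _ ⟨p, hp, rfl⟩
    exact Nat.le_of_dvd hn hp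
  have : ∀ᶠ k' in Filter.atTop, ∀ p ∈ {p : primeSet A | (p : ℕ) ∣ n}, theta A p ∣ T.size k' := by
    rw [hfin.eventually_all]
    intro p _
    obtain ⟨j, hj⟩ := T.theta_dvd_size p
    filter_upwards [Filter.eventually_ge_atTop j] with i hi using hj.trans (T.size_dvd hi)
  obtain ⟨k', h1, h2⟩ := (this.and (Filter.eventually_ge_atTop k)).exists
  exact ⟨k', h2, fun p hp => h1 p hp⟩

/-- A full matrix algebra inside some algebra of a tower. -/
structure MatrixStage (T : MatrixTower A) where
  size : ℕ
  size_pos : 0 < size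
  emb : Matrix (Fin size) (Fin size) ℂ →⋆ₐ[ℂ] A
  injective : Function.Injective emb
  exists_le : ∃ k, emb.range ≤ T.alg k

/-- Go so far up to `k'` that `θ(p)` divides `T.size k'` for each `p` of `P(A)` dividing `T.size k`.
Then interpolate at the largest divisor of `T.size k'` free of the primes of `P(A)` that do not
divide `T.size k`: these are postponed, and the others are present in full. -/
lemma MatrixStage.exists_next {T : MatrixTower A} (hA : ¬ FiniteDimensional ℂ A)
    (s : MatrixStage T) (j : ℕ) : ∃ s' : MatrixStage T, s.emb.range ≤ s'.emb.range ∧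
      T.alg j ≤ s'.emb.range ∧ s.size * (j + 1) ^ 2 ≤ s'.size ∧
      ∀ p : primeSet A, (p : ℕ) ∣ s'.size → theta A p ∣ s'.size := by
  obtain ⟨k₀, hk₀⟩ := s.exists_le
  obtain ⟨k₁, hk₁⟩ := T.exists_le_size hA (s.size * (j + 1) ^ 2)
  set k := max (max k₀ k₁) j
  obtain ⟨k', hk', hθ⟩ := T.exists_theta_dvd_size (T.size k) k (T.size_pos k)
  obtain ⟨t, ht, ht1, ht2⟩ := exists_dvd_maximal
    (fun p => p ∈ primeSet A ∧ ¬ p ∣ T.size k) (T.size_pos k')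
  have hkt : T.size k ∣ t := ht2 _ (T.size_dvd hk') fun p _ hpk hQ => hQ.2 hpk
  obtain ⟨χ, hχ, h1, h2⟩ := exists_interpolation (T.size_pos k) (T.size_pos k') (T.injective k')
    (T.mono hk') hkt ht
  have ht0 : 0 < t := Nat.pos_of_dvd_of_pos ht (T.size_pos k')
  have hle : ∀ i ≤ k, T.alg i ≤ χ.range := fun i hi => (T.alg_mono hi).trans h1
  refine ⟨⟨t, ht0, χ, hχ, k', h2⟩, ?_, hle j (le_max_right _ _), ?_, fun p hp => ?_⟩
  · exact hk₀.trans (hle k₀ ((le_max_left _ _).trans (le_max_left _ _)))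
  · refine hk₁.trans ((Nat.le_of_dvd (T.size_pos k) (T.size_dvd ?_)).trans (Nat.le_of_dvd ht0 hkt))
    exact (le_max_right _ _).trans (le_max_left _ _)
  · have hpk : (p : ℕ) ∣ T.size k := by
      by_contra hpk
      exact ht1 p p.2.1 hp ⟨p.2, hpk⟩
    refine ht2 _ (hθ p hpk) fun q hq hqp hQ => hQ.2 ?_
    have : q = p := (Nat.prime_dvd_prime_iff_eq hq p.2.1).mp (hq.dvd_of_dvd_pow hqp)
    rwa [this]

/-- The scalars, as a full matrix algebra of size one. -/
def scalarHom (A : Type u) [CStarAlgebra A] : Matrix (Fin 1) (Fin 1) ℂ →⋆ₐ[ℂ] A where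
  toFun x := algebraMap ℂ A (x 0 0)
  map_one' := by simp
  map_mul' x y := by simp [Matrix.mul_apply]
  map_zero' := by simp
  map_add' x y := by simp
  commutes' c := by simp [Matrix.algebraMap_matrix_apply]
  map_star' x := by rw [Matrix.star_apply, algebraMap_star_comm]

theorem MatrixTower.exists_refinement (T : MatrixTower A) (hA : ¬ FiniteDimensional ℂ A) :
    ∃ T' : MatrixTower A, T'.size 0 = 1 ∧ (∀ j, T'.size j * (j + 1) ^ 2 ≤ T'.size (j + 1)) ∧
      ∀ j, ∀ p : primeSet A, (p : ℕ) ∣ T'.size j → theta A p ∣ T'.size j := by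
  have := T.nontrivial
  choose next h1 h2 h3 h4 using fun s : MatrixStage T => fun j => s.exists_next hA j
  let s₀ : MatrixStage T := ⟨1, one_pos, scalarHom A, fun x y hxy => by
    ext i j
    rw [Subsingleton.elim i 0, Subsingleton.elim j 0]
    exact (algebraMap ℂ A).injective hxy, 0, by
    rintro _ ⟨x, rfl⟩
    exact algebraMap_mem (T.alg 0) (x 0 0)⟩
  let s : ℕ → MatrixStage T := fun j => Nat.rec s₀ (fun j s => next s j) j
  have hs : ∀ j, s (j + 1) = next (s j) j := fun _ => rfl
  refine ⟨⟨fun j => (s j).size, fun j => (s j).size_pos, fun j => (s j).emb,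
    fun j => (s j).injective, monotone_nat_of_le_succ fun j => h1 (s j) j, ?_⟩, rfl,
    fun j => h3 (s j) j, fun j p hp => ?_⟩
  · refine T.dense.mono (Set.iUnion_mono' fun j => ⟨j + 1, h2 (s j) j⟩)
  · rcases j with _ | j
    · exact absurd hp (by change ¬ (p : ℕ) ∣ 1; rw [Nat.dvd_one]; exact p.2.1.ne_one)
    · exact h4 (s j) j p hp

lemma IsUHF.exists_matrixTower (hA : IsUHF A) : Nonempty (MatrixTower A) := by
  obtain ⟨-, n, S, hn, hS, hmono, hdense⟩ := hA
  choose φ hφ hr using fun k => (hS k).exists_hom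
  refine ⟨⟨n, hn, φ, hφ, ?_, ?_⟩⟩
  · simpa only [hr] using hmono
  · simpa only [hr] using hdense

end Refine

/-! ### Infinite tensor products of inner automorphisms and the actions they generate. -/

section LimitAction

variable {A : Type u} [CStarAlgebra A]

open Unitary Filter Topology

/-- The inner automorphisms by `X k` are eventually constant on each algebra of the tower, hence
converge pointwise on `A`. -/
lemma MatrixTower.exists_limit_hom (T : MatrixTower A) {X : ℕ → unitary A}
    (hX : ∀ j, ∀ a ∈ T.alg j,
      (X (j + 1) : A) * a * star (X (j + 1) : A) = X j * a * star (X j : A)) :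
    ∃ G : A →⋆ₐ[ℂ] A, Continuous G ∧ ∀ j, ∀ a ∈ T.alg j, G a = X j * a * star (X j : A) := by
  have hX' : ∀ j, ∀ a ∈ T.alg j, ∀ k ≥ j,
      (X k : A) * a * star (X k : A) = X j * a * star (X j : A) := by
    intro j a ha k hk
    induction k, hk using Nat.le_induction with
    | base => rfl
    | succ k hk ih => rw [hX k a (T.alg_mono hk ha), ih]
  let F : ℕ → A →L[ℂ] A := fun k =>
    (ContinuousLinearMap.mul ℂ A (X k)).comp ((ContinuousLinearMap.mul ℂ A).flip (star (X k : A)))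
  have hFa : ∀ k a, F k a = X k * a * star (X k : A) := fun k a => (mul_assoc _ _ _).symm
  obtain ⟨G, hG⟩ := exists_tendsto_of_eventually_const F
    (fun k a => by rw [hFa, norm_unitary_conj]) T.dense (fun a ha => by
      obtain ⟨j, hj⟩ := Set.mem_iUnion.mp ha
      refine ⟨X j * a * star (X j : A), ?_⟩
      filter_upwards [eventually_ge_atTop j] with k hk
      rw [hFa, hX' j a hj k hk])
  simp only [hFa] at hG
  have hGa : ∀ j, ∀ a ∈ T.alg j, G a = X j * a * star (X j : A) := by
    intro j a ha
    refine tendsto_nhds_unique (hG a) (tendsto_const_nhds.congr' ?_)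
    filter_upwards [eventually_ge_atTop j] with k hk
    rw [hX' j a ha k hk]
  refine ⟨⟨⟨⟨⟨⟨G, ?_⟩, ?_⟩, map_zero G, map_add G⟩, ?_⟩, ?_⟩, G.continuous, hGa⟩
  · rw [hGa 0 1 (one_mem _), mul_one]
    exact (Unitary.mem_iff.mp (X 0).2).2
  · change ∀ a b, G (a * b) = G a * G b
    refine T.eq_of_eqOn_alg₂ (by fun_prop) (by fun_prop) fun k a ha b hb => ?_
    rw [hGa k _ (mul_mem ha hb), hGa k a ha, hGa k b hb]
    have : star (X k : A) * X k = 1 := (Unitary.mem_iff.mp (X k).2).1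
    calc (X k : A) * (a * b) * star (X k : A) = X k * a * 1 * b * star (X k : A) := by
          simp only [mul_assoc, one_mul]
      _ = _ := by rw [← this]; simp only [mul_assoc]
  · intro c
    change G (algebraMap ℂ A c) = _
    rw [hGa 0 _ (algebraMap_mem _ c), ← Algebra.commutes, mul_assoc,
      (Unitary.mem_iff.mp (X 0).2).2, mul_one]
  · refine T.eq_of_eqOn_alg (by fun_prop) (by fun_prop) fun k a ha => ?_
    change G (star a) = star (G a)
    rw [hGa k _ (StarMemClass.star_mem ha), hGa k a ha, star_mul, star_mul, star_star, mul_assoc]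

theorem MatrixTower.exists_limit_aut (T : MatrixTower A) {X : ℕ → unitary A}
    (hXm : ∀ j, (X j : A) ∈ T.alg j)
    (hX : ∀ j, ∀ a ∈ T.alg j,
      (X (j + 1) : A) * a * star (X (j + 1) : A) = X j * a * star (X j : A)) :
    ∃ α : A ≃⋆ₐ[ℂ] A, ∀ j, ∀ a ∈ T.alg j, α a = X j * a * star (X j : A) := by
  obtain ⟨G, hc, hG⟩ := T.exists_limit_hom hX
  have h1 : ∀ j, star (X j : A) * X j = 1 := fun j => (Unitary.mem_iff.mp (X j).2).1
  have h2 : ∀ j, (X j : A) * star (X j : A) = 1 := fun j => (Unitary.mem_iff.mp (X j).2).2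
  have hmem : ∀ j, ∀ a ∈ T.alg j, star (X j : A) * a * X j ∈ T.alg j := fun j a ha =>
    mul_mem (mul_mem (StarMemClass.star_mem (hXm j)) ha) (hXm j)
  have hcancel : ∀ j a, (X j : A) * (star (X j : A) * a * X j) * star (X j : A) = a := by
    intro j a
    calc (X j : A) * (star (X j : A) * a * X j) * star (X j : A) =
        (X j * star (X j : A)) * a * (X j * star (X j : A)) := by simp only [mul_assoc]
      _ = a := by rw [h2, one_mul, mul_one]
  have hcancel' : ∀ j a, star (X j : A) * (X j * a * star (X j : A)) * X j = a := by
    intro j a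
    calc star (X j : A) * (X j * a * star (X j : A)) * X j =
        (star (X j : A) * X j) * a * (star (X j : A) * X j) := by simp only [mul_assoc]
      _ = a := by rw [h1, one_mul, mul_one]
  obtain ⟨G', hc', hG'⟩ := T.exists_limit_hom (X := fun j => (X j)⁻¹) fun j a ha => by
    change star (X (j + 1) : A) * a * star (star (X (j + 1) : A)) =
      star (X j : A) * a * star (star (X j : A))
    rw [star_star, star_star]
    have := hX j _ (hmem j a ha)
    rw [hcancel] at this
    rw [← hcancel' (j + 1) (star (X j : A) * a * X j), this]
  have hG'' : ∀ j, ∀ a ∈ T.alg j, G' a = star (X j : A) * a * X j := by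
    intro j a ha
    rw [hG' j a ha]
    change star (X j : A) * a * star (star (X j : A)) = _
    rw [star_star]
  refine ⟨StarAlgEquiv.ofStarAlgHom G G' ?_ ?_, hG⟩
  · ext a
    refine T.eq_of_eqOn_alg (f := fun a => G' (G a)) (g := fun a => a) (by fun_prop) (by fun_prop)
      (fun k a ha => ?_) a
    have hGm : (X k : A) * a * star (X k : A) ∈ T.alg k :=
      mul_mem (mul_mem (hXm k) ha) (StarMemClass.star_mem (hXm k))
    change G' (G a) = a
    rw [hG k a ha, hG'' k _ hGm, hcancel']
  · ext a
    refine T.eq_of_eqOn_alg (f := fun a => G (G' a)) (g := fun a => a) (by fun_prop) (by fun_prop)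
      (fun k a ha => ?_) a
    rw [hG'' k a ha, hG k _ (hmem k a ha), hcancel]

/-- A sequence of unitaries with commuting tensor factors along a tower. -/
structure IsFactorSeq (T : MatrixTower A) (x : ℕ → unitary A) : Prop where
  mem : ∀ j, (x j : A) ∈ T.alg (j + 1)
  comm : ∀ j, ∀ a ∈ T.alg j, (x j : A) * a = a * x j

/-- The partial products `x 0 * ⋯ * x (j - 1)`. -/
def partialProd (x : ℕ → unitary A) : ℕ → unitary A
  | 0 => 1
  | j + 1 => partialProd x j * x j

variable {T : MatrixTower A} {x y : ℕ → unitary A}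

lemma IsFactorSeq.partialProd_mem (hx : IsFactorSeq T x) (j : ℕ) :
    (partialProd x j : A) ∈ T.alg j := by
  induction j with
  | zero => exact one_mem _
  | succ j ih => exact mul_mem (T.alg_mono (Nat.le_succ j) ih) (hx.mem j)

lemma IsFactorSeq.commute_partialProd (hx : IsFactorSeq T x) (hy : IsFactorSeq T y) (j : ℕ) :
    Commute (x j) (partialProd y j) :=
  Subtype.ext (hx.comm j _ (hy.partialProd_mem j))

theorem IsFactorSeq.exists_aut (hx : IsFactorSeq T x) : ∃ α : A ≃⋆ₐ[ℂ] A, ∀ j, ∀ a ∈ T.alg j,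
    α a = partialProd x j * a * star (partialProd x j : A) := by
  refine T.exists_limit_aut hx.partialProd_mem fun j a ha => ?_
  change (partialProd x j * x j : A) * a * star (partialProd x j * x j : A) = _
  rw [star_mul, mul_assoc (partialProd x j : A), hx.comm j a ha]
  have : (x j : A) * star (x j : A) = 1 := (Unitary.mem_iff.mp (x j).2).2
  calc (partialProd x j : A) * (a * x j) * (star (x j : A) * star (partialProd x j : A))
      = partialProd x j * a * (x j * star (x j : A)) * star (partialProd x j : A) := by
        simp only [mul_assoc]
    _ = _ := by rw [this, mul_one]

/-- The automorphism `⨂ Ad (x j)`. -/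
def IsFactorSeq.aut (hx : IsFactorSeq T x) : A ≃⋆ₐ[ℂ] A := hx.exists_aut.choose

lemma IsFactorSeq.aut_apply (hx : IsFactorSeq T x) {j : ℕ} {a : A} (ha : a ∈ T.alg j) :
    hx.aut a = partialProd x j * a * star (partialProd x j : A) :=
  hx.exists_aut.choose_spec j a ha

lemma commute_scalarUnitary (t : ℝ) (z : unitary A) : Commute (scalarUnitary A t) z := by
  ext
  rw [Submonoid.coe_mul, Submonoid.coe_mul, coe_scalarUnitary, smul_mul_assoc, mul_smul_comm,
    one_mul, mul_one]

/-- Factors from different levels commute, so the scalar commutators of the individual levels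
multiply and their phases add. In particular conjugations by the two partial products commute. -/
lemma partialProd_mul (hx : IsFactorSeq T x) (hy : IsFactorSeq T y) {t : ℕ → ℝ}
    (hxy : ∀ j, x j * y j = scalarUnitary A (t j) * (y j * x j)) (j : ℕ) :
    partialProd x j * partialProd y j =
      scalarUnitary A (∑ i ∈ Finset.range j, t i) * (partialProd y j * partialProd x j) := by
  induction j with
  | zero => simp [partialProd, scalarUnitary_zero]
  | succ j ih =>
    rw [Finset.sum_range_succ, scalarUnitary_add]
    change partialProd x j * x j * (partialProd y j * y j) =
      _ * (partialProd y j * y j * (partialProd x j * x j))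
    have h1 := (hx.commute_partialProd hy j).eq
    have h2 := (hy.commute_partialProd hx j).eq
    have h3 := (commute_scalarUnitary (t j) (partialProd y j * partialProd x j)).eq
    calc partialProd x j * x j * (partialProd y j * y j)
        = partialProd x j * (x j * partialProd y j) * y j := by simp only [mul_assoc]
      _ = (partialProd x j * partialProd y j) * (x j * y j) := by rw [h1]; simp only [mul_assoc]
      _ = scalarUnitary A (∑ i ∈ Finset.range j, t i) * (partialProd y j * partialProd x j *
            scalarUnitary A (t j)) * (y j * x j) := by rw [ih, hxy]; simp only [mul_assoc]
      _ = scalarUnitary A (∑ i ∈ Finset.range j, t i) * scalarUnitary A (t j) *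
            (partialProd y j * (partialProd x j * y j) * x j) := by
          rw [← h3]; simp only [mul_assoc]
      _ = _ := by rw [← h2]; simp only [mul_assoc]

lemma IsFactorSeq.commute_aut (hx : IsFactorSeq T x) (hy : IsFactorSeq T y) {t : ℕ → ℝ}
    (hxy : ∀ j, x j * y j = scalarUnitary A (t j) * (y j * x j)) : Commute hx.aut hy.aut := by
  have hcx : Continuous hx.aut := (StarAlgEquiv.isometry hx.aut).continuous
  have hcy : Continuous hy.aut := (StarAlgEquiv.isometry hy.aut).continuous
  refine StarAlgEquiv.ext fun a => ?_
  refine T.eq_of_eqOn_alg (f := fun a => hx.aut (hy.aut a)) (g := fun a => hy.aut (hx.aut a))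
    (by fun_prop) (by fun_prop) (fun k a ha => ?_) a
  have hX := hx.partialProd_mem k
  have hY := hy.partialProd_mem k
  set X := partialProd x k with hXd
  set Y := partialProd y k with hYd
  have h1 : (Y : A) * a * star (Y : A) ∈ T.alg k := mul_mem (mul_mem hY ha) (StarMemClass.star_mem hY)
  have h2 : (X : A) * a * star (X : A) ∈ T.alg k := mul_mem (mul_mem hX ha) (StarMemClass.star_mem hX)
  change hx.aut (hy.aut a) = hy.aut (hx.aut a)
  rw [hy.aut_apply ha, hx.aut_apply h1, hx.aut_apply ha, hy.aut_apply h2, ← hXd, ← hYd]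
  have h3 := partialProd_mul hx hy hxy k
  rw [← hXd, ← hYd] at h3
  obtain ⟨c, hc⟩ : ∃ c, c = scalarUnitary A (∑ i ∈ Finset.range k, t i) := ⟨_, rfl⟩
  rw [← hc] at h3
  have h4 : ((X * Y : unitary A) : A) * a * star ((X * Y : unitary A) : A) =
      ((Y * X : unitary A) : A) * a * star ((Y * X : unitary A) : A) := by
    have hcc : (c : A) * star (c : A) = 1 := (Unitary.mem_iff.mp c.2).2
    have hcomm : ∀ z : A, (c : A) * z = z * c := by
      intro z
      rw [hc, coe_scalarUnitary, smul_mul_assoc, mul_smul_comm, one_mul, mul_one]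
    have hcYX : ((c * (Y * X) : unitary A) : A) = c * (Y * X : unitary A) := rfl
    rw [h3, hcYX, star_mul]
    calc (c : A) * (Y * X : unitary A) * a * (star ((Y * X : unitary A) : A) * star (c : A))
        = c * ((Y * X : unitary A) * a * star ((Y * X : unitary A) : A)) * star (c : A) := by
          simp only [mul_assoc]
      _ = _ := by rw [hcomm, mul_assoc, hcc, mul_one]
  simp only [Submonoid.coe_mul, star_mul] at h4
  simpa only [mul_assoc] using h4

/-- The action of `ℤ²` by two commuting automorphisms. -/
def actionOfCommute {α β : A ≃⋆ₐ[ℂ] A} (h : Commute α β) : Action A :=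
  MonoidHom.mk' (fun n => α ^ (Multiplicative.toAdd n).1 * β ^ (Multiplicative.toAdd n).2) (by
    intro m n
    rw [toAdd_mul, Prod.fst_add, Prod.snd_add, zpow_add, zpow_add]
    have := (h.zpow_zpow (Multiplicative.toAdd n).1 (Multiplicative.toAdd m).2).eq
    calc _ = α ^ (Multiplicative.toAdd m).1 * (α ^ (Multiplicative.toAdd n).1 *
          β ^ (Multiplicative.toAdd m).2) * β ^ (Multiplicative.toAdd n).2 := by
            simp only [mul_assoc]
      _ = _ := by rw [this]; simp only [mul_assoc])

lemma actionOfCommute_at {α β : A ≃⋆ₐ[ℂ] A} (h : Commute α β) (n : ℤ × ℤ) :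
    (actionOfCommute h).at n = α ^ n.1 * β ^ n.2 := rfl

lemma zpow_apply_of_inner {α : A ≃⋆ₐ[ℂ] A} {S : StarSubalgebra ℂ A} {X : unitary A}
    (hX : (X : A) ∈ S) (hα : ∀ a ∈ S, α a = X * a * star (X : A)) (n : ℤ) :
    ∀ a ∈ S, (α ^ n) a = ((X ^ n : unitary A) : A) * a * star ((X ^ n : unitary A) : A) := by
  have h1 : star (X : A) * X = 1 := (Unitary.mem_iff.mp X.2).1
  have h2 : (X : A) * star (X : A) = 1 := (Unitary.mem_iff.mp X.2).2
  have hinv : ∀ a ∈ S, α⁻¹ a = star (X : A) * a * X := by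
    intro a ha
    have hm : star (X : A) * a * X ∈ S := mul_mem (mul_mem (StarMemClass.star_mem hX) ha) hX
    have h3 : α (star (X : A) * a * X) = a := by
      rw [hα _ hm]
      calc (X : A) * (star (X : A) * a * X) * star (X : A) =
          (X * star (X : A)) * a * (X * star (X : A)) := by simp only [mul_assoc]
        _ = a := by rw [h2, one_mul, mul_one]
    change α.symm a = _
    rw [StarAlgEquiv.symm_apply_eq, h3]
  have hXz : ∀ n : ℤ, ((X ^ n : unitary A) : A) ∈ S := fun n =>
    mem_unitarySubgroup.mp (zpow_mem (mem_unitarySubgroup.mpr hX) n)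
  induction n with
  | zero => intro a _; simp
  | succ n ih =>
    intro a ha
    rw [zpow_add_one, zpow_add_one]
    change (α ^ (n : ℤ)) (α a) = _
    rw [hα a ha, ih _ (mul_mem (mul_mem hX ha) (StarMemClass.star_mem hX)), Submonoid.coe_mul,
      star_mul]
    simp only [mul_assoc]
  | pred n ih =>
    intro a ha
    rw [zpow_sub_one, zpow_sub_one]
    change (α ^ (-(n : ℤ))) (α⁻¹ a) = _
    rw [hinv a ha, ih _ (mul_mem (mul_mem (StarMemClass.star_mem hX) ha) hX), Submonoid.coe_mul,
      star_mul]
    change _ = _ * star (X : A) * a * (star (star (X : A)) * _)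
    rw [star_star]
    simp only [mul_assoc]

/-- The unitary implementing an action on the `j`-th algebra of a tower. -/
def implementer (x y : ℕ → unitary A) (j : ℕ) (n : ℤ × ℤ) : unitary A :=
  partialProd x j ^ n.1 * partialProd y j ^ n.2

lemma implementer_succ (hx : IsFactorSeq T x) (hy : IsFactorSeq T y) (j : ℕ) (n : ℤ × ℤ) :
    implementer x y (j + 1) n = implementer x y j n * (x j ^ n.1 * y j ^ n.2) := by
  have hxx := hx.commute_partialProd hx j
  have hyy := hy.commute_partialProd hy j
  have hxy := ((hx.commute_partialProd hy j).zpow_zpow n.1 n.2).eq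
  change (partialProd x j * x j) ^ n.1 * (partialProd y j * y j) ^ n.2 = _
  rw [hxx.symm.mul_zpow, hyy.symm.mul_zpow, implementer]
  calc partialProd x j ^ n.1 * x j ^ n.1 * (partialProd y j ^ n.2 * y j ^ n.2)
      = partialProd x j ^ n.1 * (x j ^ n.1 * partialProd y j ^ n.2) * y j ^ n.2 := by
        simp only [mul_assoc]
    _ = _ := by rw [hxy]; simp only [mul_assoc]

lemma implementer_mem (hx : IsFactorSeq T x) (hy : IsFactorSeq T y) (j : ℕ) (n : ℤ × ℤ) :
    (implementer x y j n : A) ∈ T.alg j :=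
  mem_unitarySubgroup.mp (mul_mem (zpow_mem (mem_unitarySubgroup.mpr (hx.partialProd_mem j)) _)
    (zpow_mem (mem_unitarySubgroup.mpr (hy.partialProd_mem j)) _))

lemma actionOfCommute_apply (hx : IsFactorSeq T x) (hy : IsFactorSeq T y)
    (h : Commute hx.aut hy.aut) (n : ℤ × ℤ) {j : ℕ} {a : A} (ha : a ∈ T.alg j) :
    (actionOfCommute h).at n a = implementer x y j n * a * star (implementer x y j n : A) := by
  rw [actionOfCommute_at, implementer]
  change (hx.aut ^ n.1) ((hy.aut ^ n.2) a) = _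
  have hm : ((partialProd y j ^ n.2 : unitary A) : A) ∈ T.alg j :=
    mem_unitarySubgroup.mp (zpow_mem (mem_unitarySubgroup.mpr (hy.partialProd_mem j)) _)
  rw [zpow_apply_of_inner (hy.partialProd_mem j) (fun a ha => hy.aut_apply ha) n.2 a ha,
    zpow_apply_of_inner (hx.partialProd_mem j) (fun a ha => hx.aut_apply ha) n.1 _
      (mul_mem (mul_mem hm ha) (StarMemClass.star_mem hm)), Submonoid.coe_mul, star_mul]
  simp only [mul_assoc]

end LimitAction

/-! ### Monomial matrices: shifts and clock matrices. -/

section Monomial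

open Matrix

variable {d : ℕ}

/-- The monomial matrix `e_b ↦ c b • e_{b + s}`. -/
def monomialMatrix (c : ZMod d → ℂ) (s : ZMod d) : Matrix (ZMod d) (ZMod d) ℂ :=
  Matrix.of fun a b => if a = b + s then c b else 0

lemma star_monomialMatrix (c : ZMod d → ℂ) (s : ZMod d) :
    star (monomialMatrix c s) = monomialMatrix (fun b => star (c (b - s))) (-s) := by
  ext a b
  simp only [monomialMatrix, Matrix.star_apply, Matrix.of_apply]
  by_cases h : b = a + s
  · subst h; simp
  · have : a ≠ b + -s := fun h2 => h (by rw [h2]; ring)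
    rw [if_neg h, if_neg this, star_zero]

lemma monomialMatrix_one : monomialMatrix (fun _ : ZMod d => 1) 0 = 1 := by
  ext a b
  simp [monomialMatrix, Matrix.one_apply]

variable [NeZero d]

lemma monomialMatrix_mul (c c' : ZMod d → ℂ) (s s' : ZMod d) :
    monomialMatrix c s * monomialMatrix c' s' =
      monomialMatrix (fun b => c (b + s') * c' b) (s' + s) := by
  ext a b
  simp only [monomialMatrix, Matrix.mul_apply, Matrix.of_apply]
  rw [Finset.sum_eq_single (b + s')]
  · simp [add_assoc]
  · intro k _ hk
    rw [if_neg hk, mul_zero]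
  · simp

lemma monomialMatrix_mem_unitary {c : ZMod d → ℂ} (hc : ∀ b, star (c b) * c b = 1) (s : ZMod d) :
    monomialMatrix c s ∈ unitary (Matrix (ZMod d) (ZMod d) ℂ) := by
  have h1 : star (monomialMatrix c s) * monomialMatrix c s = 1 := by
    rw [star_monomialMatrix, monomialMatrix_mul, add_neg_cancel, ← monomialMatrix_one]
    congr 1
    funext b
    rw [add_sub_cancel_right, hc]
  exact Unitary.mem_iff.mpr ⟨h1, mul_eq_one_comm.mp h1⟩

lemma monomialMatrix_mul_single (c : ZMod d → ℂ) (s l : ZMod d) :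
    monomialMatrix c s * Matrix.single l l 1 =
      Matrix.single (l + s) (l + s) 1 * monomialMatrix c s := by
  ext a b
  by_cases hb : b = l
  · subst hb
    by_cases ha : a = b + s
    · subst ha; simp [monomialMatrix]
    · rw [Matrix.single_mul_apply_of_ne _ _ _ _ _ ha]
      simp [monomialMatrix, ha]
  · rw [Matrix.mul_single_apply_of_ne _ _ _ _ _ hb]
    by_cases ha : a = l + s
    · subst ha
      have : l ≠ b := Ne.symm hb
      simp [monomialMatrix, this]
    · rw [Matrix.single_mul_apply_of_ne _ _ _ _ _ ha]

/-- The condition `c ^ d = 1` is what makes the powers consistent when the representative of `b + 1`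
wraps around. -/
lemma pow_val_add_one {c : ℂ} (hc : c ^ d = 1) (b : ZMod d) :
    c ^ (b + 1).val = c * c ^ b.val := by
  rw [ZMod.val_add, ← pow_eq_pow_mod _ hc, ZMod.val_one_eq_one_mod, pow_add,
    ← pow_eq_pow_mod _ hc, pow_one, mul_comm]

/-- The complex number `exp (2πi t)`. -/
def phase (t : ℝ) : ℂ := Complex.exp (2 * Real.pi * Complex.I * t)

lemma star_phase_pow_mul (t : ℝ) (k : ℕ) : star (phase t ^ k) * phase t ^ k = 1 := by
  have h : star (phase t) * phase t = 1 := by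
    rw [phase, ← starRingEnd_apply, ← Complex.exp_conj, ← Complex.exp_add, map_mul, map_mul, map_mul,
      Complex.conj_I, Complex.conj_ofReal, Complex.conj_ofReal, Complex.conj_ofNat]
    ring_nf
    exact Complex.exp_zero
  rw [star_pow, ← mul_pow, h, one_pow]

lemma phase_pow_eq_one {t : ℝ} {d : ℕ} (h : ∃ z : ℤ, t * d = z) : phase t ^ d = 1 := by
  obtain ⟨z, hz⟩ := h
  have hz' : (t : ℂ) * d = z := by exact_mod_cast hz
  rw [phase, ← Complex.exp_nat_mul, Complex.exp_eq_one_iff]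
  exact ⟨z, by linear_combination (2 * Real.pi * Complex.I) * hz'⟩

lemma phase_neg_mul (t : ℝ) : phase (-t) * phase t = 1 := by
  rw [phase, phase, ← Complex.exp_add, Complex.ofReal_neg, mul_neg, neg_add_cancel, Complex.exp_zero]

/-- The product of the diagonal unitary with eigenvalues the powers of `exp (2πi t)` and the
`s`-th power of the shift. -/
def clockUnitary (t : ℝ) (s : ZMod d) : unitary (Matrix (ZMod d) (ZMod d) ℂ) :=
  ⟨monomialMatrix (fun b => phase t ^ b.val) s,
    monomialMatrix_mem_unitary (fun b => star_phase_pow_mul t b.val) s⟩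

end Monomial

/-! ### The product type actions with prescribed phases; outer conjugacy. -/

section FactorSystem

variable {A : Type u} [CStarAlgebra A]

/-- The successive tensor factors of a tower, with indices in cyclic groups. -/
structure FactorSystem (T : MatrixTower A) where
  d : ℕ → ℕ
  neZero : ∀ j, NeZero (d j)
  size_succ : ∀ j, T.size j * d j = T.size (j + 1)
  κ : ∀ j, Matrix (ZMod (d j)) (ZMod (d j)) ℂ →⋆ₐ[ℂ] A
  injective : ∀ j, Function.Injective (κ j)
  range_le : ∀ j, (κ j).range ≤ T.alg (j + 1)
  comm : ∀ j, ∀ y, ∀ a ∈ T.alg j, κ j y * a = a * κ j y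
  le_sup : ∀ j, T.alg (j + 1) ≤ T.alg j ⊔ (κ j).range

attribute [instance] FactorSystem.neZero

lemma MatrixTower.exists_factorSystem (T : MatrixTower A) : Nonempty (FactorSystem T) := by
  choose d κ h1 h2 h3 h4 h5 using T.exists_factor
  have hd : ∀ j, NeZero (d j) := fun j => ⟨fun h0 => by
    have := h1 j
    rw [h0, mul_zero] at this
    exact (T.size_pos (j + 1)).ne this⟩
  let e : ∀ j, Matrix (ZMod (d j)) (ZMod (d j)) ℂ ≃⋆ₐ[ℂ] Matrix (Fin (d j)) (Fin (d j)) ℂ :=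
    fun j => reindexHom (ZMod.finEquiv (d j)).symm.toEquiv
  let κ' := fun j => (κ j).comp (StarAlgHomClass.toStarAlgHom (e j))
  have hr : ∀ j, (κ' j).range = (κ j).range := by
    intro j
    ext a
    constructor
    · rintro ⟨y, rfl⟩; exact ⟨e j y, rfl⟩
    · rintro ⟨y, rfl⟩
      refine ⟨(e j).symm y, ?_⟩
      change κ j (e j ((e j).symm y)) = κ j y
      rw [StarAlgEquiv.apply_symm_apply]
  exact ⟨⟨d, hd, h1, κ', fun j => (h2 j).comp (e j).injective, fun j => (hr j).le.trans (h3 j),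
    fun j y a ha => h4 j _ a ha, fun j => by rw [hr]; exact h5 j⟩⟩

namespace FactorSystem

variable {T : MatrixTower A} (F : FactorSystem T)

/-- The unitaries of `A` given by unitary matrices in the tensor factors. -/
def lift (U : ∀ j, unitary (Matrix (ZMod (F.d j)) (ZMod (F.d j)) ℂ)) (j : ℕ) : unitary A :=
  ⟨F.κ j (U j), Unitary.map_mem (F.κ j) (U j).2⟩

lemma lift_mem (U : ∀ j, unitary (Matrix (ZMod (F.d j)) (ZMod (F.d j)) ℂ)) (j : ℕ) :
    (F.lift U j : A) ∈ (F.κ j).range := ⟨U j, rfl⟩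

lemma isFactorSeq (U : ∀ j, unitary (Matrix (ZMod (F.d j)) (ZMod (F.d j)) ℂ)) :
    IsFactorSeq T (F.lift U) where
  mem j := F.range_le j ⟨_, rfl⟩
  comm j a ha := F.comm j _ a ha

/-- The cyclic shifts. -/
def shift (j : ℕ) : unitary (Matrix (ZMod (F.d j)) (ZMod (F.d j)) ℂ) :=
  ⟨monomialMatrix (fun _ => 1) 1, monomialMatrix_mem_unitary (fun _ => by simp) 1⟩

/-- The products of a diagonal unitary with eigenvalues the powers of `exp (2πi t)` and a power
of the shift. -/
def clock (t : ℕ → ℝ) (j : ℕ) : unitary (Matrix (ZMod (F.d j)) (ZMod (F.d j)) ℂ) :=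
  clockUnitary (t j) (j : ZMod (F.d j))

lemma shift_mul_clock {t : ℕ → ℝ} (ht : ∀ j, ∃ z : ℤ, t j * F.d j = z) (j : ℕ) :
    F.lift F.shift j * F.lift (F.clock t) j =
      scalarUnitary A (-t j) * (F.lift (F.clock t) j * F.lift F.shift j) := by
  have hcd := phase_pow_eq_one (ht j)
  have h1 : (F.shift j : Matrix (ZMod (F.d j)) (ZMod (F.d j)) ℂ) * F.clock t j =
      phase (-t j) • ((F.clock t j : Matrix (ZMod (F.d j)) (ZMod (F.d j)) ℂ) * F.shift j) := by
    change monomialMatrix _ _ * monomialMatrix _ _ = _ • (monomialMatrix _ _ * monomialMatrix _ _)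
    rw [monomialMatrix_mul, monomialMatrix_mul]
    ext a b
    simp only [monomialMatrix, Matrix.smul_apply, Matrix.of_apply, one_mul, mul_one, smul_eq_mul,
      pow_val_add_one hcd, add_comm (j : ZMod (F.d j)) 1]
    split_ifs
    · rw [← mul_assoc, phase_neg_mul, one_mul]
    · simp
  ext
  change F.κ j (F.shift j) * F.κ j (F.clock t j) = _ * (F.κ j (F.clock t j) * F.κ j (F.shift j))
  rw [← map_mul, ← map_mul, h1, map_smul, coe_scalarUnitary, smul_mul_assoc, one_mul, phase]

variable {t : ℕ → ℝ} (ht : ∀ j, ∃ z : ℤ, t j * F.d j = z)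

/-- The product type action of `ℤ²` with phases `t`. -/
def action : Action A :=
  actionOfCommute ((F.isFactorSeq F.shift).commute_aut (F.isFactorSeq (F.clock t))
    (F.shift_mul_clock ht))

/-- The unitaries implementing the action on the algebras of the tower. -/
def impl (t : ℕ → ℝ) (j : ℕ) (n : ℤ × ℤ) : unitary A :=
  implementer (F.lift F.shift) (F.lift (F.clock t)) j n

/-- The unitaries implementing the action on the tensor factors. -/
def localImpl (t : ℕ → ℝ) (j : ℕ) (n : ℤ × ℤ) : unitary A :=
  F.lift F.shift j ^ n.1 * F.lift (F.clock t) j ^ n.2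

lemma impl_succ (j : ℕ) (n : ℤ × ℤ) : F.impl t (j + 1) n = F.impl t j n * F.localImpl t j n :=
  implementer_succ (F.isFactorSeq _) (F.isFactorSeq _) j n

lemma impl_mem (j : ℕ) (n : ℤ × ℤ) : (F.impl t j n : A) ∈ T.alg j :=
  implementer_mem (F.isFactorSeq _) (F.isFactorSeq _) j n

lemma localImpl_mem (j : ℕ) (n : ℤ × ℤ) : (F.localImpl t j n : A) ∈ (F.κ j).range :=
  mem_unitarySubgroup.mp (mul_mem (zpow_mem (mem_unitarySubgroup.mpr (F.lift_mem _ j)) _)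
    (zpow_mem (mem_unitarySubgroup.mpr (F.lift_mem _ j)) _))

lemma action_apply (n : ℤ × ℤ) {j : ℕ} {a : A} (ha : a ∈ T.alg j) :
    (F.action ht).at n a = F.impl t j n * a * star (F.impl t j n : A) :=
  actionOfCommute_apply (F.isFactorSeq _) (F.isFactorSeq _) _ n ha

/-- The contribution of the earlier factors lies in `T.alg j` and commutes with the factor `j`, so
only the local unitary acts. -/
lemma action_apply_factor (n : ℤ × ℤ) {j : ℕ} {b : A} (hb : b ∈ (F.κ j).range) :
    (F.action ht).at n b = F.localImpl t j n * b * star (F.localImpl t j n : A) := by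
  rw [F.action_apply ht n (F.range_le j hb), impl_succ, Submonoid.coe_mul, star_mul]
  set w := F.impl t j n with hw
  set v := F.localImpl t j n
  have hm : (v : A) * b * star (v : A) ∈ (F.κ j).range :=
    mul_mem (mul_mem (F.localImpl_mem j n) hb) (StarMemClass.star_mem (F.localImpl_mem j n))
  obtain ⟨y, hy⟩ := hm
  have hy : F.κ j y = v * b * star (v : A) := hy
  have h1 := F.comm j y w (F.impl_mem j n)
  rw [hy] at h1
  have h2 : (w : A) * star (w : A) = 1 := (Unitary.mem_iff.mp w.2).2
  calc (w : A) * v * b * (star (v : A) * star (w : A)) = w * (v * b * star (v : A)) * star (w : A) := by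
        simp only [mul_assoc]
    _ = v * b * star (v : A) := by rw [← h1, mul_assoc, h2, mul_one]

lemma alg_le_iSup (h0 : T.size 0 = 1) (j : ℕ) : T.alg j ≤ ⨆ k, (F.κ k).range := by
  induction j with
  | zero =>
    rintro _ ⟨x, rfl⟩
    have : Subsingleton (Fin (T.size 0)) := by rw [h0]; infer_instance
    have hx : x = algebraMap ℂ _ (x ⟨0, T.size_pos 0⟩ ⟨0, T.size_pos 0⟩) := by
      ext a b
      rw [Subsingleton.elim a ⟨0, T.size_pos 0⟩, Subsingleton.elim b ⟨0, T.size_pos 0⟩]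
      simp [Matrix.algebraMap_matrix_apply]
    change T.emb 0 x ∈ _
    rw [hx, AlgHomClass.commutes]
    exact algebraMap_mem _ _
  | succ j ih => exact (F.le_sup j).trans (sup_le ih (le_iSup (fun k => (F.κ k).range) j))

theorem isProductType (h0 : T.size 0 = 1) : IsProductType (F.action ht) := by
  refine ⟨F.d, fun k => (F.κ k).range, fun k => ?_, ?_, ?_, fun n k => ?_⟩
  · exact ⟨(reindexHom (ZMod.finEquiv (F.d k)).toEquiv).trans
      (StarAlgEquiv.ofInjective (F.κ k) (F.injective k))⟩
  · have key : ∀ k l, k < l → ∀ b ∈ (F.κ k).range, ∀ c ∈ (F.κ l).range, c * b = b * c := by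
      rintro k l hkl b hb _ ⟨y, rfl⟩
      exact F.comm l y b (T.alg_mono hkl (F.range_le k hb))
    intro k l hkl b hb c hc
    rcases lt_or_gt_of_ne hkl with h | h
    · exact (key k l h b hb c hc).symm
    · exact key l k h c hc b hb
  · refine T.dense.mono (Set.iUnion_subset fun j => ?_)
    exact F.alg_le_iSup h0 j
  · exact ⟨F.localImpl t k n, F.localImpl_mem k n, (F.localImpl t k n).2,
      fun b hb => F.action_apply_factor ht n hb⟩

lemma impl_eq_of_eventually {t t' : ℕ → ℝ} {J : ℕ} (h : ∀ j ≥ J, t j = t' j) (n : ℤ × ℤ) {j : ℕ}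
    (hj : J ≤ j) : F.impl t' J n * (F.impl t J n)⁻¹ * F.impl t j n = F.impl t' j n := by
  induction j, hj using Nat.le_induction with
  | base => group
  | succ j hj ih =>
    have : F.localImpl t j n = F.localImpl t' j n := by
      have hc : F.lift (F.clock t) j = F.lift (F.clock t') j := by
        ext
        change F.κ j (monomialMatrix _ _) = F.κ j (monomialMatrix _ _)
        rw [h j hj]
      rw [localImpl, localImpl, hc]
    rw [impl_succ, impl_succ, ← ih, this]
    simp only [mul_assoc]

/-- From the level `J` on, both actions use the same local unitaries. Their implementing unitaries
therefore differ by a left factor depending only on `n`, which is already seen at the level `J`. -/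
theorem outerConjugate {t' : ℕ → ℝ} (ht' : ∀ j, ∃ z : ℤ, t' j * F.d j = z) {J : ℕ}
    (h : ∀ j ≥ J, t j = t' j) : OuterConjugate (F.action ht) (F.action ht') := by
  refine ⟨StarAlgEquiv.refl ℂ A, fun n => (F.impl t' J n * (F.impl t J n)⁻¹ : unitary A),
    fun n => SetLike.coe_mem _, fun n a => ?_⟩
  change _ = (F.action ht').at n a
  have hc : Continuous ((F.action ht).at n) := (StarAlgEquiv.isometry _).continuous
  have hc' : Continuous ((F.action ht').at n) := (StarAlgEquiv.isometry _).continuous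
  refine T.eq_of_eqOn_alg (f := fun a => ((F.impl t' J n * (F.impl t J n)⁻¹ : unitary A) : A) *
    (F.action ht).at n a * star ((F.impl t' J n * (F.impl t J n)⁻¹ : unitary A) : A))
    (by fun_prop) hc' (fun k a ha => ?_) a
  have ha' := T.alg_mono (le_max_left k J) ha
  change _ = (F.action ht').at n a
  rw [F.action_apply ht n ha', F.action_apply ht' n ha',
    ← F.impl_eq_of_eventually h n (le_max_right k J)]
  set v := F.impl t' J n * (F.impl t J n)⁻¹
  set w := F.impl t (max k J) n
  have hvw : ((v * w : unitary A) : A) = v * w := rfl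
  rw [hvw, star_mul]
  simp only [mul_assoc]

end FactorSystem

end FactorSystem

/-! ### Uniform outerness. -/

section Outer

variable {A : Type u} [CStarAlgebra A]

open Filter

/-- Close projections are unitarily equivalent by a unitary close to `1`. -/
lemma exists_unitary_conj {p : A} (hp : IsStarProjection p) {ε : ℝ} (hε : 0 < ε) :
    ∃ η > 0, ∀ q : A, IsStarProjection q → ‖q - p‖ < η →
      ∃ z : unitary A, ‖(z : A) - 1‖ < ε ∧ (z : A) * q * star (z : A) = p := by
  set M : ℝ := ‖2 * p - 1‖ + 1 with hM
  have hM0 : 0 < M := by positivity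
  set c : ℝ := min (1 / 2) (ε / 4) with hc
  have hc0 : 0 < c := by positivity
  have hc1 : c < 1 := (min_le_left _ _).trans_lt (by norm_num)
  refine ⟨c / M, by positivity, fun q hq hqp => ?_⟩
  have hpp : p * p = p := hp.isIdempotentElem
  have hqq : q * q = q := hq.isIdempotentElem
  set v := intertwiner p q with hv
  have hvn : ‖v - 1‖ ≤ c := by
    rw [hv, intertwiner_sub_one hpp]
    calc ‖(q - p) * (2 * p - 1)‖ ≤ ‖q - p‖ * ‖2 * p - 1‖ := norm_mul_le _ _
      _ ≤ c / M * M := by gcongr; rw [hM]; linarith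
      _ = c := div_mul_cancel₀ _ hM0.ne'
  have hvu : IsUnit v := isUnit_of_norm_sub_lt_one (one_mem _) (hvn.trans_lt hc1)
  have hvp : v * p = q * v := intertwiner_mul hpp hqq
  have hvq : p * star v = star v * q := by
    have := congrArg star hvp
    rwa [star_mul, star_mul, hp.isSelfAdjoint.star_eq, hq.isSelfAdjoint.star_eq] at this
  have hcomm : Commute (star v * v) p := by
    change star v * v * p = p * (star v * v)
    rw [mul_assoc, hvp, ← mul_assoc, ← mul_assoc, hvq]
  have habs : Commute (absInv v) p := (hcomm.cfc_real _)
  let u : unitary A := ⟨polarPart v, polarPart_mem_unitary hvu⟩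
  have huv : (u : A) = v * absInv v := rfl
  have hup : (u : A) * p = q * u := by
    rw [huv, mul_assoc, habs.eq, ← mul_assoc, hvp, mul_assoc]
  have h1 : star (u : A) * u = 1 := (Unitary.mem_iff.mp u.2).1
  have hun : ‖(u : A) - 1‖ < ε := by
    refine (norm_polarPart_sub_le (one_mem _) hc1 hvn).trans_lt ?_
    have := min_le_right (1 / 2) (ε / 4)
    linarith
  refine ⟨star u, ?_, ?_⟩
  · rw [Unitary.coe_star, ← norm_star, star_sub, star_star, star_one]
    exact hun
  · rw [Unitary.coe_star, star_star, mul_assoc, ← hup, ← mul_assoc, h1, one_mul]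

lemma MatrixTower.exists_projection_near (T : MatrixTower A) {p : A} (hp : IsStarProjection p)
    {ε : ℝ} (hε : 0 < ε) :
    ∀ᶠ k in atTop, ∃ q ∈ T.alg k, IsStarProjection q ∧ ‖q - p‖ < ε := by
  obtain ⟨η, hη, h⟩ := exists_idempotent_near hp.isIdempotentElem hε
  filter_upwards [T.eventually_exists_mem_alg_near p hη] with k hk
  obtain ⟨b, hb, hbp⟩ := hk
  set c : A := (2 : ℂ)⁻¹ • (b + star b) with hc
  have hcm : c ∈ T.alg k := SMulMemClass.smul_mem _ (add_mem hb (StarMemClass.star_mem hb))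
  have hcs : IsSelfAdjoint c := by
    rw [isSelfAdjoint_iff, hc, star_smul, star_add, star_star, add_comm (star b)]
    simp
  have hcp : ‖c - p‖ < η := by
    have e : c - p = (2 : ℂ)⁻¹ • ((b - p) + star (b - p)) := by
      rw [hc, star_sub, hp.isSelfAdjoint.star_eq]
      module
    rw [e, norm_smul]
    have := norm_add_le (b - p) (star (b - p))
    rw [norm_star] at this
    have h2 : ‖(2 : ℂ)⁻¹‖ = 2⁻¹ := by simp
    rw [h2]
    linarith
  obtain ⟨q, hqq, hqp, hS⟩ := h c hcp
  exact ⟨q, hS _ (T.isClosed_alg k) (fun x hx => idemStep_mem hx) hcm,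
    ⟨hqq, hS {x | IsSelfAdjoint x} (isClosed_eq continuous_star continuous_id)
      (fun x hx => IsSelfAdjoint.idemStep hx) hcs⟩, hqp⟩

/-- An automorphism is uniformly outer if it moves partitions of unity in the relative commutants
of a tower to orthogonal ones. -/
theorem MatrixTower.isUniformlyOuterAut (T : MatrixTower A) {σ : A ≃⋆ₐ[ℂ] A}
    (hσ : ∀ᶠ k in atTop, ∃ (n : ℕ) (e : Fin n → A), (∀ i, IsStarProjection (e i)) ∧ ∑ i, e i = 1 ∧
      (∀ i, ∀ a ∈ T.alg k, e i * a = a * e i) ∧ ∀ i, e i * σ (e i) = 0) :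
    IsUniformlyOuterAut σ := by
  intro a p hp _ ε hε
  -- Replacing `z` by `1` on both sides and `a` by `b` produces an error below `η * (2 * ‖a‖ + 1)`.
  set η : ℝ := ε / (2 * ‖a‖ + 2) with hη
  have hη0 : 0 < η := by positivity
  obtain ⟨η', hη', hconj⟩ := exists_unitary_conj hp hη0
  obtain ⟨k, ⟨n, e, he, hsum, hcomm, horth⟩, ⟨q, hqk, hq, hqp⟩, b, hbk, hba⟩ :=
    (hσ.and ((T.exists_projection_near hp hη').and (T.eventually_exists_mem_alg_near a hη0))).exists
  obtain ⟨z, hz, hzq⟩ := hconj q hq hqp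
  have hz1 : star (z : A) * z = 1 := (Unitary.mem_iff.mp z.2).1
  have hf : ∀ i, IsStarProjection (q * e i) := fun i => hq.mul (he i) (hcomm i q hqk).symm
  have hproj : ∀ {r : A}, IsStarProjection r →
      IsStarProjection ((z : A) * r * star (z : A)) := by
    intro r hr
    refine ⟨?_, ?_⟩
    · change (z : A) * r * star (z : A) * ((z : A) * r * star (z : A)) = _
      calc _ = (z : A) * r * (star (z : A) * z) * (r * star (z : A)) := by simp only [mul_assoc]
        _ = (z : A) * (r * r) * star (z : A) := by rw [hz1, mul_one]; simp only [mul_assoc]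
        _ = _ := by rw [hr.isIdempotentElem]
    · rw [isSelfAdjoint_iff, star_mul, star_mul, star_star, hr.isSelfAdjoint.star_eq, mul_assoc]
  refine ⟨n, fun i => z * (q * e i) * star (z : A), fun i => hproj (hf i), ?_, fun i => ?_⟩
  · rw [← Finset.sum_mul, ← Finset.mul_sum, ← Finset.mul_sum, hsum, mul_one, hzq]
  · set f := q * e i with hfd
    set s : A := σ f with hs
    -- Since `e i` commutes with both `q` and `b`, it can be moved next to `σ (e i)`.
    have hzero : f * b * s = 0 := by
      have h1 : s = σ (e i) * σ q := by rw [hs, hfd, ← hcomm i q hqk, map_mul]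
      calc f * b * s = q * (e i * b) * s := by rw [hfd]; simp only [mul_assoc]
        _ = q * b * (e i * σ (e i)) * σ q := by rw [hcomm i b hbk, h1]; simp only [mul_assoc]
        _ = 0 := by rw [horth, mul_zero, zero_mul]
    have hσz : ‖σ (z : A) - 1‖ = ‖(z : A) - 1‖ := by
      conv_lhs => rw [← map_one σ, ← map_sub]
      exact StarAlgEquiv.norm_map σ _
    set w : A := star (z : A) * a * σ z - b with hw
    have hkey : (z : A) * f * star (z : A) * a * σ (z * f * star (z : A)) =
        z * (f * w * s) * star (σ (z : A)) := by
      rw [hw, mul_sub, sub_mul, hzero, sub_zero, map_mul, map_mul, map_star]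
      simp only [mul_assoc, hs]
    have hwn : ‖w‖ ≤ ‖a‖ * ‖(z : A) - 1‖ + ‖(z : A) - 1‖ * ‖a‖ + ‖b - a‖ := by
      have e2 : w = star (z : A) * (a * (σ z - 1)) + star ((z : A) - 1) * a - (b - a) := by
        rw [hw, star_sub, star_one]
        noncomm_ring
      have e3 : ‖star (z : A) * (a * (σ z - 1))‖ ≤ ‖a‖ * ‖(z : A) - 1‖ := by
        rw [CStarRing.norm_mem_unitary_mul _ (Unitary.star_mem z.2), ← hσz]
        exact norm_mul_le _ _
      have e4 : ‖star ((z : A) - 1) * a‖ ≤ ‖(z : A) - 1‖ * ‖a‖ := by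
        rw [← norm_star ((z : A) - 1)]
        exact norm_mul_le _ _
      rw [e2]
      exact (norm_sub_le _ _).trans (add_le_add ((norm_add_le _ _).trans (add_le_add e3 e4)) le_rfl)
    have hf1 : ‖f‖ ≤ 1 := (hf i).norm_le
    have hs1 : ‖s‖ ≤ 1 := by rw [hs, StarAlgEquiv.norm_map]; exact hf1
    have hσu : star (σ (z : A)) ∈ unitary A := Unitary.star_mem (Unitary.map_mem σ z.2)
    change ‖(z : A) * f * star (z : A) * a * σ (z * f * star (z : A))‖ < ε
    rw [hkey, CStarRing.norm_mul_mem_unitary _ hσu, CStarRing.norm_mem_unitary_mul _ z.2]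
    have hfw : ‖f * w * s‖ ≤ ‖w‖ := by
      calc ‖f * w * s‖ ≤ ‖f‖ * ‖w‖ * ‖s‖ := norm_mul₃_le
        _ ≤ 1 * ‖w‖ * 1 := by gcongr
        _ = ‖w‖ := by ring
    calc ‖f * w * s‖ ≤ ‖a‖ * ‖(z : A) - 1‖ + ‖(z : A) - 1‖ * ‖a‖ + ‖b - a‖ := hfw.trans hwn
      _ ≤ ‖a‖ * η + η * ‖a‖ + ‖b - a‖ := by gcongr
      _ < ‖a‖ * η + η * ‖a‖ + η := by gcongr
      _ = η * (2 * ‖a‖ + 1) := by ring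
      _ < η * (2 * ‖a‖ + 2) := by gcongr; norm_num
      _ = ε := div_mul_cancel₀ _ (by positivity)

/-- Conjugation of a cyclically indexed family by powers. -/
lemma zpow_mul_eq_of_cyclic {d : ℕ} {u : unitary A} {E : ZMod d → A} {s : ZMod d}
    (h : ∀ l, (u : A) * E l = E (l + s) * u) (n : ℤ) (l : ZMod d) :
    ((u ^ n : unitary A) : A) * E l = E (l + n * s) * (u ^ n : unitary A) := by
  have hinv : ∀ l, star (u : A) * E l = E (l - s) * star (u : A) := by
    intro l
    have h1 : star (u : A) * u = 1 := (Unitary.mem_iff.mp u.2).1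
    have h2 : (u : A) * star (u : A) = 1 := (Unitary.mem_iff.mp u.2).2
    have h3 := h (l - s)
    rw [sub_add_cancel] at h3
    calc star (u : A) * E l = star (u : A) * (E l * u) * star (u : A) := by
          rw [mul_assoc, mul_assoc, h2, mul_one]
      _ = star (u : A) * u * E (l - s) * star (u : A) := by rw [← h3]; simp only [mul_assoc]
      _ = _ := by rw [h1, one_mul]
  induction n generalizing l with
  | zero => simp
  | succ n ih =>
    have e : ((u ^ ((n : ℤ) + 1) : unitary A) : A) = (u ^ (n : ℤ) : unitary A) * u := by
      rw [zpow_add_one]; rfl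
    rw [e, mul_assoc, h, ← mul_assoc, ih, mul_assoc]
    congr 2
    push_cast
    ring
  | pred n ih =>
    have e : ((u ^ (-(n : ℤ) - 1) : unitary A) : A) = (u ^ (-(n : ℤ)) : unitary A) * star (u : A) := by
      rw [zpow_sub_one]; rfl
    rw [e, mul_assoc, hinv, ← mul_assoc, ih, mul_assoc]
    congr 2
    push_cast
    ring

namespace FactorSystem

variable {T : MatrixTower A} (F : FactorSystem T)

/-- The diagonal projections of the tensor factors. -/
def diag (j : ℕ) (l : ZMod (F.d j)) : A := F.κ j (Matrix.single l l 1)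

lemma shift_mul_diag (j : ℕ) (l : ZMod (F.d j)) :
    (F.lift F.shift j : A) * F.diag j l = F.diag j (l + 1) * F.lift F.shift j := by
  change F.κ j (monomialMatrix _ _) * F.κ j _ = F.κ j _ * F.κ j (monomialMatrix _ _)
  rw [← map_mul, monomialMatrix_mul_single, map_mul]

lemma clock_mul_diag (t : ℕ → ℝ) (j : ℕ) (l : ZMod (F.d j)) :
    (F.lift (F.clock t) j : A) * F.diag j l = F.diag j (l + j) * F.lift (F.clock t) j := by
  change F.κ j (monomialMatrix _ _) * F.κ j _ = F.κ j _ * F.κ j (monomialMatrix _ _)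
  rw [← map_mul, monomialMatrix_mul_single, map_mul]

lemma localImpl_mul_diag (t : ℕ → ℝ) (j : ℕ) (n : ℤ × ℤ) (l : ZMod (F.d j)) :
    (F.localImpl t j n : A) * F.diag j l =
      F.diag j (l + (n.1 + n.2 * j : ℤ)) * F.localImpl t j n := by
  have h1 := zpow_mul_eq_of_cyclic (F.shift_mul_diag j) n.1
  have h2 := zpow_mul_eq_of_cyclic (F.clock_mul_diag t j) n.2
  have e : (F.localImpl t j n : A) =
    (F.lift F.shift j ^ n.1 : unitary A) * (F.lift (F.clock t) j ^ n.2 : unitary A) := rfl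
  rw [e, mul_assoc, h2, ← mul_assoc, h1, mul_assoc]
  congr 2
  push_cast
  ring

variable {t : ℕ → ℝ} (ht : ∀ j, ∃ z : ℤ, t j * F.d j = z)

lemma action_diag (n : ℤ × ℤ) (j : ℕ) (l : ZMod (F.d j)) :
    (F.action ht).at n (F.diag j l) = F.diag j (l + (n.1 + n.2 * j : ℤ)) := by
  have hm : F.diag j l ∈ (F.κ j).range := ⟨_, rfl⟩
  rw [F.action_apply_factor ht n hm]
  change (F.localImpl t j n : A) * F.diag j l * _ = _
  rw [localImpl_mul_diag, mul_assoc, (Unitary.mem_iff.mp (F.localImpl t j n).2).2, mul_one]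

lemma isStarProjection_diag (j : ℕ) (l : ZMod (F.d j)) : IsStarProjection (F.diag j l) := by
  refine IsStarProjection.map ⟨?_, ?_⟩ (F.κ j)
  · change Matrix.single l l (1 : ℂ) * Matrix.single l l 1 = _
    simp
  · rw [isSelfAdjoint_iff, Matrix.star_eq_conjTranspose, Matrix.conjTranspose_single, star_one]

lemma sum_diag (j : ℕ) : ∑ l, F.diag j l = 1 := by
  simp only [diag]
  rw [← map_sum]
  have : ∑ l, Matrix.single l l (1 : ℂ) = (1 : Matrix (ZMod (F.d j)) (ZMod (F.d j)) ℂ) := by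
    ext a b
    rw [Matrix.sum_apply, Finset.sum_eq_single a]
    · simp [Matrix.single_apply, Matrix.one_apply]
    · intro l _ hl
      rw [Matrix.single_apply_of_row_ne hl]
    · simp
  rw [this, map_one]

lemma diag_mul_diag {j : ℕ} {l m : ZMod (F.d j)} (h : l ≠ m) : F.diag j l * F.diag j m = 0 := by
  rw [diag, diag, ← map_mul, Matrix.single_mul_single_of_ne _ _ _ _ h, map_zero]

/-- The diagonal projections of the factor `j` are shifted by `n.1 + n.2 * j`. For `j` above the sum
of the absolute values of the coordinates this integer is nonzero for `n ≠ 0`, and its absolute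
value is below `(j + 1) ^ 2`, so it remains nonzero modulo `F.d j`. This is the purpose of the
`j`-th power of the shift in the second generator. -/
theorem isUniformlyOuter (hd : ∀ j, (j + 1) ^ 2 ≤ F.d j) : IsUniformlyOuter (F.action ht) := by
  intro n hn
  refine T.isUniformlyOuterAut ?_
  filter_upwards [eventually_gt_atTop (n.1.natAbs + n.2.natAbs)] with j hj
  have hne : n.1 + n.2 * j ≠ 0 := by
    intro h0
    rcases eq_or_ne n.2 0 with h2 | h2
    · rw [h2, zero_mul, add_zero] at h0
      exact hn (Prod.ext h0 h2)
    · have h3 : n.1.natAbs = n.2.natAbs * j := by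
        rw [show n.1 = -(n.2 * j) by linarith, Int.natAbs_neg, Int.natAbs_mul, Int.natAbs_natCast]
      have h4 : 1 ≤ n.2.natAbs := Nat.one_le_iff_ne_zero.mpr (Int.natAbs_ne_zero.mpr h2)
      nlinarith
  have hs : ((n.1 + n.2 * j : ℤ) : ZMod (F.d j)) ≠ 0 := by
    intro h0
    have h1 : F.d j ∣ (n.1 + n.2 * j).natAbs := by
      rw [ZMod.intCast_zmod_eq_zero_iff_dvd] at h0
      exact Int.natCast_dvd.mp h0
    have h2 := Nat.le_of_dvd (Int.natAbs_pos.mpr hne) h1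
    have h3 := Int.natAbs_add_le n.1 (n.2 * j)
    rw [Int.natAbs_mul, Int.natAbs_natCast] at h3
    have h4 := hd j
    have h5 : n.1.natAbs ≤ j := by omega
    have h6 : n.2.natAbs ≤ j := by omega
    nlinarith
  let e := ZMod.finEquiv (F.d j)
  refine ⟨F.d j, fun i => F.diag j (e i), fun i => F.isStarProjection_diag j _, ?_,
    fun i a ha => F.comm j _ a ha, fun i => ?_⟩
  · rw [← F.sum_diag j]
    exact Fintype.sum_equiv e.toEquiv _ _ fun _ => rfl
  · rw [action_diag]
    refine F.diag_mul_diag fun h => hs ?_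
    simpa using h.symm

end FactorSystem

end Outer

/-! ### The phases with invariant `f`, and the computation of the invariant. -/

section Invariant

variable {A : Type u} [CStarAlgebra A]

open Filter

open Classical in
/-- The primes in `primeSet A` that divide `m`. -/
def primeDivisors (A : Type u) [CStarAlgebra A] (m : ℕ) : Finset (primeSet A) :=
  m.divisors.subtype (· ∈ primeSet A)

lemma mem_primeDivisors {m : ℕ} (hm : 0 < m) {p : primeSet A} :
    p ∈ primeDivisors A m ↔ (p : ℕ) ∣ m := by
  classical
  rw [primeDivisors, Finset.mem_subtype, Nat.mem_divisors, and_iff_left hm.ne']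

lemma primeDivisors_one : primeDivisors A 1 = ∅ := by
  refine Finset.eq_empty_of_forall_notMem fun p hp => ?_
  rw [mem_primeDivisors one_pos, Nat.dvd_one] at hp
  exact p.2.1.ne_one hp

/-- The sum of the `f p / θ(p)`, over the primes `p` that divide `m`. -/
def phaseSum (f : InvariantGroup A) (m : ℕ) : ℝ :=
  ∑ p ∈ primeDivisors A m, ((f p).val : ℝ) / theta A p

lemma coprime_theta {p q : primeSet A} (h : p ≠ q) : (theta A p).Coprime (theta A q) :=
  Nat.Coprime.pow _ _ ((Nat.coprime_primes p.2.1 q.2.1).mpr fun h' => h (Subtype.ext h'))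

lemma phaseSum_sub {f : InvariantGroup A} {m m' : ℕ} (hm' : 0 < m') (h : m ∣ m') :
    phaseSum f m' - phaseSum f m =
      ∑ p ∈ primeDivisors A m' \ primeDivisors A m, ((f p).val : ℝ) / theta A p := by
  have hm : 0 < m := Nat.pos_of_dvd_of_pos h hm'
  have hsub : primeDivisors A m ⊆ primeDivisors A m' := fun p hp => by
    rw [mem_primeDivisors hm] at hp
    rw [mem_primeDivisors hm']
    exact hp.trans h
  rw [phaseSum, phaseSum, ← Finset.sum_sdiff hsub, add_sub_cancel_right]

/-- Only primes dividing `m * d` but not `m` contribute to the difference. For these `θ(p)` is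
coprime to `m`, hence divides `d`. -/
lemma exists_int_phaseSum_sub (f : InvariantGroup A) {m d : ℕ} (h0 : 0 < m * d)
    (h : ∀ p : primeSet A, (p : ℕ) ∣ m * d → theta A p ∣ m * d) :
    ∃ z : ℤ, (phaseSum f (m * d) - phaseSum f m) * d = z := by
  have hm : 0 < m := Nat.pos_of_mul_pos_right h0
  rw [phaseSum_sub h0 (Dvd.intro _ rfl), Finset.sum_mul]
  have key : ∀ p ∈ primeDivisors A (m * d) \ primeDivisors A m,
      ∃ z : ℤ, ((f p).val : ℝ) / theta A p * d = z := by
    intro p hp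
    rw [Finset.mem_sdiff, mem_primeDivisors h0, mem_primeDivisors hm] at hp
    have hcop : (theta A p).Coprime m := Nat.Coprime.pow_left _ ((p.2.1.coprime_iff_not_dvd).mpr hp.2)
    obtain ⟨c, hc⟩ := hcop.dvd_of_dvd_mul_left (h p hp.1)
    have hθ : (theta A p : ℝ) ≠ 0 := by exact_mod_cast (theta_pos p).ne'
    refine ⟨(f p).val * c, ?_⟩
    rw [hc]
    push_cast
    field_simp
  choose! z hz using key
  exact ⟨∑ p ∈ primeDivisors A (m * d) \ primeDivisors A m, z p, by
    rw [Finset.sum_congr rfl hz]; push_cast; rfl⟩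

/-- For `q ≠ p` the coprime numbers `θ(p)` and `θ(q)` both divide the size, so `f q / θ(q)` is
`θ(p)` times an integer over the size and vanishes in the quotient. -/
lemma MatrixTower.phaseSum_sub_mem (T : MatrixTower A) (f : InvariantGroup A) {p : primeSet A}
    (φ : Matrix (Fin (theta A p)) (Fin (theta A p)) ℂ →⋆ₐ[ℂ] A) {j : ℕ}
    (hp : theta A p ∣ T.size j) (h : ∀ q : primeSet A, (q : ℕ) ∣ T.size j → theta A q ∣ T.size j) :
    phaseSum f (T.size j) - ((f p).val : ℝ) / theta A p ∈
      traceK0 (StarSubalgebra.centralizer ℂ (φ.range : Set A)) := by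
  have hpm : p ∈ primeDivisors A (T.size j) :=
    (mem_primeDivisors (T.size_pos j)).mpr (theta_dvd_of_dvd hp)
  rw [phaseSum, ← Finset.sum_erase_add _ _ hpm, add_sub_cancel_right]
  refine sum_mem fun q hq => ?_
  rw [Finset.mem_erase, mem_primeDivisors (T.size_pos j)] at hq
  obtain ⟨c, hc⟩ := (coprime_theta (Ne.symm hq.1)).mul_dvd_of_dvd_of_dvd hp (h q hq.2)
  have hc0 : (c : ℝ) ≠ 0 := by
    rintro hc0
    rw [Nat.cast_eq_zero.mp hc0, mul_zero] at hc
    exact (T.size_pos j).ne' hc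
  have h1 : (theta A p : ℝ) ≠ 0 := by exact_mod_cast (theta_pos p).ne'
  have h2 : (theta A q : ℝ) ≠ 0 := by exact_mod_cast (theta_pos q).ne'
  have := T.theta_div_mem_traceK0 φ j ((f q).val * c : ℕ)
  convert this using 1
  rw [hc]
  push_cast
  field_simp

lemma contDiff_scalarUnitary_mul (s : ℝ) :
    ContDiff ℝ ∞ fun r : ℝ => (scalarUnitary A (s * r) : A) := by
  have h : (fun r : ℝ => (scalarUnitary A (s * r) : A)) = fun r : ℝ =>
      (selfAdjoint.expUnitary (r • ((2 * Real.pi * s) • (1 : selfAdjoint A))) : A) := by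
    funext r
    rw [scalarUnitary, smul_smul]
    congr 3
    ring
  rw [h]
  exact contDiff_expUnitary_smul _

lemma scalarUnitary_neg (s : ℝ) : scalarUnitary A (-s) = (scalarUnitary A s)⁻¹ := by
  rw [eq_inv_iff_mul_eq_one, ← scalarUnitary_add, neg_add_cancel, scalarUnitary_zero]

/-- A choice for an action which is inner on an algebra of a tower. -/
theorem MatrixTower.exists_isChoice (T : MatrixTower A) (h0 : T.size 0 = 1) {α : Action A}
    {p : primeSet A} {j : ℕ} (hp : theta A p ∣ T.size j) {X Y : unitary A} {s : ℝ}
    (hXm : (X : A) ∈ T.alg j) (hYm : (Y : A) ∈ T.alg j)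
    (hX : ∀ a ∈ T.alg j, α.at (1, 0) a = X * a * star (X : A))
    (hY : ∀ a ∈ T.alg j, α.at (0, 1) a = Y * a * star (Y : A))
    (hXY : X * Y = scalarUnitary A s * (Y * X)) :
    ∃ (δ : ℝ) (A₀ A₁ : StarSubalgebra ℂ A) (u₁ u₂ : A) (h : ℝ → A),
      IsChoice 1 α p δ A₀ A₁ u₁ u₂ h := by
  obtain ⟨χ, hχ, -, hle⟩ := exists_interpolation (T.size_pos 0) (T.size_pos j) (T.injective j)
    (T.mono (Nat.zero_le j)) (by rw [h0]; exact one_dvd _) hp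
  have hinner : ∀ (Z : unitary A) (a : A),
      ((Z⁻¹ : unitary A) : A) * (Z * a * star (Z : A)) * star ((Z⁻¹ : unitary A) : A) = a := by
    intro Z a
    have h1 : star (Z : A) * Z = 1 := (Unitary.mem_iff.mp Z.2).1
    have h2 : ((Z⁻¹ : unitary A) : A) = star (Z : A) := rfl
    rw [h2, star_star]
    calc star (Z : A) * (Z * a * star (Z : A)) * Z =
        (star (Z : A) * Z) * a * (star (Z : A) * Z) := by simp only [mul_assoc]
      _ = a := by rw [h1, one_mul, mul_one]
  have hone : ∀ n a, (1 : Action A).at n a = a := fun _ _ => rfl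
  have hδ : (0 : ℝ) < 1 / 64 / 7 := by norm_num
  -- Undoing the inner automorphisms makes the perturbed action trivial on `T.alg j`, which contains
  -- the chosen copy of the matrix algebra of size `θ(p)`. The endpoint is then the scalar `exp
  -- (-2πi s)`, reached through scalars.
  refine ⟨1 / 64, χ.range, χ.range, (X⁻¹ : unitary A), (Y⁻¹ : unitary A),
    fun r => scalarUnitary A (-s * r), T.isAdmissibleConst, ⟨StarAlgEquiv.ofInjective χ hχ⟩,
    finiteDimensional_range χ, fun w hw => ?_, SetLike.coe_mem _, SetLike.coe_mem _,
    fun a ha => ?_, ?_, fun t _ a _ => ?_⟩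
  · exact ⟨⟨w, hw, by rwa [sub_self, norm_zero]⟩,
      ⟨w, hw, by change ‖w - w‖ < _; rwa [sub_self, norm_zero]⟩,
      ⟨w, hw, by change ‖w - w‖ < _; rwa [sub_self, norm_zero]⟩⟩
  · simp only [hone, or_self] at ha ⊢
    have ha' : a ∈ T.alg j := hle ha.1
    rw [hX a ha', hY a ha', hinner, hinner, sub_self, norm_zero]
    exact ⟨hδ, hδ⟩
  · refine isUnitaryPath_of_contDiff (contDiff_scalarUnitary_mul (-s)) (fun t => SetLike.coe_mem _)
      (by rw [mul_zero, scalarUnitary_zero]; rfl) ?_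
    have hXm' : ((X⁻¹ : unitary A) : A) ∈ T.alg j := StarMemClass.star_mem hXm
    have hYm' : ((Y⁻¹ : unitary A) : A) ∈ T.alg j := StarMemClass.star_mem hYm
    rw [hX _ hYm', hY _ hXm', mul_one, scalarUnitary_neg]
    have hgroup : (scalarUnitary A s)⁻¹ =
        X⁻¹ * (X * Y⁻¹ * X⁻¹) * (Y⁻¹ * (Y * X⁻¹ * Y⁻¹))⁻¹ := by
      have h1 := (commute_scalarUnitary s (Y * X)).eq
      rw [h1] at hXY
      have h2 : scalarUnitary A s = (Y * X)⁻¹ * (X * Y) := by rw [hXY]; group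
      rw [h2]
      group
    rw [hgroup]
    rfl
  · have := congrArg Subtype.val (commute_scalarUnitary (A := A) (-s * t) 1).eq
    rw [coe_scalarUnitary, smul_mul_assoc, mul_smul_comm, one_mul, mul_one, sub_self, norm_zero]
    norm_num

namespace FactorSystem

variable {T : MatrixTower A} (F : FactorSystem T)

/-- The phases of the action with invariant `f`. -/
def phases (T : MatrixTower A) (f : InvariantGroup A) (j : ℕ) : ℝ :=
  phaseSum f (T.size (j + 1)) - phaseSum f (T.size j)

lemma exists_int_phases (hθ : ∀ j, ∀ p : primeSet A, (p : ℕ) ∣ T.size j → theta A p ∣ T.size j)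
    (f : InvariantGroup A) (j : ℕ) : ∃ z : ℤ, phases T f j * F.d j = z := by
  have := exists_int_phaseSum_sub f (m := T.size j) (d := F.d j)
    (by rw [F.size_succ]; exact T.size_pos _) (by rw [F.size_succ]; exact hθ _)
  rwa [F.size_succ] at this

/-- The phases telescope: on `T.alg j` the two implementing unitaries commute up to `exp (-2πi r)`
with `r` the phase sum of `T.size j`. Modulo the image of `K₀(A ∩ A₀')`, the value of any admitted
path is thus `r`, hence `f p / θ(p)` once `θ(p)` divides the size. -/
theorem hasInvariant (h0 : T.size 0 = 1)
    (hθ : ∀ j, ∀ p : primeSet A, (p : ℕ) ∣ T.size j → theta A p ∣ T.size j)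
    (f : InvariantGroup A) : HasInvariant (F.action (F.exists_int_phases hθ f)) f := by
  have hXY : ∀ j, F.impl (phases T f) j (1, 0) * F.impl (phases T f) j (0, 1) =
      scalarUnitary A (-phaseSum f (T.size j)) *
        (F.impl (phases T f) j (0, 1) * F.impl (phases T f) j (1, 0)) := by
    intro j
    have h1 : -phaseSum f (T.size j) = ∑ i ∈ Finset.range j, -phases T f i := by
      rw [Finset.sum_neg_distrib, neg_inj]
      simp only [phases]
      have h2 : phaseSum f 1 = 0 := by rw [phaseSum, primeDivisors_one, Finset.sum_empty]
      rw [Finset.sum_range_sub (fun i => phaseSum f (T.size i)), h0, h2, sub_zero]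
    rw [h1]
    simp only [impl, implementer, zpow_one, zpow_zero, mul_one, one_mul]
    exact partialProd_mul (F.isFactorSeq _) (F.isFactorSeq _)
      (F.shift_mul_clock (F.exists_int_phases hθ f)) j
  have hX := fun j a (ha : a ∈ T.alg j) => F.action_apply (F.exists_int_phases hθ f) (1, 0) ha
  have hY := fun j a (ha : a ∈ T.alg j) => F.action_apply (F.exists_int_phases hθ f) (0, 1) ha
  intro p
  obtain ⟨k, hk⟩ := T.theta_dvd_size p
  refine ⟨T.exists_isChoice h0 hk (F.impl_mem k (1, 0)) (F.impl_mem k (0, 1)) (hX k) (hY k) (hXY k),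
    fun δ A₀ A₁ u₁ u₂ h hc => ?_⟩
  obtain ⟨j, hj, hkj⟩ := ((T.eventually_pathValue_add_mem hc hX hY hXY).and
    (eventually_ge_atTop k)).exists
  obtain ⟨φ, -, hφ⟩ := hc.full.exists_hom
  have hm := T.phaseSum_sub_mem f φ (hk.trans (T.size_dvd hkj)) (hθ j)
  rw [hφ] at hm
  have := add_mem hj hm
  rw [HasClass]
  convert this using 1
  ring

theorem outerConjugate_phases
    (hθ : ∀ j, ∀ p : primeSet A, (p : ℕ) ∣ T.size j → theta A p ∣ T.size j)
    {f g : InvariantGroup A} (h : {p | f p ≠ g p}.Finite) :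
    OuterConjugate (F.action (F.exists_int_phases hθ f)) (F.action (F.exists_int_phases hθ g)) := by
  -- Each prime contributes only to the phase of the level at which it first enters. Beyond `J` all
  -- the finitely many primes where `f` and `g` differ have entered.
  have hJ : ∀ᶠ J in atTop, ∀ p ∈ {p | f p ≠ g p}, theta A p ∣ T.size J := by
    rw [h.eventually_all]
    intro p _
    obtain ⟨k, hk⟩ := T.theta_dvd_size p
    filter_upwards [eventually_ge_atTop k] with j hj using hk.trans (T.size_dvd hj)
  obtain ⟨J, hJ⟩ := hJ.exists
  refine F.outerConjugate _ _ (J := J) fun j hj => ?_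
  rw [phases, phases, phaseSum_sub (T.size_pos _) (T.size_dvd (Nat.le_succ j)),
    phaseSum_sub (T.size_pos _) (T.size_dvd (Nat.le_succ j))]
  refine Finset.sum_congr rfl fun p hp => ?_
  by_cases hfg : f p = g p
  · rw [hfg]
  · have h1 := theta_dvd_of_dvd ((hJ p hfg).trans (T.size_dvd hj))
    rw [Finset.mem_sdiff, mem_primeDivisors (T.size_pos j)] at hp
    exact absurd h1 hp.2

end FactorSystem

end Invariant

end UHFAction

end

theorem mainTheorem8 (A : Type*) [CStarAlgebra A] (hA : UHFAction.IsUHF A) :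
    ∃ γ : UHFAction.InvariantGroup A → UHFAction.Action A,
      (∀ f, UHFAction.IsUniformlyOuter (γ f) ∧ UHFAction.IsProductType (γ f) ∧
        UHFAction.HasInvariant (γ f) f) ∧
      ∀ f g : UHFAction.InvariantGroup A, {p | f p ≠ g p}.Finite →
        UHFAction.OuterConjugate (γ f) (γ g) := by
  obtain ⟨T₀⟩ := hA.exists_matrixTower
  obtain ⟨T, h0, hgrow, hθ⟩ := T₀.exists_refinement hA.1
  obtain ⟨F⟩ := T.exists_factorSystem
  -- The quotient of consecutive sizes is the size of the tensor factor, so the growth of the tower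
  -- is exactly what uniform outerness needs.
  have hd : ∀ j, (j + 1) ^ 2 ≤ F.d j := fun j =>
    Nat.le_of_mul_le_mul_left ((hgrow j).trans (F.size_succ j).ge) (T.size_pos j)
  exact ⟨fun f => F.action (F.exists_int_phases hθ f),
    fun f => ⟨F.isUniformlyOuter _ hd, F.isProductType _ h0, F.hasInvariant h0 hθ f⟩,
    fun f g h => F.outerConjugate_phases hθ h⟩
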